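/- Let $N\ge 1$, $V=\{1,\dots,N\}$, and let $\theta\in\mathbb R$ be such that $\theta\ge 0$, or $\theta<0$ and $1/|\theta|\in\mathbb N$. Let $\Lambda_\theta=\mathbb N=\{0,1,2,\dots\}$ if $\theta\ge 0$ and $\Lambda_\theta=\{0,1,\dots,1/|\theta|\}$ if $\theta<0$. Let $p:V\times V\to[0,\infty)$ be symmetric, let $c_\ell,c_r,\rho_\ell,\rho_r\ge 0$, and suppose that $1+\theta\rho_\ell\ge 0$ and $1+\theta\rho_r\ge 0$. Write $\delta_i$ for the configuration with one particle, at $i$, and $\eta^{i,j}=\eta-\delta_i+\delta_j$. Consider the Markov jump process on $\Lambda_\theta^V$ with generator $$\begin{aligned}\mathcal L^{\rm res}_\theta f(\eta)=&\sum_{i,j\in V}p(i,j)\,\eta_i(1+\theta\eta_j)[f(\eta^{i,j})-f(\eta)]\\&+c_\ell\{\rho_\ell(1+\theta\eta_1)[f(\eta+\delta_1)-f(\eta)]+(1+\theta\rho_\ell)\eta_1[f(\eta-\delta_1)-f(\eta)]\}\\&+c_r\{\rho_r(1+\theta\eta_N)[f(\eta+\delta_N)-f(\eta)]+(1+\theta\rho_r)\eta_N[f(\eta-\delta_N)-f(\eta)]\},\end{aligned}$$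 and suppose that it has a unique stationary probability measure $\mu$ (the non-equilibrium steady state); $\mathbb E_\mu$ denotes expectation with respect to $\mu$. Let $V^*=V\cup\{0,N+1\}$ and let $\{\xi(t)\}_{t\ge 0}$ be the dual Markov jump process with absorbing sites $0$ and $N+1$, on the configurations $\xi\in\mathbb N^{V^*}$ with $\xi_i\in\Lambda_\theta$ for $i\in V$, whose generator is $$\mathcal L^{\rm Dual}_\theta f(\xi)=\sum_{i,j\in V}p(i,j)\,\xi_i(1+\theta\xi_j)[f(\xi^{i,j})-f(\xi)]+c_\ell\,\xi_1[f(\xi^{1,0})-f(\xi)]+c_r\,\xi_N[f(\xi^{N,N+1})-f(\xi)],$$ with law $\mathbb P_\xi$ when started from $\xi$. This process does not involve $\rho_\ell,\rho_r$. Let $X^{\rm rw}$ be the random walk on $V^*$ performed by a single dual particle, with law $\mathbf P_x$ when started from $x$; let $\mathbb P^{\rm irw}_\xi$ be the law of the configuration process of independent copies of $X^{\rm rw}$ started from the particle positions of $\xi$. Set $$\mathbb P_\xi(\xi_0(\infty)=0)=\lim_{t\to\infty}\mathbb P_\xi(\xi_0(t)=0),\quad \mathbb P^{\rm irw}_\xi(\xi_0(\infty)=0)=\lim_{t\to\infty}\mathbb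 P^{\rm irw}_\xi(\xi_0(t)=0),\quad q(x,y)=\lim_{t\to\infty}\mathbf P_x(X^{\rm rw}(t)=y).$$ Then the following holds, where all limits that occur exist, all expectations that occur are finite, and $0^0=1$. 1. For every $x\in V$, $\ \mathbb E_\mu[\eta_x]=\rho_\ell\,q(x,0)+\rho_r\,q(x,N+1)$. 2. For every $n\ge 0$ and all pairwise distinct $x_1,\dots,x_n\in V$, $$\mathbb E_\mu\Big[\prod_{i=1}^n\eta_{x_i}\Big]-\prod_{i=1}^n\mathbb E_\mu[\eta_{x_i}]=\sum_{\kappa=2}^n\gamma_\kappa(x_1,\dots,x_n)\,(\rho_r-\rho_\ell)^\kappa\,\rho_\ell^{\,n-\kappa},$$ where $$\gamma_\kappa(x_1,\dots,x_n)=\sum_{1\le i_1<\dots<i_\kappa\le n}\Big(\mathbb P_{\xi}(\xi_0(\infty)=0)-\mathbb P^{\rm irw}_{\xi}(\xi_0(\infty)=0)\Big)\Big|_{\xi=\delta_{x_{i_1}}+\dots+\delta_{x_{i_\kappa}}}.$$ 3. In particular, for $x\ne y$ in $V$, $$\mathbb E_\mu[\eta_x\eta_y]-\mathbb E_\mu[\eta_x]\,\mathbb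 E_\mu[\eta_y]=(\rho_r-\rho_\ell)^2\Big(\mathbb P_{\delta_x+\delta_y}(\xi_0(\infty)=0)-\mathbb P^{\rm irw}_{\delta_x+\delta_y}(\xi_0(\infty)=0)\Big),$$ and the last factor does not depend on $\rho_\ell,\rho_r$. -/

import Mathlib

open MeasureTheory Filter Topology
open scoped ENNReal NNReal

noncomputable section

namespace ConsistentIPS

/-! ### Continuous-time Markov jump processes -/

/-- The data of a Markov jump process on `S`: from the state `x`, each of the finitely many moves
`m` is performed at rate `rate m x` and leads to the state `move m x`. -/
structure JumpSystem (S M : Type*) where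
  rate : M → S → ℝ
  move : M → S → S

namespace JumpSystem

variable {S M : Type*} [Fintype M]

/-- The generator `f ↦ ∑ₘ rate m x (f (move m x) - f x)`. -/
def generator (Q : JumpSystem S M) (f : S → ℝ) (x : S) : ℝ :=
  ∑ m, Q.rate m x * (f (Q.move m x) - f x)

/-- The total rate at which moves are performed from `x`. (Negative numbers are not rates and are
read as `0`; the systems below have nonnegative rates on their state spaces.) -/
def exitRate (Q : JumpSystem S M) (x : S) : ℝ≥0 := ∑ m, (Q.rate m x).toNNReal

/-- `Q.iter n t f x` is `E_x[f(X_t); fewer than n moves have been performed up to time t]`,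
computed by conditioning on the time `s` and the kind `m` of the first move. -/
def iter (Q : JumpSystem S M) : ℕ → ℝ → (S → ℝ≥0∞) → S → ℝ≥0∞
  | 0, _, _, _ => 0
  | n + 1, t, f, x =>
      ENNReal.ofReal (Real.exp (-(Q.exitRate x : ℝ) * t)) * f x +
        ∫⁻ s in Set.Ioc 0 t, ENNReal.ofReal (Real.exp (-(Q.exitRate x : ℝ) * s)) *
          ∑ m, ((Q.rate m x).toNNReal : ℝ≥0∞) * Q.iter n (t - s) f (Q.move m x)

/-- The transition probability `P_x(X_t ∈ A)` of the (minimal) Markov jump process. -/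
def prob (Q : JumpSystem S M) (t : ℝ) (x : S) (A : Set S) : ℝ≥0∞ :=
  ⨆ n, Q.iter n t (A.indicator 1) x

end JumpSystem

/-! ### The process with reservoirs -/

/-- The two ends of the system. They label the two reservoirs and also the two absorbing sites
of the dual process (`left` is the site `0`, `right` is the site `N + 1`). -/
inductive Side
  | left
  | right
  deriving DecidableEq

instance : Fintype Side := ⟨{.left, .right}, fun s => by cases s <;> simp⟩

/-- The admissible interaction parameters: `θ ≥ 0`, or `θ < 0` with `1 / |θ|` an integer. -/
def AdmissibleTheta (θ : ℝ) : Prop := 0 ≤ θ ∨ ∃ k : ℕ, 0 < k ∧ θ = -(1 / (k : ℝ))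

/-- The possible occupation numbers of a site: all of `ℕ` if `θ ≥ 0`, and `{0, …, 1 / |θ|}`
if `θ < 0`. -/
def occupation (θ : ℝ) : Set ℕ := {k | 0 ≤ θ ∨ (k : ℝ) ≤ 1 / |θ|}

section

variable {V : Type*} [Fintype V] [DecidableEq V]

/-- The configuration `δ_i` with a single particle, located at `i`. -/
def delta {W : Type*} [DecidableEq W] (i : W) : W → ℕ := Pi.single i 1

/-- The configuration space `Ω_θ`, as a subset of `ℕ^V`. -/
def stateSpace (V : Type*) (θ : ℝ) : Set (V → ℕ) := {η | ∀ i, η i ∈ occupation θ}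

/-- The process with reservoirs. Its moves are the jumps from `i` to `j` in the bulk, the
injection of a particle by the reservoir `s`, and the removal of a particle by the reservoir `s`,
where the reservoir `s` acts on the site `site s`, at rate `c s`, and has density `ρ s`.
(The subtraction of `delta i` is used at positive rate only if `η i ≥ 1`.) -/
def reservoirSystem (θ : ℝ) (p : V → V → ℝ) (site : Side → V) (c ρ : Side → ℝ) :
    JumpSystem (V → ℕ) ((V × V) ⊕ (Side ⊕ Side)) where
  rate
    | .inl (i, j), η => p i j * η i * (1 + θ * η j)
    | .inr (.inl s), η => c s * (ρ s * (1 + θ * η (site s)))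
    | .inr (.inr s), η => c s * ((1 + θ * ρ s) * η (site s))
  move
    | .inl (i, j), η => η - delta i + delta j
    | .inr (.inl s), η => η + delta (site s)
    | .inr (.inr s), η => η - delta (site s)

theorem reservoirSystem_generator (θ : ℝ) (p : V → V → ℝ) (site : Side → V) (c ρ : Side → ℝ)
    (f : (V → ℕ) → ℝ) (η : V → ℕ) :
    (reservoirSystem θ p site c ρ).generator f η =
      ∑ i, ∑ j, p i j * η i * (1 + θ * η j) * (f (η - delta i + delta j) - f η) +
      ∑ s, c s * (ρ s * (1 + θ * η (site s)) * (f (η + delta (site s)) - f η) +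
        (1 + θ * ρ s) * η (site s) * (f (η - delta (site s)) - f η)) := by
  simp only [JumpSystem.generator, reservoirSystem, Fintype.sum_sum_type, Fintype.sum_prod_type,
    ← Finset.sum_add_distrib]
  congr 1
  exact Finset.sum_congr rfl fun s _ => by ring

/-- `μ` is a stationary probability measure, on the state space `Ω_θ`, of the process with
reservoirs: started from `μ`, the process has law `μ` at every time. -/
def IsStationary (θ : ℝ) (p : V → V → ℝ) (site : Side → V) (c ρ : Side → ℝ)
    (μ : Measure (V → ℕ)) : Prop :=
  IsProbabilityMeasure μ ∧ μ (stateSpace V θ)ᶜ = 0 ∧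
    ∀ t : ℝ, 0 ≤ t → ∀ A : Set (V → ℕ),
      ∫⁻ η, (reservoirSystem θ p site c ρ).prob t η A ∂μ = μ A

/-! ### The dual process with absorbing sites -/

/-- The dual process, on configurations over `V* = V ∪ {left, right}`: particles interact in `V`
as before, and a particle at `site s` is absorbed at `s` at rate `c s`. -/
def dualSystem (θ : ℝ) (p : V → V → ℝ) (site : Side → V) (c : Side → ℝ) :
    JumpSystem (V ⊕ Side → ℕ) ((V × V) ⊕ Side) where
  rate
    | .inl (i, j), ξ => p i j * ξ (.inl i) * (1 + θ * ξ (.inl j))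
    | .inr s, ξ => c s * ξ (.inl (site s))
  move
    | .inl (i, j), ξ => ξ - delta (.inl i) + delta (.inl j)
    | .inr s, ξ => ξ - delta (.inl (site s)) + delta (.inr s)

theorem dualSystem_generator (θ : ℝ) (p : V → V → ℝ) (site : Side → V) (c : Side → ℝ)
    (f : (V ⊕ Side → ℕ) → ℝ) (ξ : V ⊕ Side → ℕ) :
    (dualSystem θ p site c).generator f ξ =
      ∑ i, ∑ j, p i j * ξ (.inl i) * (1 + θ * ξ (.inl j)) *
        (f (ξ - delta (.inl i) + delta (.inl j)) - f ξ) +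
      ∑ s, c s * ξ (.inl (site s)) * (f (ξ - delta (.inl (site s)) + delta (.inr s)) - f ξ) := by
  simp only [JumpSystem.generator, dualSystem, Fintype.sum_sum_type, Fintype.sum_prod_type]

/-- The configuration `φ(y) = ∑ᵢ δ_{y i}` of a finite family `y` of particle positions. -/
def config {ι W : Type*} [Fintype ι] [DecidableEq W] (y : ι → W) : W → ℕ := ∑ i, delta (y i)

/-- `P_ξ(ξ_0(t) = 0)`: no particle of the dual process has been absorbed at the left absorbing
site up to time `t`. -/
def noLeftProb (θ : ℝ) (p : V → V → ℝ) (site : Side → V) (c : Side → ℝ) (t : ℝ)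
    (ξ : V ⊕ Side → ℕ) : ℝ :=
  ((dualSystem θ p site c).prob t ξ {ξ' | ξ' (.inr .left) = 0}).toReal

/-- `P_ξ(ξ_0(∞) = 0)`. -/
def noLeftLimit (θ : ℝ) (p : V → V → ℝ) (site : Side → V) (c : Side → ℝ)
    (ξ : V ⊕ Side → ℕ) : ℝ :=
  limUnder atTop fun t => noLeftProb θ p site c t ξ

/-- `P_u(X^rw(t) = v)` for the random walk followed by the dual process when it has a single
particle. -/
def walkProb (θ : ℝ) (p : V → V → ℝ) (site : Side → V) (c : Side → ℝ) (t : ℝ)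
    (u v : V ⊕ Side) : ℝ :=
  ((dualSystem θ p site c).prob t (delta u) {delta v}).toReal

/-- `q(u, v) = P_u(X^rw(∞) = v)`. -/
def walkLimit (θ : ℝ) (p : V → V → ℝ) (site : Side → V) (c : Side → ℝ)
    (u v : V ⊕ Side) : ℝ :=
  limUnder atTop fun t => walkProb θ p site c t u v

/-- `P^irw(ξ_0(t) = 0)` for independent copies of the random walk started from the positions
`y i`: the sum, over the joint positions `z` at time `t` with no walker at the left absorbing
site, of the product of the transition probabilities. -/
def irwNoLeftProb {ι : Type*} [Fintype ι] [DecidableEq ι] (θ : ℝ) (p : V → V → ℝ)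
    (site : Side → V) (c : Side → ℝ) (t : ℝ) (y : ι → V ⊕ Side) : ℝ :=
  ∑ z : ι → V ⊕ Side,
    if config z (.inr .left) = 0 then ∏ i, walkProb θ p site c t (y i) (z i) else 0

/-- `P^irw(ξ_0(∞) = 0)`. -/
def irwNoLeftLimit {ι : Type*} [Fintype ι] [DecidableEq ι] (θ : ℝ) (p : V → V → ℝ)
    (site : Side → V) (c : Side → ℝ) (y : ι → V ⊕ Side) : ℝ :=
  limUnder atTop fun t => irwNoLeftProb θ p site c t y

/-- `γ_κ(x)`: the sum over the sub-families `y` of `x` of size `κ` of the difference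
`P_{φ(y)}(ξ_0(∞) = 0) - P^irw_{φ(y)}(ξ_0(∞) = 0)`. -/
def gammaCoeff (θ : ℝ) (p : V → V → ℝ) (site : Side → V) (c : Side → ℝ) {n : ℕ}
    (x : Fin n → V) (κ : ℕ) : ℝ :=
  ∑ I ∈ (Finset.univ : Finset (Fin n)).powersetCard κ,
    (noLeftLimit θ p site c (config fun i : I => Sum.inl (x i)) -
      irwNoLeftLimit θ p site c fun i : I => (Sum.inl (x i) : V ⊕ Side))

end

/-- On `V = {1, …, N}`, here `Fin N`, the left reservoir acts on the first site and the right
reservoir on the last one. -/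
def endSite {N : ℕ} (hN : 0 < N) : Side → Fin N
  | .left => ⟨0, hN⟩
  | .right => ⟨N - 1, Nat.sub_lt hN Nat.one_pos⟩

end ConsistentIPS

end

/-! The process with reservoirs is dual to the absorbing process. For any centre `r`, take the
product over sites of a one-site function `siteDual θ r (ξ i) (η i)` (a binomial transform of the
scaled falling factorials), times the weight `∏ (ρ s - r) ^ ξ s` of the absorbed particles. The
generator with reservoirs acting on `η` and the dual generator acting on `ξ` give the same result on
this function (`generator_configDual`). For particles at distinct sites it is `∏ (η x - r)`.

Choose `r = ρ_left`. An absorbed configuration then has weight `0` as soon as one particle went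
left, and `(ρ_right - ρ_left) ^ n` if all `n` went right. Letting `t → ∞` in the stationarity
relation gives `E ∏ (η x - ρ_left) = (ρ_right - ρ_left) ^ n * P(ξ_0(∞) = 0)` (`integral_configDual`,
`integral_prod_sub`). Writing each `η x` as `(η x - ρ_left) + ρ_left` and expanding over subsets
gives the moments. The product of the one-point functions has the same expansion with independent
walks, and the terms of at most one site cancel (`integral_prod_apply`).

Two points need work. The first is absorption. Uniqueness of `μ` enters only here: a nonempty set of
sites cut off from the active reservoirs would carry either no particle or one uniformly placed
particle, which yields two stationary measures (`isolated_eq_empty`). So the walk has a finite mean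
absorption time (`exists_isAbsorptionTime`), and the interacting particles are absorbed
exponentially fast because the interaction cancels on linear functions (`dual_generator_linear`,
`tendsto_unabsorbed`).

The second is unboundedness when `θ ≥ 0`. The minimal semigroup acts on nonnegative functions and is
controlled by comparison with nonnegative supersolutions (`expect_le_of_isSupersolution`). With the
nonnegative duality function centred at `0`, the comparison gives finite moments
(`lintegral_configDual_lt_top`). With a Lyapunov correction it gives stationarity against solutions
of either sign and polynomial growth (`integral_le_of_solution`). -/

namespace ConsistentIPS

namespace JumpSystem

/-! ### General facts on minimal jump processes -/

section General

variable {S M : Type*} [Fintype M]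

/-- `E_x[f(X_t)]` for the minimal jump process. -/
noncomputable def expect (Q : JumpSystem S M) (t : ℝ) (f : S → ℝ≥0∞) (x : S) : ℝ≥0∞ :=
  ⨆ n, Q.iter n t f x

theorem measurable_iter (Q : JumpSystem S M) (f : S → ℝ≥0∞) (n : ℕ) :
    ∀ x, Measurable fun t => Q.iter n t f x := by
  induction n with
  | zero => intro x; simp only [iter]; exact measurable_const
  | succ n ih =>
    intro x
    simp only [iter]
    refine Measurable.add (by fun_prop) ?_
    -- The domain of integration depends on `t`. As an indicator on the plane, the integrand becomes
    -- jointly measurable and Tonelli applies.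
    have h : ∀ t : ℝ, (∫⁻ s in Set.Ioc 0 t, ENNReal.ofReal (Real.exp (-(Q.exitRate x : ℝ) * s)) *
          ∑ m, ((Q.rate m x).toNNReal : ℝ≥0∞) * Q.iter n (t - s) f (Q.move m x)) =
        ∫⁻ s, ({q : ℝ × ℝ | 0 < q.2 ∧ q.2 ≤ q.1}.indicator
          (fun q => ENNReal.ofReal (Real.exp (-(Q.exitRate x : ℝ) * q.2)) *
          ∑ m, ((Q.rate m x).toNNReal : ℝ≥0∞) * Q.iter n (q.1 - q.2) f (Q.move m x))) (t, s) := by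
      intro t
      rw [← lintegral_indicator measurableSet_Ioc]
      rfl
    simp_rw [h]
    refine Measurable.lintegral_prod_right' (f := Set.indicator _ _) ?_
    refine Measurable.indicator ?_ ?_
    · refine Measurable.mul (by fun_prop) (Finset.measurable_sum _ fun m _ => ?_)
      exact Measurable.const_mul ((ih _).comp (measurable_fst.sub measurable_snd)) _
    · exact (measurableSet_lt measurable_const measurable_snd).inter
        (measurableSet_le measurable_snd measurable_fst)

theorem measurable_iter_sub (Q : JumpSystem S M) (f : S → ℝ≥0∞) (n : ℕ) (t : ℝ) (x : S) :
    Measurable fun s => ENNReal.ofReal (Real.exp (-(Q.exitRate x : ℝ) * s)) *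
      ∑ m, ((Q.rate m x).toNNReal : ℝ≥0∞) * Q.iter n (t - s) f (Q.move m x) := by
  refine Measurable.mul (by fun_prop) (Finset.measurable_sum _ fun m _ => ?_)
  exact Measurable.const_mul ((Q.measurable_iter f n _).comp (measurable_const.sub measurable_id)) _

theorem measurable_expect (Q : JumpSystem S M) (f : S → ℝ≥0∞) (x : S) :
    Measurable fun t => Q.expect t f x :=
  Measurable.iSup fun n => Q.measurable_iter f n x

theorem iter_tsum (Q : JumpSystem S M) {ι : Type*} [Countable ι] (f : ι → S → ℝ≥0∞) (n : ℕ) :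
    ∀ t x, Q.iter n t (fun y => ∑' i, f i y) x = ∑' i, Q.iter n t (f i) x := by
  induction n with
  | zero => intro t x; simp [iter]
  | succ n ih =>
    intro t x
    simp only [iter]
    rw [ENNReal.tsum_add, ENNReal.tsum_mul_left,
      ← lintegral_tsum fun i => (Q.measurable_iter_sub (f i) n t x).aemeasurable]
    congr 1
    refine lintegral_congr fun s => ?_
    rw [ENNReal.tsum_mul_left]
    congr 1
    simp_rw [ih, ← ENNReal.tsum_mul_left]
    exact (Summable.tsum_finsetSum (f := fun m i => ((Q.rate m x).toNNReal : ℝ≥0∞) *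
      Q.iter n (t - s) (f i) (Q.move m x)) fun _ _ => ENNReal.summable).symm

theorem iter_const_mul (Q : JumpSystem S M) (a : ℝ≥0∞) (f : S → ℝ≥0∞) (n : ℕ) :
    ∀ t x, Q.iter n t (fun y => a * f y) x = a * Q.iter n t f x := by
  induction n with
  | zero => intro t x; simp [iter]
  | succ n ih =>
    intro t x
    simp only [iter]
    rw [mul_add, ← lintegral_const_mul a (Q.measurable_iter_sub f n t x)]
    congr 1
    · ring
    · refine lintegral_congr fun s => ?_
      rw [mul_left_comm a]
      congr 1
      rw [Finset.mul_sum]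
      refine Finset.sum_congr rfl fun m _ => ?_
      rw [ih]; ring

theorem iter_mono_fun (Q : JumpSystem S M) {f g : S → ℝ≥0∞} (h : ∀ x, f x ≤ g x) (n : ℕ) :
    ∀ t x, Q.iter n t f x ≤ Q.iter n t g x := by
  induction n with
  | zero => intro t x; simp [iter]
  | succ n ih =>
    intro t x
    simp only [iter]
    gcongr with s m
    · exact h x
    · exact ih _ _

theorem iter_mono (Q : JumpSystem S M) (f : S → ℝ≥0∞) (t : ℝ) (x : S) :
    Monotone fun n => Q.iter n t f x := by
  refine monotone_nat_of_le_succ fun n => ?_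
  revert t x
  induction n with
  | zero => intro t x; simp [iter]
  | succ n ih =>
    intro t x
    rw [iter, iter]
    gcongr with s m
    exact ih _ _

theorem expect_mono (Q : JumpSystem S M) {f g : S → ℝ≥0∞} (h : ∀ x, f x ≤ g x) (t : ℝ) (x : S) :
    Q.expect t f x ≤ Q.expect t g x :=
  iSup_mono fun n => Q.iter_mono_fun h n t x

theorem expect_const_mul (Q : JumpSystem S M) (a : ℝ≥0∞) (f : S → ℝ≥0∞) (t : ℝ) (x : S) :
    Q.expect t (fun y => a * f y) x = a * Q.expect t f x := by
  simp only [expect, iter_const_mul, ENNReal.mul_iSup]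

theorem expect_tsum (Q : JumpSystem S M) {ι : Type*} [Countable ι] (f : ι → S → ℝ≥0∞) (t : ℝ)
    (x : S) : Q.expect t (fun y => ∑' i, f i y) x = ∑' i, Q.expect t (f i) x := by
  simp only [expect, iter_tsum]
  simp only [ENNReal.tsum_eq_iSup_sum]
  rw [iSup_comm]
  refine iSup_congr fun s => ?_
  rw [ENNReal.finsetSum_iSup_of_monotone fun i => Q.iter_mono (f i) t x]

theorem expect_add (Q : JumpSystem S M) (f g : S → ℝ≥0∞) (t : ℝ) (x : S) :
    Q.expect t (fun y => f y + g y) x = Q.expect t f x + Q.expect t g x := by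
  have := Q.expect_tsum (fun b : Bool => if b then f else g) t x
  simpa [tsum_fintype] using this

/-- Identifies `expect` with integration against the transition probabilities, so that hypotheses on
`prob` control expectations. -/
theorem expect_eq_tsum [Countable S] (Q : JumpSystem S M) (f : S → ℝ≥0∞) (t : ℝ) (x : S) :
    Q.expect t f x = ∑' y, f y * Q.prob t x {y} := by
  have h : f = fun z => ∑' y, f y * (({y} : Set S).indicator 1 z) := by
    funext z
    rw [tsum_eq_single z]
    · simp
    · intro y hy; simp [Ne.symm hy]
  conv_lhs => rw [h]
  rw [expect_tsum]
  exact tsum_congr fun y => Q.expect_const_mul _ _ t x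

/-- Conditioning on the first move. -/
theorem expect_renewal (Q : JumpSystem S M) (f : S → ℝ≥0∞) (t : ℝ) (x : S) :
    Q.expect t f x = ENNReal.ofReal (Real.exp (-(Q.exitRate x : ℝ) * t)) * f x +
        ∫⁻ s in Set.Ioc 0 t, ENNReal.ofReal (Real.exp (-(Q.exitRate x : ℝ) * s)) *
          ∑ m, ((Q.rate m x).toNNReal : ℝ≥0∞) * Q.expect (t - s) f (Q.move m x) := by
  have h1 : Q.expect t f x = ⨆ n, Q.iter (n + 1) t f x :=
    ((Q.iter_mono f t x).iSup_nat_add 1).symm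
  rw [h1]
  simp only [iter]
  rw [← ENNReal.add_iSup]
  congr 1
  rw [← lintegral_iSup (fun n => Q.measurable_iter_sub f n t x)]
  · refine lintegral_congr fun s => ?_
    rw [← ENNReal.mul_iSup]
    congr 1
    simp only [expect, ENNReal.mul_iSup]
    rw [ENNReal.finsetSum_iSup_of_monotone]
    intro m a b hab
    dsimp only
    gcongr
    exact Q.iter_mono f _ _ hab
  · intro a b hab s
    dsimp only
    gcongr with m
    exact Q.iter_mono f _ _ hab

/-! ### Comparison with supersolutions, and the backward equation -/

/-- The rates are nonnegative on `A` and the process does not leave `A`. -/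
def Invariant (Q : JumpSystem S M) (A : Set S) : Prop :=
  ∀ x ∈ A, ∀ m, 0 ≤ Q.rate m x ∧ (0 < Q.rate m x → Q.move m x ∈ A)

/-- `u` is a nonnegative supersolution of the backward equation on `A`. -/
structure IsSupersolution (Q : JumpSystem S M) (A : Set S) (u : ℝ → S → ℝ) : Prop where
  nonneg : ∀ x ∈ A, ∀ t, 0 ≤ t → 0 ≤ u t x
  deriv : ∀ x ∈ A, ∀ t, 0 ≤ t → ∃ u', HasDerivWithinAt (fun s => u s x) u' (Set.Ici 0) t ∧
    Q.generator (u t) x ≤ u'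

theorem exitRate_eq (Q : JumpSystem S M) {A : Set S} (hA : Q.Invariant A) {x : S} (hx : x ∈ A) :
    (Q.exitRate x : ℝ) = ∑ m, Q.rate m x := by
  simp only [exitRate, NNReal.coe_sum]
  exact Finset.sum_congr rfl fun m _ => Real.coe_toNNReal _ (hA x hx m).1

theorem generator_eq (Q : JumpSystem S M) {A : Set S} (hA : Q.Invariant A) {x : S} (hx : x ∈ A)
    (f : S → ℝ) :
    Q.generator f x = ∑ m, Q.rate m x * f (Q.move m x) - Q.exitRate x * f x := by
  rw [exitRate_eq Q hA hx, generator, Finset.sum_mul, ← Finset.sum_sub_distrib]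
  exact Finset.sum_congr rfl fun m _ => by ring

theorem IsSupersolution.continuousOn {Q : JumpSystem S M} {A : Set S} {u : ℝ → S → ℝ}
    (hu : Q.IsSupersolution A u) {x : S} (hx : x ∈ A) :
    ContinuousOn (fun s => u s x) (Set.Ici 0) := fun t ht => by
  obtain ⟨u', h, -⟩ := hu.deriv x hx t ht
  exact h.continuousWithinAt

/-- The function `s ↦ exp (-l s) * u (t - s) x` decreases at rate at least `exp (-l s) * ∑ m, rate m
x * u (t - s) (move m x)`, because its exponential factor cancels the diagonal of the generator.
Integrating over `[0, t]` gives the one-move recursion of `iter`, as an inequality. -/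
theorem IsSupersolution.duhamel {Q : JumpSystem S M} {A : Set S} (hA : Q.Invariant A)
    {u : ℝ → S → ℝ} (hu : Q.IsSupersolution A u) {x : S} (hx : x ∈ A) {t : ℝ} (ht : 0 ≤ t) :
    ContinuousOn (fun s => Real.exp (-(Q.exitRate x : ℝ) * s) *
        ∑ m, Q.rate m x * u (t - s) (Q.move m x)) (Set.Icc 0 t) ∧
    Real.exp (-(Q.exitRate x : ℝ) * t) * u 0 x +
      ∫ s in (0 : ℝ)..t, Real.exp (-(Q.exitRate x : ℝ) * s) *
        ∑ m, Q.rate m x * u (t - s) (Q.move m x) ≤ u t x := by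
  set l : ℝ := (Q.exitRate x : ℝ)
  have hmaps : Set.MapsTo (fun s : ℝ => t - s) (Set.Icc 0 t) (Set.Ici 0) :=
    fun s hs => sub_nonneg.2 hs.2
  have hcont : ContinuousOn (fun s => Real.exp (-l * s) *
      ∑ m, Q.rate m x * u (t - s) (Q.move m x)) (Set.Icc 0 t) := by
    refine ContinuousOn.mul (by fun_prop) (continuousOn_finsetSum _ fun m _ => ?_)
    -- A move of rate zero may leave `A`, where nothing is known about `u`.
    rcases (hA x hx m).1.eq_or_lt with h0 | h0
    · simp only [← h0, zero_mul]; exact continuousOn_const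
    · exact continuousOn_const.mul
        ((hu.continuousOn ((hA x hx m).2 h0)).comp (by fun_prop) hmaps)
  refine ⟨hcont, ?_⟩
  have key := intervalIntegral.integral_le_sub_of_hasDeriv_right_of_le (a := 0) (b := t)
    (g := fun s => -(Real.exp (-l * s) * u (t - s) x))
    (g' := fun s => -(Real.exp (-l * s) * (-l * u (t - s) x) +
      Real.exp (-l * s) * -(derivWithin (fun s => u s x) (Set.Ici 0) (t - s))))
    (φ := fun s => Real.exp (-l * s) * ∑ m, Q.rate m x * u (t - s) (Q.move m x)) ht
    ?_ ?_ ?_ ?_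
  · simp only [sub_self, sub_zero, mul_zero, Real.exp_zero, one_mul] at key
    linarith
  · refine ContinuousOn.neg (ContinuousOn.mul (by fun_prop) ?_)
    exact (hu.continuousOn hx).comp (by fun_prop) hmaps
  · intro s hs
    have hts : 0 < t - s := sub_pos.2 hs.2
    obtain ⟨u', h1, -⟩ := hu.deriv x hx (t - s) hts.le
    rw [h1.derivWithin (uniqueDiffOn_Ici 0 _ hts.le)]
    have h2 : HasDerivAt (fun s => u s x) u' (t - s) := h1.hasDerivAt (Ici_mem_nhds hts)
    have h3 : HasDerivAt (fun s => u (t - s) x) (-u') s := by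
      simpa [Function.comp_def] using h2.comp s ((hasDerivAt_id s).const_sub t)
    have h4 : HasDerivAt (fun s => Real.exp (-l * s)) (Real.exp (-l * s) * -l) s := by
      simpa using ((hasDerivAt_id s).const_mul (-l)).exp
    have h5 := (h4.mul h3).neg
    refine HasDerivAt.hasDerivWithinAt ?_
    convert h5 using 1
    · rfl
    · ring
  · exact hcont.integrableOn_Icc
  · intro s hs
    have hts : 0 < t - s := sub_pos.2 hs.2
    obtain ⟨u', h1, h2⟩ := hu.deriv x hx (t - s) hts.le
    rw [h1.derivWithin (uniqueDiffOn_Ici 0 _ hts.le)]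
    rw [generator_eq Q hA hx] at h2
    have := mul_le_mul_of_nonneg_left h2 (Real.exp_nonneg (-l * s))
    change _ ≤ _
    nlinarith

/-- The minimal process is dominated by nonnegative supersolutions. -/
theorem expect_le_of_isSupersolution {Q : JumpSystem S M} {A : Set S} (hA : Q.Invariant A)
    {u : ℝ → S → ℝ} (hu : Q.IsSupersolution A u) {f : S → ℝ≥0∞}
    (hf : ∀ x ∈ A, f x ≤ ENNReal.ofReal (u 0 x)) {x : S} (hx : x ∈ A) {t : ℝ} (ht : 0 ≤ t) :
    Q.expect t f x ≤ ENNReal.ofReal (u t x) := by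
  refine iSup_le fun n => ?_
  -- The recursion of `iter` lies term by term below the Duhamel inequality for `u`. Nonnegativity
  -- of `u` starts the induction.
  induction n generalizing x t with
  | zero => simp [iter]
  | succ n ih =>
    obtain ⟨hcont, hle⟩ := hu.duhamel hA hx ht
    have hnn : ∀ s ∈ Set.Icc 0 t, ∀ m, 0 ≤ Q.rate m x * u (t - s) (Q.move m x) := by
      intro s hs m
      rcases (hA x hx m).1.eq_or_lt with h0 | h0
      · simp [← h0]
      · exact mul_nonneg h0.le (hu.nonneg _ ((hA x hx m).2 h0) _ (sub_nonneg.2 hs.2))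
    refine le_trans ?_ (ENNReal.ofReal_le_ofReal hle)
    rw [ENNReal.ofReal_add (mul_nonneg (Real.exp_nonneg _) (hu.nonneg x hx 0 le_rfl)),
      ENNReal.ofReal_mul (Real.exp_nonneg _), iter, intervalIntegral.integral_of_le ht,
      ofReal_integral_eq_lintegral_ofReal]
    · refine add_le_add (mul_le_mul_right (hf x hx) _) ?_
      refine setLIntegral_mono' measurableSet_Ioc fun s hs => ?_
      have hs' : s ∈ Set.Icc 0 t := ⟨hs.1.le, hs.2⟩
      rw [ENNReal.ofReal_mul (Real.exp_nonneg _), ENNReal.ofReal_sum_of_nonneg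
        fun m _ => hnn s hs' m]
      gcongr with m
      rcases (hA x hx m).1.eq_or_lt with h0 | h0
      · simp [← h0]
      · rw [ENNReal.ofReal_mul h0.le]
        exact mul_le_mul_right (ih ((hA x hx m).2 h0) (sub_nonneg.2 hs.2)) _
    · exact hcont.integrableOn_Icc.mono_set Set.Ioc_subset_Icc_self
    · refine (ae_restrict_iff' measurableSet_Ioc).2 (Eventually.of_forall fun s hs => ?_)
      exact mul_nonneg (Real.exp_nonneg _)
        (Finset.sum_nonneg fun m _ => hnn s ⟨hs.1.le, hs.2⟩ m)
    · refine intervalIntegral.integral_nonneg ht fun s hs => ?_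
      exact mul_nonneg (Real.exp_nonneg _) (Finset.sum_nonneg fun m _ => hnn s hs m)

/-- The system with negative rates replaced by `0`. -/
def posPart (Q : JumpSystem S M) : JumpSystem S M where
  rate m x := ((Q.rate m x).toNNReal : ℝ)
  move := Q.move

theorem posPart_iter (Q : JumpSystem S M) (f : S → ℝ≥0∞) (n : ℕ) :
    ∀ t x, Q.posPart.iter n t f x = Q.iter n t f x := by
  induction n with
  | zero => intro t x; simp [iter]
  | succ n ih =>
    intro t x
    simp only [iter, ih]
    simp only [exitRate, posPart, Real.toNNReal_coe]

/-- The purpose of `posPart`: it has the same `iter`, but its rates are nonnegative everywhere, so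
the comparison principle applies on all of `S`. -/
theorem posPart_invariant {S M : Type*} (Q : JumpSystem S M) : Q.posPart.Invariant Set.univ :=
  fun _ _ _ => ⟨NNReal.coe_nonneg _, fun _ => trivial⟩

theorem posPart_generator (Q : JumpSystem S M) {A : Set S} (hA : Q.Invariant A) {x : S}
    (hx : x ∈ A) (f : S → ℝ) : Q.posPart.generator f x = Q.generator f x := by
  simp only [generator, posPart]
  exact Finset.sum_congr rfl fun m _ => by rw [Real.coe_toNNReal _ (hA x hx m).1]

/-- The constant `1` is a supersolution. Equality is not claimed for `f = 1`, since the minimal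
process may explode. -/
theorem expect_le_one (Q : JumpSystem S M) {f : S → ℝ≥0∞} (hf : ∀ x, f x ≤ 1) {t : ℝ}
    (ht : 0 ≤ t) (x : S) : Q.expect t f x ≤ 1 := by
  have hu : Q.posPart.IsSupersolution Set.univ fun _ _ => 1 :=
    ⟨fun _ _ _ _ => zero_le_one, fun x _ t _ => ⟨0, hasDerivWithinAt_const _ _ _, by
      simp [generator]⟩⟩
  have := expect_le_of_isSupersolution Q.posPart_invariant hu (f := f)
    (fun x _ => by simpa using hf x) (Set.mem_univ x) ht
  simpa [expect, posPart_iter] using this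

theorem prob_le_one (Q : JumpSystem S M) {t : ℝ} (ht : 0 ≤ t) (x : S) (A : Set S) :
    Q.prob t x A ≤ 1 :=
  Q.expect_le_one (fun y => Set.indicator_le_self' (fun _ _ => zero_le) y) ht x

theorem expect_zero (Q : JumpSystem S M) (f : S → ℝ≥0∞) (x : S) : Q.expect 0 f x = f x := by
  rw [expect_renewal]; simp

/-- The backward equation. -/
theorem hasDerivWithinAt_expect (Q : JumpSystem S M) {f : S → ℝ≥0∞} (hf : ∀ x, f x ≤ 1)
    (x : S) {t : ℝ} (ht : 0 ≤ t) :
    HasDerivWithinAt (fun s => (Q.expect s f x).toReal)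
      (Q.posPart.generator (fun y => (Q.expect t f y).toReal) x) (Set.Ici 0) t := by
  set u : ℝ → S → ℝ := fun t x => (Q.expect t f x).toReal
  have hu1 : ∀ t, 0 ≤ t → ∀ x, u t x ≤ 1 := fun t ht x =>
    ENNReal.toReal_mono ENNReal.one_ne_top (Q.expect_le_one hf ht x)
  have hu0 : ∀ t x, 0 ≤ u t x := fun t x => ENNReal.toReal_nonneg
  have hum : ∀ x, Measurable fun t => u t x := fun x => (Q.measurable_expect f x).ennreal_toReal
  set r : M → S → ℝ := fun m x => ((Q.rate m x).toNNReal : ℝ)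
  -- The bound `u ≤ 1` is only known at nonnegative times, hence `max s 0`.
  set g : S → ℝ → ℝ := fun x s => ∑ m, r m x * u (max s 0) (Q.move m x)
  have hgm : ∀ x, Measurable (g x) := fun x => Finset.measurable_sum _ fun m _ =>
    ((hum _).comp (measurable_id.max measurable_const)).const_mul _
  have hg0 : ∀ x s, 0 ≤ g x s := fun x s =>
    Finset.sum_nonneg fun m _ => mul_nonneg (NNReal.coe_nonneg _) (hu0 _ _)
  have hg1 : ∀ x s, g x s ≤ Q.exitRate x := fun x s => by
    simp only [exitRate, NNReal.coe_sum]
    exact Finset.sum_le_sum fun m _ => mul_le_of_le_one_right (NNReal.coe_nonneg _)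
      (hu1 _ (le_max_right _ _) _)
  have hint : ∀ x a b, IntervalIntegrable (fun s => Real.exp ((Q.exitRate x : ℝ) * s) * g x s)
      volume a b := by
    intro x a b
    refine IntervalIntegrable.continuousOn_mul ?_ (by fun_prop)
    refine (intervalIntegrable_const (c := (Q.exitRate x : ℝ))).mono_fun
      (hgm x).aestronglyMeasurable (Eventually.of_forall fun s => ?_)
    simp only
    rw [Real.norm_of_nonneg (hg0 x s), Real.norm_of_nonneg (NNReal.coe_nonneg _)]
    exact hg1 x s
  -- The renewal equation after the substitution `s ↦ t - s`. The regularity is bootstrapped: the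
  -- bounded measurable integrand makes `U` continuous, hence `g` is continuous, hence `U` is
  -- differentiable.
  set U : ℝ → S → ℝ := fun t x => Real.exp (-(Q.exitRate x : ℝ) * t) * ((f x).toReal +
    ∫ s in (0 : ℝ)..t, Real.exp ((Q.exitRate x : ℝ) * s) * g x s)
  have hfin : ∀ x, f x ≠ ∞ := fun x => ((hf x).trans_lt ENNReal.one_lt_top).ne
  have huU : ∀ t, 0 ≤ t → ∀ x, u t x = U t x := by
    intro t ht x
    have e1 : ∀ s ∈ Set.Ioc 0 t, ENNReal.ofReal (Real.exp (-(Q.exitRate x : ℝ) * s)) *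
          ∑ m, ((Q.rate m x).toNNReal : ℝ≥0∞) * Q.expect (t - s) f (Q.move m x) =
        ENNReal.ofReal (Real.exp (-(Q.exitRate x : ℝ) * s) * g x (t - s)) := by
      intro s hs
      rw [ENNReal.ofReal_mul (Real.exp_nonneg _), ENNReal.ofReal_sum_of_nonneg fun m _ =>
        mul_nonneg (NNReal.coe_nonneg _) (hu0 _ _)]
      congr 1
      refine Finset.sum_congr rfl fun m _ => ?_
      rw [ENNReal.ofReal_mul (NNReal.coe_nonneg _), ENNReal.ofReal_coe_nnreal,
        max_eq_left (sub_nonneg.2 hs.2), ENNReal.ofReal_toReal]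
      exact ((Q.expect_le_one hf (sub_nonneg.2 hs.2) _).trans_lt ENNReal.one_lt_top).ne
    have e2 : ∫ s in (0 : ℝ)..t, Real.exp (-(Q.exitRate x : ℝ) * s) * g x (t - s) =
        Real.exp (-(Q.exitRate x : ℝ) * t) *
          ∫ s in (0 : ℝ)..t, Real.exp ((Q.exitRate x : ℝ) * s) * g x s := by
      rw [← intervalIntegral.integral_const_mul]
      have := intervalIntegral.integral_comp_sub_left (a := 0) (b := t)
        (fun s => Real.exp (-(Q.exitRate x : ℝ) * (t - s)) * g x s) t
      simp only [sub_sub_cancel, sub_self, sub_zero] at this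
      rw [this]
      refine intervalIntegral.integral_congr fun s _ => ?_
      rw [← mul_assoc, ← Real.exp_add]
      congr 2
      ring
    have e3 : IntegrableOn (fun s => Real.exp (-(Q.exitRate x : ℝ) * s) * g x (t - s))
        (Set.Ioc 0 t) := by
      refine Integrable.mono' (g := fun _ => (Q.exitRate x : ℝ)) (integrableOn_const (by simp))
        (Measurable.aestronglyMeasurable ?_) ?_
      · exact Measurable.mul (by fun_prop) ((hgm x).comp (by fun_prop))
      · refine (ae_restrict_iff' measurableSet_Ioc).2 (Eventually.of_forall fun s hs => ?_)
        rw [Real.norm_of_nonneg (mul_nonneg (Real.exp_nonneg _) (hg0 _ _))]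
        refine (mul_le_of_le_one_left (hg0 _ _) ?_).trans (hg1 _ _)
        rw [Real.exp_le_one_iff]
        have := mul_nonneg (NNReal.coe_nonneg (Q.exitRate x)) hs.1.le
        linarith
    simp only [u, U]
    rw [expect_renewal, setLIntegral_congr_fun measurableSet_Ioc e1,
      ← ofReal_integral_eq_lintegral_ofReal e3 (Eventually.of_forall fun s =>
        mul_nonneg (Real.exp_nonneg _) (hg0 _ _)), ENNReal.toReal_add
        (ENNReal.mul_ne_top ENNReal.ofReal_ne_top (hfin x)) ENNReal.ofReal_ne_top,
      ENNReal.toReal_mul, ENNReal.toReal_ofReal (Real.exp_nonneg _), ENNReal.toReal_ofReal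
        (integral_nonneg fun s => mul_nonneg (Real.exp_nonneg _) (hg0 _ _)),
      ← intervalIntegral.integral_of_le ht, e2, mul_add]
  have hUc : ∀ x, Continuous fun t => U t x := fun x => by
    refine Continuous.mul (by fun_prop) (continuous_const.add ?_)
    exact intervalIntegral.continuous_primitive (hint x) 0
  have hgc : ∀ x, Continuous (g x) := fun x => by
    refine continuous_finsetSum _ fun m _ => continuous_const.mul ?_
    have : (fun s : ℝ => u (max s 0) (Q.move m x)) = fun s => U (max s 0) (Q.move m x) := by
      funext s; exact huU _ (le_max_right _ _) _
    rw [this]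
    exact (hUc _).comp (by fun_prop)
  have hd : HasDerivAt (fun s => U s x) (Real.exp (-(Q.exitRate x : ℝ) * t) * -(Q.exitRate x : ℝ) *
      ((f x).toReal + ∫ s in (0 : ℝ)..t, Real.exp ((Q.exitRate x : ℝ) * s) * g x s) +
      Real.exp (-(Q.exitRate x : ℝ) * t) * (Real.exp ((Q.exitRate x : ℝ) * t) * g x t)) t := by
    have h4 : HasDerivAt (fun s => Real.exp (-(Q.exitRate x : ℝ) * s))
        (Real.exp (-(Q.exitRate x : ℝ) * t) * -(Q.exitRate x : ℝ)) t := by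
      simpa using ((hasDerivAt_id t).const_mul (-(Q.exitRate x : ℝ))).exp
    refine h4.mul (HasDerivAt.const_add _ ?_)
    have hc : Continuous fun s => Real.exp ((Q.exitRate x : ℝ) * s) * g x s :=
      Continuous.mul (by fun_prop) (hgc x)
    exact intervalIntegral.integral_hasDerivAt_right (hint x 0 t)
      (hc.stronglyMeasurableAtFilter _ _) hc.continuousAt
  have hval : Real.exp (-(Q.exitRate x : ℝ) * t) * -(Q.exitRate x : ℝ) *
      ((f x).toReal + ∫ s in (0 : ℝ)..t, Real.exp ((Q.exitRate x : ℝ) * s) * g x s) +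
      Real.exp (-(Q.exitRate x : ℝ) * t) * (Real.exp ((Q.exitRate x : ℝ) * t) * g x t) =
      Q.posPart.generator (u t) x := by
    have hexp : Real.exp (-(Q.exitRate x : ℝ) * t) * Real.exp ((Q.exitRate x : ℝ) * t) = 1 := by
      rw [← Real.exp_add]; simp
    rw [← mul_assoc, hexp, one_mul]
    have h2 : Real.exp (-(Q.exitRate x : ℝ) * t) * -(Q.exitRate x : ℝ) *
      ((f x).toReal + ∫ s in (0 : ℝ)..t, Real.exp ((Q.exitRate x : ℝ) * s) * g x s) =
      -(Q.exitRate x : ℝ) * u t x := by rw [huU t ht x]; ring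
    rw [h2, generator_eq Q.posPart Q.posPart_invariant (Set.mem_univ x)]
    simp only [g, max_eq_left ht, exitRate, posPart, Real.toNNReal_coe, r]
    ring
  rw [← hval]
  exact hd.hasDerivWithinAt.congr (fun s hs => huU s hs x) (huU t ht x)

end General

end JumpSystem

namespace JumpSystem

/-! ### Jump processes on a finite invariant set -/

section FiniteInvariant

variable {S M : Type*} [Fintype M]

theorem generator_congr {Q : JumpSystem S M} {A : Set S} (hA : Q.Invariant A) {f g : S → ℝ}
    (h : ∀ y ∈ A, f y = g y) {x : S} (hx : x ∈ A) : Q.generator f x = Q.generator g x := by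
  refine Finset.sum_congr rfl fun m _ => ?_
  rcases (hA x hx m).1.eq_or_lt with h0 | h0
  · simp [← h0]
  · rw [h x hx, h _ ((hA x hx m).2 h0)]

theorem generator_hasDerivWithinAt {Q : JumpSystem S M} {A : Set S} (hA : Q.Invariant A)
    {u : ℝ → S → ℝ} {u' : S → ℝ} {I : Set ℝ} {t : ℝ}
    (h : ∀ y ∈ A, HasDerivWithinAt (fun s => u s y) (u' y) I t) {x : S} (hx : x ∈ A) :
    HasDerivWithinAt (fun s => Q.generator (u s) x) (Q.generator u' x) I t := by
  refine HasDerivWithinAt.fun_sum fun m _ => ?_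
  rcases (hA x hx m).1.eq_or_lt with h0 | h0
  · simp only [← h0, zero_mul]; exact hasDerivWithinAt_const _ _ _
  · exact ((h _ ((hA x hx m).2 h0)).sub (h x hx)).const_mul _

/-- Uniqueness for the backward equation on a finite invariant set. -/
theorem backward_unique {Q : JumpSystem S M} {F : Finset S} (hF : Q.Invariant (F : Set S))
    {u w : ℝ → S → ℝ}
    (hu : ∀ x ∈ F, ∀ t, 0 ≤ t →
      HasDerivWithinAt (fun s => u s x) (Q.generator (u t) x) (Set.Ici 0) t)
    (hw : ∀ x ∈ F, ∀ t, 0 ≤ t →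
      HasDerivWithinAt (fun s => w s x) (Q.generator (w t) x) (Set.Ici 0) t)
    (h0 : ∀ x ∈ F, u 0 x = w 0 x) {t : ℝ} (ht : 0 ≤ t) {x : S} (hx : x ∈ F) :
    u t x = w t x := by
  classical
  -- The backward equation becomes a linear ODE on `F → ℝ`. The extension by `0` is harmless, since
  -- by invariance the generator at points of `F` does not see values outside `F`.
  let ext : (F → ℝ) → S → ℝ := fun e y => if h : y ∈ F then e ⟨y, h⟩ else 0
  let L : (F → ℝ) →ₗ[ℝ] (F → ℝ) :=
    { toFun := fun e x => Q.generator (ext e) x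
      map_add' := fun e e' => by
        funext x
        simp only [generator, Pi.add_apply, ← Finset.sum_add_distrib]
        refine Finset.sum_congr rfl fun m _ => ?_
        simp only [ext, Pi.add_apply]
        split_ifs <;> ring
      map_smul' := fun a e => by
        funext x
        simp only [generator, Pi.smul_apply, smul_eq_mul, RingHom.id_apply, Finset.mul_sum]
        refine Finset.sum_congr rfl fun m _ => ?_
        simp only [ext, Pi.smul_apply, smul_eq_mul]
        split_ifs <;> ring }
  have key : ∀ z : ℝ → S → ℝ, (∀ x ∈ F, ∀ t, 0 ≤ t →
      HasDerivWithinAt (fun s => z s x) (Q.generator (z t) x) (Set.Ici 0) t) →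
      ∀ t, 0 ≤ t → HasDerivWithinAt (fun s => (fun y : F => z s y))
        (L.toContinuousLinearMap (fun y : F => z t y)) (Set.Ici 0) t := by
    intro z hz t ht
    refine hasDerivWithinAt_pi.2 fun y => ?_
    have : (L.toContinuousLinearMap (fun y : F => z t y)) y = Q.generator (z t) y := by
      refine generator_congr hF (fun y hy => ?_) y.2
      exact dif_pos hy
    rw [this]
    exact hz y y.2 t ht
  have := ODE_solution_unique (a := 0) (b := t) (v := fun _ => L.toContinuousLinearMap)
    (K := ‖L.toContinuousLinearMap‖₊) (f := fun s => (fun y : F => u s y))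
    (g := fun s => (fun y : F => w s y))
    (fun _ => L.toContinuousLinearMap.lipschitz)
    (fun s hs => (key u hu s hs.1).continuousWithinAt.mono Set.Icc_subset_Ici_self)
    (fun s hs => (key u hu s hs.1).mono (Set.Ici_subset_Ici.2 hs.1))
    (fun s hs => (key w hw s hs.1).continuousWithinAt.mono Set.Icc_subset_Ici_self)
    (fun s hs => (key w hw s hs.1).mono (Set.Ici_subset_Ici.2 hs.1))
    (funext fun y => h0 y y.2) ⟨ht, le_rfl⟩
  exact congrFun this ⟨x, hx⟩

/-- `E_x[f(X_t); X_t ∈ F]`. -/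
noncomputable def finExpect (Q : JumpSystem S M) (F : Finset S) (t : ℝ) (f : S → ℝ) (x : S) : ℝ :=
  ∑ y ∈ F, f y * (Q.prob t x {y}).toReal

theorem finExpect_mono {Q : JumpSystem S M} {F : Finset S} {f g : S → ℝ}
    (h : ∀ y ∈ F, f y ≤ g y) (t : ℝ) (x : S) : Q.finExpect F t f x ≤ Q.finExpect F t g x :=
  Finset.sum_le_sum fun y hy => mul_le_mul_of_nonneg_right (h y hy) ENNReal.toReal_nonneg

theorem finExpect_congr {Q : JumpSystem S M} {F : Finset S} {f g : S → ℝ}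
    (h : ∀ y ∈ F, f y = g y) (t : ℝ) (x : S) : Q.finExpect F t f x = Q.finExpect F t g x :=
  Finset.sum_congr rfl fun y hy => by rw [h y hy]

theorem finExpect_nonneg {Q : JumpSystem S M} {F : Finset S} {f : S → ℝ}
    (h : ∀ y ∈ F, 0 ≤ f y) (t : ℝ) (x : S) : 0 ≤ Q.finExpect F t f x :=
  Finset.sum_nonneg fun y hy => mul_nonneg (h y hy) ENNReal.toReal_nonneg

theorem finExpect_add (Q : JumpSystem S M) (F : Finset S) (f g : S → ℝ) (t : ℝ) (x : S) :
    Q.finExpect F t (fun y => f y + g y) x = Q.finExpect F t f x + Q.finExpect F t g x := by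
  simp only [finExpect, add_mul, Finset.sum_add_distrib]

theorem finExpect_const_mul (Q : JumpSystem S M) (F : Finset S) (a : ℝ) (f : S → ℝ) (t : ℝ)
    (x : S) : Q.finExpect F t (fun y => a * f y) x = a * Q.finExpect F t f x := by
  simp only [finExpect, Finset.mul_sum, mul_assoc]

theorem finExpect_neg (Q : JumpSystem S M) (F : Finset S) (f : S → ℝ) (t : ℝ)
    (x : S) : Q.finExpect F t (fun y => - f y) x = - Q.finExpect F t f x := by
  simp only [finExpect, neg_mul, Finset.sum_neg_distrib]

theorem finExpect_zero (Q : JumpSystem S M) {F : Finset S} (f : S → ℝ) {x : S} (hx : x ∈ F) :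
    Q.finExpect F 0 f x = f x := by
  classical
  rw [finExpect, Finset.sum_eq_single x]
  · have : Q.prob 0 x {x} = 1 := (Q.expect_zero _ x).trans (by simp)
    simp [this]
  · intro y _ hy
    have : Q.prob 0 x {y} = 0 := (Q.expect_zero _ x).trans (by simp [Ne.symm hy])
    simp [this]
  · exact fun h => absurd hx h

theorem finExpect_backward {Q : JumpSystem S M} {F : Finset S} (hF : Q.Invariant (F : Set S))
    (f : S → ℝ) {x : S} (hx : x ∈ F) {t : ℝ} (ht : 0 ≤ t) :
    HasDerivWithinAt (fun s => Q.finExpect F s f x) (Q.generator (Q.finExpect F t f) x)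
      (Set.Ici 0) t := by
  have h : ∀ y ∈ F, HasDerivWithinAt (fun s => f y * (Q.prob s x {y}).toReal)
      (f y * Q.generator (fun z => (Q.prob t z {y}).toReal) x) (Set.Ici 0) t := by
    intro y _
    have := Q.hasDerivWithinAt_expect (f := ({y} : Set S).indicator 1)
      (fun y => Set.indicator_le_self' (fun _ _ => zero_le) y) x ht
    rw [posPart_generator Q hF hx] at this
    exact this.const_mul _
  have e : Q.generator (Q.finExpect F t f) x =
      ∑ y ∈ F, f y * Q.generator (fun z => (Q.prob t z {y}).toReal) x := by
    simp only [generator, finExpect, Finset.mul_sum]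
    rw [Finset.sum_comm]
    refine Finset.sum_congr rfl fun m _ => ?_
    rw [← Finset.sum_sub_distrib, Finset.mul_sum]
    exact Finset.sum_congr rfl fun y _ => by ring
  rw [e]
  exact HasDerivWithinAt.fun_sum h

/-- The forward equation on a finite invariant set. -/
theorem finExpect_forward {Q : JumpSystem S M} {F : Finset S} (hF : Q.Invariant (F : Set S))
    (f : S → ℝ) {x : S} (hx : x ∈ F) {t : ℝ} (ht : 0 ≤ t) :
    HasDerivWithinAt (fun s => Q.finExpect F s f x) (Q.finExpect F t (Q.generator f) x)
      (Set.Ici 0) t := by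
  -- With `P_t` the semigroup and `L` the generator, both `L P_t f` and `P_t L f` solve the backward
  -- equation with initial value `L f`, so they agree.
  have h := backward_unique hF (u := fun t => Q.generator (Q.finExpect F t f))
    (w := fun t => Q.finExpect F t (Q.generator f))
    (fun x hx t ht => generator_hasDerivWithinAt hF
      (fun y hy => finExpect_backward hF f hy ht) hx)
    (fun x hx t ht => finExpect_backward hF _ hx ht)
    (fun x hx => by
      rw [finExpect_zero Q _ hx]
      exact generator_congr hF (fun y hy => finExpect_zero Q _ hy) hx) ht hx
  rw [← h]
  exact finExpect_backward hF f hx ht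

/-- Grönwall's argument: the derivative of `exp (-a s) P_s f` is `exp (-a s) P_s (L f - a f)`, which
is at most `0`. -/
theorem finExpect_le_exp_mul {Q : JumpSystem S M} {F : Finset S} (hF : Q.Invariant (F : Set S))
    {f : S → ℝ} {a : ℝ} (h : ∀ y ∈ F, Q.generator f y ≤ a * f y) {x : S} (hx : x ∈ F) {t : ℝ}
    (ht : 0 ≤ t) : Q.finExpect F t f x ≤ Real.exp (a * t) * f x := by
  have hd : ∀ s, 0 ≤ s → HasDerivWithinAt (fun s => Real.exp (-a * s) * Q.finExpect F s f x)
      (Real.exp (-a * s) * -a * Q.finExpect F s f x +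
        Real.exp (-a * s) * Q.finExpect F s (Q.generator f) x) (Set.Ici 0) s := by
    intro s hs
    have h4 : HasDerivAt (fun s => Real.exp (-a * s)) (Real.exp (-a * s) * -a) s := by
      simpa using ((hasDerivAt_id s).const_mul (-a)).exp
    exact h4.hasDerivWithinAt.mul (finExpect_forward hF f hx hs)
  have hanti : AntitoneOn (fun s => Real.exp (-a * s) * Q.finExpect F s f x) (Set.Ici 0) := by
    refine antitoneOn_of_hasDerivWithinAt_nonpos (convex_Ici 0)
      (fun s hs => (hd s hs).continuousWithinAt)
      (fun s hs => (hd s (interior_subset hs)).mono interior_subset) (fun s hs => ?_)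
    have h1 := finExpect_mono (Q := Q) h s x
    rw [finExpect_const_mul] at h1
    have := mul_le_mul_of_nonneg_left h1 (Real.exp_nonneg (-a * s))
    linarith
  have h2 := hanti (Set.mem_Ici.2 le_rfl) (Set.mem_Ici.2 ht) ht
  simp only [mul_zero, Real.exp_zero, one_mul, finExpect_zero Q f hx] at h2
  have h3 := mul_le_mul_of_nonneg_left h2 (Real.exp_nonneg (a * t))
  rwa [← mul_assoc, ← Real.exp_add, neg_mul, add_neg_cancel, Real.exp_zero, one_mul] at h3

theorem finExpect_antitoneOn {Q : JumpSystem S M} {F : Finset S} (hF : Q.Invariant (F : Set S))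
    {f : S → ℝ} (h : ∀ y ∈ F, Q.generator f y ≤ 0) {x : S} (hx : x ∈ F) :
    AntitoneOn (fun t => Q.finExpect F t f x) (Set.Ici 0) := by
  refine antitoneOn_of_hasDerivWithinAt_nonpos (convex_Ici 0)
    (fun s hs => (finExpect_forward hF f hx hs).continuousWithinAt)
    (fun s hs => (finExpect_forward hF f hx (interior_subset hs)).mono interior_subset)
    (fun s hs => ?_)
  refine (finExpect_mono (Q := Q) h s x).trans_eq ?_
  simp [finExpect]

/-- No explosion on a finite invariant set: `1` and `-1` are both annihilated by the generator, so
the total mass is both nonincreasing and nondecreasing. -/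
theorem finExpect_one {Q : JumpSystem S M} {F : Finset S} (hF : Q.Invariant (F : Set S))
    {x : S} (hx : x ∈ F) {t : ℝ} (ht : 0 ≤ t) : Q.finExpect F t (fun _ => 1) x = 1 := by
  have h1 := finExpect_antitoneOn hF (f := fun _ => 1) (fun y _ => by simp [generator]) hx
    (Set.mem_Ici.2 le_rfl) ht ht
  have h2 := finExpect_antitoneOn hF (f := fun _ => -1) (fun y _ => by simp [generator]) hx
    (Set.mem_Ici.2 le_rfl) ht ht
  simp only [finExpect_zero Q _ hx, finExpect_neg] at h1 h2
  linarith

theorem abs_finExpect_le {Q : JumpSystem S M} {F : Finset S} (hF : Q.Invariant (F : Set S))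
    {f : S → ℝ} {b : ℝ} (h : ∀ y ∈ F, |f y| ≤ b) {x : S} (hx : x ∈ F) {t : ℝ} (ht : 0 ≤ t) :
    |Q.finExpect F t f x| ≤ b := by
  have h1 := finExpect_mono (Q := Q) (f := f) (g := fun _ => b)
    (fun y hy => (abs_le.1 (h y hy)).2) t x
  have h2 := finExpect_mono (Q := Q) (f := fun _ => b * (-1)) (g := f)
    (fun y hy => by linarith [(abs_le.1 (h y hy)).1]) t x
  have e : ∀ c : ℝ, Q.finExpect F t (fun _ => c) x = c := fun c => by
    have := finExpect_const_mul Q F c (fun _ => 1) t x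
    simpa [finExpect_one hF hx ht] using this
  simp only [e] at h1 h2
  exact abs_le.2 ⟨by linarith, h1⟩

/-- On `A` the zero function is a supersolution dominating the indicator of `y`. -/
theorem prob_eq_zero_of_not_mem {Q : JumpSystem S M} {A : Set S} (hA : Q.Invariant A) {x y : S}
    (hx : x ∈ A) (hy : y ∉ A) {t : ℝ} (ht : 0 ≤ t) : Q.prob t x {y} = 0 := by
  have hu : Q.IsSupersolution A fun _ _ => 0 :=
    ⟨fun _ _ _ _ => le_rfl, fun x _ t _ => ⟨0, hasDerivWithinAt_const _ _ _, by
      simp [generator]⟩⟩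
  have := expect_le_of_isSupersolution hA hu (f := ({y} : Set S).indicator 1)
    (fun z hz => by
      have : z ≠ y := fun h => hy (h ▸ hz)
      simp [this]) hx ht
  rw [ENNReal.ofReal_zero] at this
  exact le_antisymm this zero_le

theorem expect_toReal_eq_finExpect [Countable S] {Q : JumpSystem S M} {F : Finset S}
    (hF : Q.Invariant (F : Set S)) (f : S → ℝ≥0∞) (hf : ∀ y ∈ F, f y ≠ ∞)
    {x : S} (hx : x ∈ F) {t : ℝ} (ht : 0 ≤ t) :
    (Q.expect t f x).toReal = Q.finExpect F t (fun y => (f y).toReal) x := by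
  rw [expect_eq_tsum, tsum_eq_sum (s := F), ENNReal.toReal_sum]
  · simp only [ENNReal.toReal_mul, finExpect]
  · intro y hy
    exact ENNReal.mul_ne_top (hf y hy)
      ((Q.prob_le_one ht x {y}).trans_lt ENNReal.one_lt_top).ne
  · intro y hy
    rw [prob_eq_zero_of_not_mem hF hx (by simpa using hy) ht, mul_zero]

open Classical in
theorem prob_toReal_eq_finExpect [Countable S] {Q : JumpSystem S M} {F : Finset S}
    (hF : Q.Invariant (F : Set S)) (A : Set S) {x : S} (hx : x ∈ F) {t : ℝ} (ht : 0 ≤ t) :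
    (Q.prob t x A).toReal = Q.finExpect F t (fun y => if y ∈ A then 1 else 0) x := by
  have h := expect_toReal_eq_finExpect hF (A.indicator 1) (fun y _ => by
    by_cases h : y ∈ A <;> simp [h]) hx ht
  refine Eq.trans h (finExpect_congr (fun y _ => ?_) t x)
  by_cases h : y ∈ A <;> simp [h]

end FiniteInvariant

end JumpSystem

/-! ### Single-site duality functions -/

/-- The factorial duality function `n (n-1) ⋯ (n-k+1) / ∏_{j<k} (1 + θ j)`. -/
noncomputable def factorialDual (θ : ℝ) (k n : ℕ) : ℝ :=
  (n.descFactorial k : ℝ) / ∏ j ∈ Finset.range k, (1 + θ * j)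

/-- The binomial transform `k ↦ ∑ₘ (k choose m) (-r)^(k-m) f m`. -/
def binomialShift (r : ℝ) (f : ℕ → ℝ) : ℕ → ℝ
  | 0 => f 0
  | k + 1 => binomialShift r (fun m => f (m + 1)) k - r * binomialShift r f k

theorem binomialShift_congr (r : ℝ) {f g : ℕ → ℝ} {k : ℕ} (h : ∀ m ≤ k, f m = g m) :
    binomialShift r f k = binomialShift r g k := by
  induction k generalizing f g with
  | zero => exact h 0 le_rfl
  | succ k ih =>
    rw [binomialShift, binomialShift, ih fun m hm => h (m + 1) (by omega),
      ih fun m hm => h m (by omega)]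

theorem binomialShift_add (r : ℝ) (f g : ℕ → ℝ) (k : ℕ) :
    binomialShift r (fun m => f m + g m) k = binomialShift r f k + binomialShift r g k := by
  induction k generalizing f g with
  | zero => rfl
  | succ k ih =>
    simp only [binomialShift]
    rw [ih f g, ih (fun m => f (m + 1))]; ring

theorem binomialShift_const_mul (r a : ℝ) (f : ℕ → ℝ) (k : ℕ) :
    binomialShift r (fun m => a * f m) k = a * binomialShift r f k := by
  induction k generalizing f with
  | zero => rfl
  | succ k ih => simp only [binomialShift]; rw [ih f, ih (fun m => f (m + 1))]; ring

theorem binomialShift_zero (f : ℕ → ℝ) (k : ℕ) : binomialShift 0 f k = f k := by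
  induction k generalizing f with
  | zero => rfl
  | succ k ih => simp only [binomialShift]; rw [ih]; ring

/-- With `T` the shift, `binomialShift r f k` is `((T - r) ^ k f) 0`. For `(A f) m = m * f (m - 1)`
one has `T A = A T + 1`, hence `(T - r) ^ k A = A (T - r) ^ k + k (T - r) ^ (k - 1)`, and functions
in the image of `A` vanish at `0`. -/
theorem binomialShift_lower (r : ℝ) (f : ℕ → ℝ) (k : ℕ) :
    binomialShift r (fun m : ℕ => (m : ℝ) * f (m - 1)) k = k * binomialShift r f (k - 1) := by
  induction k generalizing f with
  | zero => simp [binomialShift]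
  | succ k ih =>
    have e : (fun m : ℕ => ((m + 1 : ℕ) : ℝ) * f (m + 1 - 1)) =
        fun m : ℕ => (m : ℝ) * (fun m => f (m + 1)) (m - 1) + f m := by
      funext m
      rcases m with _ | m
      · simp
      · simp only [Nat.add_sub_cancel]; push_cast; ring
    rw [binomialShift, e, binomialShift_add, ih (fun m => f (m + 1)), ih f]
    rcases k with _ | k
    · simp [binomialShift]
    · simp only [Nat.add_sub_cancel, binomialShift]; push_cast; ring

/-- The number operator is `A T`, so this is `binomialShift_lower` followed by `T = (T - r) + r`. -/
theorem binomialShift_number (r : ℝ) (f : ℕ → ℝ) (k : ℕ) :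
    binomialShift r (fun m : ℕ => (m : ℝ) * f m) k =
      k * binomialShift r f k + r * (k * binomialShift r f (k - 1)) := by
  have e : (fun m : ℕ => (m : ℝ) * f m) = fun m : ℕ => (m : ℝ) * (fun m => f (m + 1)) (m - 1) := by
    funext m
    rcases m with _ | m <;> simp
  rw [e, binomialShift_lower r (fun m => f (m + 1))]
  rcases k with _ | k
  · simp
  · simp only [Nat.add_sub_cancel, binomialShift]; ring

/-- The operator here is `T + θ A T T`, so `binomialShift_number` applied to the shifted function
gives the result after writing `T = (T - r) + r`. -/
theorem binomialShift_raise (θ r : ℝ) (f : ℕ → ℝ) (k : ℕ) :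
    binomialShift r (fun m : ℕ => (1 + θ * m) * f (m + 1)) k =
      (1 + θ * k) * binomialShift r f (k + 1) + r * (1 + 2 * θ * k) * binomialShift r f k +
        θ * r ^ 2 * (k * binomialShift r f (k - 1)) := by
  have e : (fun m : ℕ => (1 + θ * m) * f (m + 1)) =
      fun m => f (m + 1) + θ * (m * f (m + 1)) := by funext m; ring
  rw [e, binomialShift_add, binomialShift_const_mul,
    binomialShift_number r (fun m => f (m + 1))]
  rcases k with _ | k
  · simp [binomialShift]
  · simp only [Nat.add_sub_cancel, binomialShift]; push_cast; ring

/-- The single-site duality function, centred at `r`. -/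
noncomputable def siteDual (θ r : ℝ) (k n : ℕ) : ℝ :=
  binomialShift r (fun m => factorialDual θ m n) k

theorem siteDual_zero_left (θ r : ℝ) (n : ℕ) : siteDual θ r 0 n = 1 := by
  simp [siteDual, binomialShift, factorialDual]

theorem siteDual_one_left (θ r : ℝ) (n : ℕ) : siteDual θ r 1 n = n - r := by
  simp [siteDual, binomialShift, factorialDual]

/-! ### Admissible occupation numbers and the recursions of the duality function -/

/-- `k` is an admissible occupation number and `n` is one compatible with it. -/
theorem occupation_factor {θ : ℝ} (hθ : AdmissibleTheta θ) {k : ℕ} (hk : k ∈ occupation θ) :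
    0 ≤ 1 + θ * k ∧ (0 < 1 + θ * k → k + 1 ∈ occupation θ) ∧
      (1 + θ * k = 0 → ∀ n ∈ occupation θ, n ≤ k) := by
  rcases hθ with h | ⟨K, hK, rfl⟩
  · have : 0 ≤ θ * k := by positivity
    exact ⟨by linarith, fun _ => Or.inl h, fun h' => by linarith⟩
  · have hK' : (0 : ℝ) < K := by exact_mod_cast hK
    have hneg : ¬ (0 : ℝ) ≤ -(1 / K) := by
      have : (0 : ℝ) < 1 / K := by positivity
      linarith
    have hocc : ∀ n : ℕ, n ∈ occupation (-(1 / (K : ℝ))) ↔ n ≤ K := by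
      intro n
      simp only [occupation, Set.mem_ofPred_eq, hneg, false_or, abs_neg]
      rw [abs_of_pos (by positivity), one_div_one_div]
      exact Nat.cast_le
    have hf : ∀ n : ℕ, 1 + -(1 / (K : ℝ)) * n = (K - n) / K := by
      intro n; field_simp; ring
    simp only [hocc, hf] at hk ⊢
    have hk' : (k : ℝ) ≤ K := by exact_mod_cast hk
    refine ⟨div_nonneg (by linarith) hK'.le, fun h => ?_, fun h n hn => ?_⟩
    · have : (0 : ℝ) < K - k := by
        by_contra h'
        exact absurd h (not_lt.2 (div_nonpos_of_nonpos_of_nonneg (not_lt.1 h') hK'.le))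
      have : k < K := by exact_mod_cast (sub_pos.1 this)
      exact this
    · have : (K : ℝ) - k = 0 := by
        rcases div_eq_zero_iff.1 h with h | h
        · exact h
        · exact absurd h hK'.ne'
      have : (K : ℝ) = k := by linarith
      have : K = k := by exact_mod_cast this
      omega

theorem occupation_of_le {θ : ℝ} {k m : ℕ} (hk : k ∈ occupation θ) (h : m ≤ k) :
    m ∈ occupation θ := by
  rcases hk with hk | hk
  · exact Or.inl hk
  · exact Or.inr (le_trans (by exact_mod_cast h) hk)

theorem one_add_pos_of_lt {θ : ℝ} (hθ : AdmissibleTheta θ) {k m : ℕ} (hk : k ∈ occupation θ)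
    (h : m < k) : 0 < 1 + θ * m := by
  obtain ⟨h1, -, h3⟩ := occupation_factor hθ (occupation_of_le hk h.le)
  exact h1.lt_of_ne fun h0 => absurd (h3 h0.symm k hk) (by omega)

theorem weight_pos {θ : ℝ} (hθ : AdmissibleTheta θ) {k : ℕ} (hk : k ∈ occupation θ) :
    0 < ∏ j ∈ Finset.range k, (1 + θ * (j : ℝ)) :=
  Finset.prod_pos fun _ hj => one_add_pos_of_lt hθ hk (Finset.mem_range.1 hj)

theorem factorialDual_nonneg {θ : ℝ} (hθ : AdmissibleTheta θ) {k : ℕ} (hk : k ∈ occupation θ)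
    (n : ℕ) : 0 ≤ factorialDual θ k n :=
  div_nonneg (Nat.cast_nonneg _) (weight_pos hθ hk).le

theorem factorialDual_raise {θ : ℝ} (hθ : AdmissibleTheta θ) {k n : ℕ} (hk : k ∈ occupation θ)
    (hn : n ∈ occupation θ) :
    (1 + θ * k) * factorialDual θ (k + 1) n = n * factorialDual θ k (n - 1) := by
  have hd : (n.descFactorial (k + 1) : ℝ) = n * (n - 1).descFactorial k := by
    rcases n with _ | n
    · simp
    · rw [Nat.succ_descFactorial_succ]; push_cast; simp
  rw [factorialDual, factorialDual, Finset.prod_range_succ]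
  have hw := (weight_pos hθ hk).ne'
  -- If `1 + θ k = 0` then `k` is the maximal occupation number, so `n ≤ k` and both sides vanish.
  -- The weight in `factorialDual θ (k + 1) n` is then zero, but that term is multiplied by `0`.
  rcases eq_or_ne (1 + θ * (k : ℝ)) 0 with h0 | h0
  · have hnk := (occupation_factor hθ hk).2.2 h0 n hn
    have h1 : n.descFactorial (k + 1) = 0 := Nat.descFactorial_eq_zero_iff_lt.2 (by omega)
    rw [h1, Nat.cast_zero] at hd
    rw [h0, zero_mul, mul_div_assoc', ← hd, zero_div]
  · rw [hd]; field_simp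

theorem factorialDual_number (θ : ℝ) (k n : ℕ) :
    (n : ℝ) * factorialDual θ k n =
      n * factorialDual θ k (n - 1) + k * factorialDual θ k n := by
  have hd : (n : ℝ) * n.descFactorial k = n * (n - 1).descFactorial k + k * n.descFactorial k := by
    rcases lt_or_ge n k with h | h
    · rw [Nat.descFactorial_eq_zero_iff_lt.2 h, Nat.descFactorial_eq_zero_iff_lt.2 (by omega)]
      simp
    · have h1 := Nat.descFactorial_succ n k
      have h2 : n.descFactorial (k + 1) = n * (n - 1).descFactorial k := by
        rcases n with _ | n
        · simp
        · rw [Nat.succ_descFactorial_succ]; simp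
      have h3 : (n - k) * n.descFactorial k = n * (n - 1).descFactorial k := by rw [← h1, h2]
      have h4 : ((n : ℝ) - k) * n.descFactorial k = n * (n - 1).descFactorial k := by
        rw [← Nat.cast_sub h]; exact_mod_cast h3
      linarith
  simp only [factorialDual, mul_div_assoc', ← add_div, hd]

theorem factorialDual_succ_right {θ : ℝ} (hθ : AdmissibleTheta θ) {k n : ℕ}
    (hk : k ∈ occupation θ) (hn : n ∈ occupation θ) :
    (1 + θ * n) * factorialDual θ k (n + 1) =
      θ * ((1 + θ * k) * factorialDual θ (k + 1) n) + (1 + 2 * θ * k) * factorialDual θ k n +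
        k * factorialDual θ (k - 1) n := by
  have hnum := factorialDual_number θ k n
  rw [← factorialDual_raise hθ hk hn] at hnum
  rcases k with _ | k
  · simp only [factorialDual, Nat.descFactorial_zero, Finset.range_zero, Finset.prod_empty,
      Nat.cast_zero, mul_zero, add_zero, Nat.cast_one, div_one, mul_one, zero_mul,
      one_mul] at hnum ⊢
    rw [← hnum]; ring
  · have hk' : k ∈ occupation θ := occupation_of_le hk (Nat.le_succ k)
    have hpos : (1 + θ * (k : ℝ)) ≠ 0 := (one_add_pos_of_lt hθ hk (Nat.lt_succ_self k)).ne'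
    have hnum' := factorialDual_number θ k n
    rw [← factorialDual_raise hθ hk' hn] at hnum'
    have hsucc : (1 + θ * k) * factorialDual θ (k + 1) (n + 1) =
        (n + 1) * factorialDual θ k n := by
      rw [factorialDual, factorialDual, Finset.prod_range_succ, Nat.succ_descFactorial_succ]
      have hw := (weight_pos hθ hk').ne'
      push_cast
      field_simp
    simp only [Nat.add_sub_cancel]
    -- After multiplication by `1 + θ k`, which is nonzero because `k + 1` is admissible, `hd` and
    -- `hb` express everything through neighbouring falling factorials.
    refine mul_left_cancel₀ hpos ?_
    have e1 : (1 + θ * (k : ℝ)) * ((1 + θ * n) * factorialDual θ (k + 1) (n + 1)) =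
        (1 + θ * n) * ((n + 1) * factorialDual θ k n) := by rw [← hsucc]; ring
    rw [e1]
    push_cast at hnum ⊢
    set a := factorialDual θ k n
    set b := factorialDual θ (k + 1) n
    set d := (1 + θ * ((k : ℝ) + 1)) * factorialDual θ (k + 1 + 1) n
    have hd : d = (n - (k + 1)) * b := by linarith
    have hb : (1 + θ * (k : ℝ)) * b = (n - k) * a := by linarith
    rw [hd]
    linear_combination (-1 - θ * (n + k + 1)) * hb

/-- Together with `siteDual_number` and `siteDual_raise`, this transfers the three one-site
operators from `n` to `k`. Each follows from the relation for `factorialDual`, pushed through the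
binomial transform, which produces the terms in `r`. -/
theorem siteDual_lower {θ : ℝ} (hθ : AdmissibleTheta θ) (r : ℝ) {k n : ℕ}
    (hk : k ∈ occupation θ) (hn : n ∈ occupation θ) :
    n * siteDual θ r k (n - 1) =
      (1 + θ * k) * siteDual θ r (k + 1) n + r * (1 + 2 * θ * k) * siteDual θ r k n +
        θ * r ^ 2 * (k * siteDual θ r (k - 1) n) := by
  simp only [siteDual]
  rw [← binomialShift_raise, ← binomialShift_const_mul]
  exact binomialShift_congr r fun m hm =>
    (factorialDual_raise hθ (occupation_of_le hk hm) hn).symm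

theorem siteDual_number {θ : ℝ} (hθ : AdmissibleTheta θ) (r : ℝ) {k n : ℕ}
    (hk : k ∈ occupation θ) (hn : n ∈ occupation θ) :
    n * siteDual θ r k n =
      (1 + θ * k) * siteDual θ r (k + 1) n + (r * (1 + 2 * θ * k) + k) * siteDual θ r k n +
        r * (1 + θ * r) * (k * siteDual θ r (k - 1) n) := by
  have h : n * siteDual θ r k n = n * siteDual θ r k (n - 1) +
      (k * siteDual θ r k n + r * (k * siteDual θ r (k - 1) n)) := by
    simp only [siteDual]
    rw [← binomialShift_number, ← binomialShift_const_mul, ← binomialShift_const_mul,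
      ← binomialShift_add]
    exact binomialShift_congr r fun m _ => factorialDual_number θ m n
  rw [h, siteDual_lower hθ r hk hn]
  ring

theorem siteDual_raise {θ : ℝ} (hθ : AdmissibleTheta θ) (r : ℝ) {k n : ℕ}
    (hk : k ∈ occupation θ) (hn : n ∈ occupation θ) :
    (1 + θ * n) * siteDual θ r k (n + 1) =
      θ * ((1 + θ * k) * siteDual θ r (k + 1) n) +
        (1 + 2 * θ * k) * (1 + θ * r) * siteDual θ r k n +
        (1 + θ * r) ^ 2 * (k * siteDual θ r (k - 1) n) := by
  have h : (1 + θ * n) * siteDual θ r k (n + 1) =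
      θ * ((1 + θ * k) * siteDual θ r (k + 1) n + r * (1 + 2 * θ * k) * siteDual θ r k n +
        θ * r ^ 2 * (k * siteDual θ r (k - 1) n)) + (siteDual θ r k n +
        2 * θ * (k * siteDual θ r k n + r * (k * siteDual θ r (k - 1) n))) +
        k * siteDual θ r (k - 1) n := by
    simp only [siteDual]
    rw [← binomialShift_raise, ← binomialShift_number, ← binomialShift_lower,
      ← binomialShift_const_mul, ← binomialShift_const_mul, ← binomialShift_const_mul,
      ← binomialShift_add, ← binomialShift_add, ← binomialShift_add]
    refine binomialShift_congr r fun m hm => ?_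
    rw [factorialDual_succ_right hθ (occupation_of_le hk hm) hn]
    ring
  rw [h]; ring

/-- Duality of the two-site exchange dynamics. -/
theorem siteDual_exchange {θ : ℝ} (hθ : AdmissibleTheta θ) (r : ℝ) {k l n m : ℕ}
    (hk : k ∈ occupation θ) (hl : l ∈ occupation θ) (hn : n ∈ occupation θ)
    (hm : m ∈ occupation θ) :
    n * (1 + θ * m) * (siteDual θ r k (n - 1) * siteDual θ r l (m + 1) -
        siteDual θ r k n * siteDual θ r l m) +
      m * (1 + θ * n) * (siteDual θ r k (n + 1) * siteDual θ r l (m - 1) -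
        siteDual θ r k n * siteDual θ r l m) =
    k * (1 + θ * l) * (siteDual θ r (k - 1) n * siteDual θ r (l + 1) m -
        siteDual θ r k n * siteDual θ r l m) +
      l * (1 + θ * k) * (siteDual θ r (k + 1) n * siteDual θ r (l - 1) m -
        siteDual θ r k n * siteDual θ r l m) := by
  have a1 := siteDual_lower hθ r hk hn
  have a2 := siteDual_number hθ r hk hn
  have a3 := siteDual_raise hθ r hk hn
  have b1 := siteDual_lower hθ r hl hm
  have b2 := siteDual_number hθ r hl hm
  have b3 := siteDual_raise hθ r hl hm
  -- The two-site generator is bilinear in the one-site operators. Once these act on `k` and `l`,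
  -- the terms in `r` cancel between the two sites.
  have e1 : n * (1 + θ * m) * (siteDual θ r k (n - 1) * siteDual θ r l (m + 1) -
        siteDual θ r k n * siteDual θ r l m) +
      m * (1 + θ * n) * (siteDual θ r k (n + 1) * siteDual θ r l (m - 1) -
        siteDual θ r k n * siteDual θ r l m) =
      (n * siteDual θ r k (n - 1)) * ((1 + θ * m) * siteDual θ r l (m + 1)) +
      ((1 + θ * n) * siteDual θ r k (n + 1)) * (m * siteDual θ r l (m - 1)) -
      (n * siteDual θ r k n) * (siteDual θ r l m + θ * (m * siteDual θ r l m)) -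
      (siteDual θ r k n + θ * (n * siteDual θ r k n)) * (m * siteDual θ r l m) := by ring
  rw [e1, a1, a2, a3, b1, b2, b3]
  ring

/-- Duality of the reservoir dynamics at one site. -/
theorem siteDual_reservoir {θ : ℝ} (hθ : AdmissibleTheta θ) (r ρ : ℝ) {k n : ℕ}
    (hk : k ∈ occupation θ) (hn : n ∈ occupation θ) :
    ρ * (1 + θ * n) * (siteDual θ r k (n + 1) - siteDual θ r k n) +
      (1 + θ * ρ) * n * (siteDual θ r k (n - 1) - siteDual θ r k n) =
    k * (siteDual θ r (k - 1) n * (ρ - r) - siteDual θ r k n) := by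
  have a1 := siteDual_lower hθ r hk hn
  have a2 := siteDual_number hθ r hk hn
  have a3 := siteDual_raise hθ r hk hn
  have e1 : ρ * (1 + θ * n) * (siteDual θ r k (n + 1) - siteDual θ r k n) +
      (1 + θ * ρ) * n * (siteDual θ r k (n - 1) - siteDual θ r k n) =
      ρ * ((1 + θ * n) * siteDual θ r k (n + 1) - siteDual θ r k n -
        θ * (n * siteDual θ r k n)) +
      (1 + θ * ρ) * (n * siteDual θ r k (n - 1) - n * siteDual θ r k n) := by ring
  rw [e1, a1, a2, a3]
  ring

/-! ### Duality between the process with reservoirs and the absorbing process -/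

section Duality

variable {V : Type*} [Fintype V] [DecidableEq V]

theorem delta_apply {W : Type*} [DecidableEq W] (i j : W) :
    delta i j = if j = i then 1 else 0 := by
  simp [delta, Pi.single_apply]

theorem sub_delta_add_delta_self {W : Type*} [DecidableEq W] {ζ : W → ℕ} {i : W}
    (h : ζ i ≠ 0) : ζ - delta i + delta i = ζ := by
  funext w
  simp only [Pi.add_apply, Pi.sub_apply, delta_apply]
  split_ifs with hw
  · subst hw; omega
  · omega

/-- The duality function, centred at the density `r`. -/
noncomputable def configDual (θ r : ℝ) (ρ : Side → ℝ) (ξ : V ⊕ Side → ℕ) (η : V → ℕ) : ℝ :=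
  (∏ i, siteDual θ r (ξ (.inl i)) (η i)) * ∏ s, (ρ s - r) ^ ξ (.inr s)

/-- The configurations of the dual process. -/
def dualSpace (V : Type*) (θ : ℝ) : Set (V ⊕ Side → ℕ) := {ξ | ∀ i, ξ (.inl i) ∈ occupation θ}

theorem prod_eq_pair_mul {i j : V} (h : i ≠ j) (g : V → ℝ) :
    ∏ v, g v = g i * g j * ∏ v ∈ (Finset.univ.erase i).erase j, g v := by
  rw [← Finset.mul_prod_erase _ _ (Finset.mem_univ i),
    ← Finset.mul_prod_erase _ _ (Finset.mem_erase.2 ⟨h.symm, Finset.mem_univ j⟩), mul_assoc]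

theorem configDual_exchange {θ : ℝ} (hθ : AdmissibleTheta θ) (r : ℝ) (ρ : Side → ℝ)
    {ξ : V ⊕ Side → ℕ} (hξ : ξ ∈ dualSpace V θ) {η : V → ℕ} (hη : η ∈ stateSpace V θ) (i j : V) :
    η i * (1 + θ * η j) * (configDual θ r ρ ξ (η - delta i + delta j) - configDual θ r ρ ξ η) +
    η j * (1 + θ * η i) * (configDual θ r ρ ξ (η - delta j + delta i) - configDual θ r ρ ξ η) =
    ξ (.inl i) * (1 + θ * ξ (.inl j)) *
      (configDual θ r ρ (ξ - delta (.inl i) + delta (.inl j)) η - configDual θ r ρ ξ η) +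
    ξ (.inl j) * (1 + θ * ξ (.inl i)) *
      (configDual θ r ρ (ξ - delta (.inl j) + delta (.inl i)) η - configDual θ r ρ ξ η) := by
  -- A jump from `i` to itself fixes a configuration with a particle at `i`. At an empty site the
  -- truncated subtraction would create a particle, but the rate vanishes.
  rcases eq_or_ne i j with rfl | hij
  · have h1 : (η i : ℝ) * (configDual θ r ρ ξ (η - delta i + delta i) -
        configDual θ r ρ ξ η) = 0 := by
      rcases eq_or_ne (η i) 0 with h | h
      · simp [h]
      · rw [sub_delta_add_delta_self h, sub_self, mul_zero]
    have h2 : (ξ (.inl i) : ℝ) * (configDual θ r ρ (ξ - delta (.inl i) + delta (.inl i)) η -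
        configDual θ r ρ ξ η) = 0 := by
      rcases eq_or_ne (ξ (.inl i)) 0 with h | h
      · simp [h]
      · rw [sub_delta_add_delta_self h, sub_self, mul_zero]
    linear_combination 2 * (1 + θ * η i) * h1 - 2 * (1 + θ * ξ (.inl i)) * h2
  · have hji := hij.symm
    set R := ∏ v ∈ (Finset.univ.erase i).erase j, siteDual θ r (ξ (.inl v)) (η v)
    set B := ∏ s, (ρ s - r) ^ ξ (.inr s)
    have h0 : configDual θ r ρ ξ η =
        siteDual θ r (ξ (.inl i)) (η i) * siteDual θ r (ξ (.inl j)) (η j) * R * B := by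
      rw [configDual, prod_eq_pair_mul hij]
    have hR : ∀ {ξ' : V ⊕ Side → ℕ} {η' : V → ℕ}, (∀ v, v ≠ i → v ≠ j →
        ξ' (.inl v) = ξ (.inl v) ∧ η' v = η v) → (∀ s, ξ' (.inr s) = ξ (.inr s)) →
        configDual θ r ρ ξ' η' = siteDual θ r (ξ' (.inl i)) (η' i) *
          siteDual θ r (ξ' (.inl j)) (η' j) * R * B := by
      intro ξ' η' h h'
      rw [configDual, prod_eq_pair_mul hij]
      simp only [h', R, B]
      congr 2
      refine Finset.prod_congr rfl fun v hv => ?_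
      simp only [Finset.mem_erase, Finset.mem_univ, and_true] at hv
      rw [(h v hv.2 hv.1).1, (h v hv.2 hv.1).2]
    have h1 : configDual θ r ρ ξ (η - delta i + delta j) =
        siteDual θ r (ξ (.inl i)) (η i - 1) * siteDual θ r (ξ (.inl j)) (η j + 1) * R * B := by
      rw [hR (fun v hi hj => by simp [delta_apply, hi, hj]) (fun s => rfl)]
      simp [delta_apply, hij, hji]
    have h2 : configDual θ r ρ ξ (η - delta j + delta i) =
        siteDual θ r (ξ (.inl i)) (η i + 1) * siteDual θ r (ξ (.inl j)) (η j - 1) * R * B := by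
      rw [hR (fun v hi hj => by simp [delta_apply, hi, hj]) (fun s => rfl)]
      simp [delta_apply, hij, hji]
    have h3 : configDual θ r ρ (ξ - delta (.inl i) + delta (.inl j)) η =
        siteDual θ r (ξ (.inl i) - 1) (η i) * siteDual θ r (ξ (.inl j) + 1) (η j) * R * B := by
      rw [hR (fun v hi hj => by simp [delta_apply, hi, hj]) (fun s => by simp [delta_apply])]
      simp [delta_apply, hij, hji]
    have h4 : configDual θ r ρ (ξ - delta (.inl j) + delta (.inl i)) η =
        siteDual θ r (ξ (.inl i) + 1) (η i) * siteDual θ r (ξ (.inl j) - 1) (η j) * R * B := by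
      rw [hR (fun v hi hj => by simp [delta_apply, hi, hj]) (fun s => by simp [delta_apply])]
      simp [delta_apply, hij, hji]
    rw [h0, h1, h2, h3, h4]
    linear_combination R * B * siteDual_exchange hθ r (hξ i) (hξ j) (hη i) (hη j)

theorem configDual_boundary {θ : ℝ} (hθ : AdmissibleTheta θ) (r : ℝ) (ρ : Side → ℝ)
    {ξ : V ⊕ Side → ℕ} (hξ : ξ ∈ dualSpace V θ) {η : V → ℕ} (hη : η ∈ stateSpace V θ) (i : V)
    (s : Side) :
    ρ s * (1 + θ * η i) * (configDual θ r ρ ξ (η + delta i) - configDual θ r ρ ξ η) +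
      (1 + θ * ρ s) * η i * (configDual θ r ρ ξ (η - delta i) - configDual θ r ρ ξ η) =
    ξ (.inl i) * (configDual θ r ρ (ξ - delta (.inl i) + delta (.inr s)) η -
      configDual θ r ρ ξ η) := by
  set R := ∏ v ∈ Finset.univ.erase i, siteDual θ r (ξ (.inl v)) (η v)
  set B := ∏ s, (ρ s - r) ^ ξ (.inr s)
  have hR : ∀ {ξ' : V ⊕ Side → ℕ} {η' : V → ℕ}, (∀ v, v ≠ i →
      ξ' (.inl v) = ξ (.inl v) ∧ η' v = η v) →
      configDual θ r ρ ξ' η' = siteDual θ r (ξ' (.inl i)) (η' i) * R *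
        ∏ s, (ρ s - r) ^ ξ' (.inr s) := by
    intro ξ' η' h
    rw [configDual, ← Finset.mul_prod_erase _ _ (Finset.mem_univ i)]
    congr 2
    refine Finset.prod_congr rfl fun v hv => ?_
    rw [(h v (Finset.mem_erase.1 hv).1).1, (h v (Finset.mem_erase.1 hv).1).2]
  have h0 : configDual θ r ρ ξ η = siteDual θ r (ξ (.inl i)) (η i) * R * B :=
    hR fun v _ => ⟨rfl, rfl⟩
  have h1 : configDual θ r ρ ξ (η + delta i) = siteDual θ r (ξ (.inl i)) (η i + 1) * R * B := by
    rw [hR fun v hv => by simp [delta_apply, hv]]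
    simp [delta_apply, B]
  have h2 : configDual θ r ρ ξ (η - delta i) = siteDual θ r (ξ (.inl i)) (η i - 1) * R * B := by
    rw [hR fun v hv => by simp [delta_apply, hv]]
    simp [delta_apply, B]
  have h3 : configDual θ r ρ (ξ - delta (.inl i) + delta (.inr s)) η =
      siteDual θ r (ξ (.inl i) - 1) (η i) * R * (B * (ρ s - r)) := by
    rw [hR fun v hv => by simp [delta_apply, hv]]
    have : ∏ s', (ρ s' - r) ^ (ξ - delta (.inl i) + delta (.inr s) : V ⊕ Side → ℕ) (.inr s') =
        B * (ρ s - r) := by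
      have e : ∀ s', (ρ s' - r) ^ (ξ - delta (.inl i) + delta (.inr s) : V ⊕ Side → ℕ) (.inr s') =
          (ρ s' - r) ^ ξ (.inr s') * if s' = s then ρ s' - r else 1 := by
        intro s'
        by_cases h : s' = s <;> simp [delta_apply, h, pow_succ]
      simp only [e, Finset.prod_mul_distrib, B, Finset.prod_ite_eq', Finset.mem_univ, if_true]
    rw [this]
    simp [delta_apply]
  rw [h0, h1, h2, h3]
  linear_combination R * B * siteDual_reservoir hθ r (ρ s) (hξ i) (hη i)

/-- Duality: the generator of the process with reservoirs acts on the duality function as the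
generator of the absorbing process. -/
theorem generator_configDual {θ : ℝ} (hθ : AdmissibleTheta θ) {p : V → V → ℝ}
    (hp : ∀ i j, p i j = p j i) (site : Side → V) (c ρ : Side → ℝ) (r : ℝ)
    {ξ : V ⊕ Side → ℕ} (hξ : ξ ∈ dualSpace V θ) {η : V → ℕ} (hη : η ∈ stateSpace V θ) :
    (reservoirSystem θ p site c ρ).generator (configDual θ r ρ ξ) η =
      (dualSystem θ p site c).generator (fun ξ' => configDual θ r ρ ξ' η) ξ := by
  rw [reservoirSystem_generator, dualSystem_generator]
  congr 1
  -- `configDual_exchange` treats the jumps `i → j` and `j → i` together. Symmetry of `p` pairs them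
  -- in the double sum, whence the factor `2`.
  · have sym : ∀ g : V → V → ℝ, 2 * ∑ i, ∑ j, p i j * g i j =
        ∑ i, ∑ j, p i j * (g i j + g j i) := by
      intro g
      simp only [mul_add, Finset.sum_add_distrib]
      rw [two_mul]
      congr 1
      rw [Finset.sum_comm]
      exact Finset.sum_congr rfl fun i _ => Finset.sum_congr rfl fun j _ => by rw [hp]
    have h : (2 : ℝ) ≠ 0 := two_ne_zero
    refine mul_left_cancel₀ h ?_
    simp only [mul_assoc (p _ _)]
    rw [sym fun i j => η i * (1 + θ * η j) *
        (configDual θ r ρ ξ (η - delta i + delta j) - configDual θ r ρ ξ η),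
      sym fun i j => ξ (.inl i) * (1 + θ * ξ (.inl j)) *
        (configDual θ r ρ (ξ - delta (.inl i : V ⊕ Side) + delta (.inl j : V ⊕ Side)) η -
          configDual θ r ρ ξ η)]
    exact Finset.sum_congr rfl fun i _ => Finset.sum_congr rfl fun j _ => by
      rw [configDual_exchange hθ r ρ hξ hη]
  · refine Finset.sum_congr rfl fun s _ => ?_
    rw [configDual_boundary hθ r ρ hξ hη, mul_assoc]

/-! ### Invariant sets -/

theorem reservoirSystem_invariant {V : Type*} [DecidableEq V] {θ : ℝ} (hθ : AdmissibleTheta θ) {p : V → V → ℝ}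
    (hp : ∀ i j, 0 ≤ p i j) (site : Side → V) {c ρ : Side → ℝ} (hc : ∀ s, 0 ≤ c s)
    (hρ : ∀ s, 0 ≤ ρ s) (hθρ : ∀ s, 0 ≤ 1 + θ * ρ s) :
    (reservoirSystem θ p site c ρ).Invariant (stateSpace V θ) := by
  intro η hη m
  rcases m with ⟨i, j⟩ | s | s
  · simp only [reservoirSystem]
    obtain ⟨h1, h2, -⟩ := occupation_factor hθ (hη j)
    have h3 : 0 ≤ p i j * η i := mul_nonneg (hp i j) (Nat.cast_nonneg _)
    refine ⟨mul_nonneg h3 h1, fun h v => ?_⟩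
    have h4 := pos_of_mul_pos_right h h3
    rcases eq_or_ne v j with rfl | hv
    · refine occupation_of_le (h2 h4) ?_
      simp [delta_apply]
    · refine occupation_of_le (hη v) ?_
      simp [delta_apply, hv]
  · simp only [reservoirSystem]
    obtain ⟨h1, h2, -⟩ := occupation_factor hθ (hη (site s))
    refine ⟨mul_nonneg (hc s) (mul_nonneg (hρ s) h1), fun h v => ?_⟩
    have h4 := pos_of_mul_pos_right (pos_of_mul_pos_right h (hc s)) (hρ s)
    rcases eq_or_ne v (site s) with rfl | hv
    · refine occupation_of_le (h2 h4) ?_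
      simp [delta_apply]
    · refine occupation_of_le (hη v) ?_
      simp [delta_apply, hv]
  · simp only [reservoirSystem]
    refine ⟨mul_nonneg (hc s) (mul_nonneg (hθρ s) (Nat.cast_nonneg _)), fun h v => ?_⟩
    refine occupation_of_le (hη v) ?_
    simp

/-- The dual configurations with `n` particles. -/
theorem finite_dualSpace_card (V : Type*) [Fintype V] (θ : ℝ) (n : ℕ) :
    {ξ : V ⊕ Side → ℕ | ξ ∈ dualSpace V θ ∧ ∑ w, ξ w = n}.Finite := by
  classical
  refine (Fintype.piFinset fun _ : V ⊕ Side => Finset.range (n + 1)).finite_toSet.subset ?_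
  intro ξ hξ
  simp only [Finset.mem_coe, Fintype.mem_piFinset, Finset.mem_range, Nat.lt_succ_iff]
  intro w
  rw [← hξ.2]
  exact Finset.single_le_sum (fun _ _ => Nat.zero_le _) (Finset.mem_univ w)

/-- The dual configurations with `n` particles. -/
noncomputable def dualFinset (V : Type*) [Fintype V] (θ : ℝ) (n : ℕ) : Finset (V ⊕ Side → ℕ) :=
  (finite_dualSpace_card V θ n).toFinset

theorem mem_dualFinset {V : Type*} [Fintype V] {θ : ℝ} {n : ℕ} {ξ : V ⊕ Side → ℕ} :
    ξ ∈ dualFinset V θ n ↔ ξ ∈ dualSpace V θ ∧ ∑ w, ξ w = n := by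
  simp [dualFinset]

theorem sum_sub_delta_add_delta {W : Type*} [Fintype W] [DecidableEq W] {ζ : W → ℕ} {i : W}
    (h : ζ i ≠ 0) (j : W) : ∑ w, (ζ - delta i + delta j) w = ∑ w, ζ w := by
  have h1 : ∀ k : W, ∑ w, delta k w = 1 := fun k => by simp [delta_apply]
  have h2 : ∑ w, (ζ - delta i) w + ∑ w, delta i w = ∑ w, ζ w := by
    rw [← Finset.sum_add_distrib]
    refine Finset.sum_congr rfl fun w _ => ?_
    simp only [Pi.sub_apply, delta_apply]
    split_ifs with hw
    · subst hw; omega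
    · omega
  simp only [Pi.add_apply, Finset.sum_add_distrib, h1] at h2 ⊢
  omega

theorem dualSystem_invariant {θ : ℝ} (hθ : AdmissibleTheta θ) {p : V → V → ℝ}
    (hp : ∀ i j, 0 ≤ p i j) (site : Side → V) {c : Side → ℝ} (hc : ∀ s, 0 ≤ c s) (n : ℕ) :
    (dualSystem θ p site c).Invariant (dualFinset V θ n : Set (V ⊕ Side → ℕ)) := by
  intro ξ hξ m
  obtain ⟨hξ, hn⟩ := mem_dualFinset.1 hξ
  rcases m with ⟨i, j⟩ | s
  · simp only [dualSystem]
    obtain ⟨h1, h2, -⟩ := occupation_factor hθ (hξ j)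
    have h3 : 0 ≤ p i j * ξ (.inl i) := mul_nonneg (hp i j) (Nat.cast_nonneg _)
    refine ⟨mul_nonneg h3 h1, fun h => mem_dualFinset.2 ⟨fun v => ?_, ?_⟩⟩
    · have h4 := pos_of_mul_pos_right h h3
      rcases eq_or_ne v j with rfl | hv
      · refine occupation_of_le (h2 h4) ?_
        simp [delta_apply]
      · refine occupation_of_le (hξ v) ?_
        simp [delta_apply, hv]
    · rw [sum_sub_delta_add_delta, hn]
      intro h0
      simp [h0] at h
  · simp only [dualSystem]
    refine ⟨mul_nonneg (hc s) (Nat.cast_nonneg _), fun h => mem_dualFinset.2 ⟨fun v => ?_, ?_⟩⟩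
    · refine occupation_of_le (hξ v) ?_
      simp [delta_apply]
    · rw [sum_sub_delta_add_delta, hn]
      intro h0
      simp [h0] at h

end Duality

/-! ### Absorption of the dual process -/

section Absorption

variable {V : Type*} [Fintype V] [DecidableEq V]

/-- `v` is the expected absorption time of the walk with conductances `p` that is killed at the
sites of the reservoirs. -/
structure IsAbsorptionTime (p : V → V → ℝ) (site : Side → V) (c : Side → ℝ) (v : V → ℝ) :
    Prop where
  pos : ∀ x, 0 < v x
  eq_one : ∀ x, ∑ y, p x y * (v x - v y) + (∑ s, if site s = x then c s else 0) * v x = 1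

/-- On linear functions the interaction disappears: its contribution `θ * p i j * ξ i * ξ j * (v j -
v i)` is antisymmetric in `i` and `j`. The weighted particle number evolves as for independent
walks. -/
theorem dual_generator_linear {θ : ℝ} {p : V → V → ℝ} (hp : ∀ i j, p i j = p j i)
    (site : Side → V) (c : Side → ℝ) (v : V → ℝ) (ξ : V ⊕ Side → ℕ) :
    (dualSystem θ p site c).generator (fun ξ => ∑ x, v x * (ξ (.inl x) : ℝ)) ξ =
      -∑ x, ξ (.inl x) * (∑ y, p x y * (v x - v y) +
        (∑ s, if site s = x then c s else 0) * v x) := by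
  have hsum : ∀ j : V, ∑ x, v x * ((delta j : V → ℕ) x : ℝ) = v j := fun j => by
    simp [delta_apply]
  have hsub : ∀ (i : V) (w : V ⊕ Side), (ξ (.inl i) : ℝ) *
      (∑ x, v x * ((ξ - delta (.inl i) + delta w : V ⊕ Side → ℕ) (.inl x) : ℝ) -
        ∑ x, v x * (ξ (.inl x) : ℝ)) =
      ξ (.inl i) * (Sum.elim v (fun _ => 0) w - v i) := by
    intro i w
    rcases eq_or_ne (ξ (.inl i)) 0 with h | h
    · simp [h]
    · congr 1
      have h1 : ∀ x, v x * ((ξ - delta (.inl i) + delta w : V ⊕ Side → ℕ) (.inl x) : ℝ) =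
          v x * ξ (.inl x) - v x * ((delta i : V → ℕ) x : ℝ) +
            v x * ((delta w : V ⊕ Side → ℕ) (.inl x) : ℝ) := by
        intro x
        rw [← mul_sub, ← mul_add]
        congr 1
        simp only [Pi.add_apply, Pi.sub_apply, delta_apply, Sum.inl.injEq]
        by_cases hx : x = i
        · subst hx
          have : 1 ≤ ξ (.inl x) := Nat.one_le_iff_ne_zero.2 h
          push_cast [this]
          simp [this]
        · simp [hx]
      simp only [h1, Finset.sum_add_distrib, Finset.sum_sub_distrib, hsum]
      have h2 : ∑ x, v x * ((delta w : V ⊕ Side → ℕ) (.inl x) : ℝ) =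
          Sum.elim v (fun _ => 0) w := by
        rcases w with j | s
        · simp [delta_apply]
        · simp [delta_apply]
      rw [h2]; ring
  rw [dualSystem_generator]
  have hbulk : ∑ i, ∑ j, p i j * ξ (.inl i) * (1 + θ * ξ (.inl j)) *
        (∑ x, v x * ((ξ - delta (.inl i) + delta (.inl j) : V ⊕ Side → ℕ) (.inl x) : ℝ) -
          ∑ x, v x * (ξ (.inl x) : ℝ)) =
      ∑ i, ∑ j, p i j * ξ (.inl i) * (v j - v i) := by
    have anti : ∑ i, ∑ j, p i j * ξ (.inl i) * ξ (.inl j) * (v j - v i) = 0 := by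
      have : ∑ i, ∑ j, p i j * ξ (.inl i) * ξ (.inl j) * (v j - v i) =
          -∑ i, ∑ j, p i j * ξ (.inl i) * ξ (.inl j) * (v j - v i) := by
        conv_lhs => rw [Finset.sum_comm]
        rw [← Finset.sum_neg_distrib]
        refine Finset.sum_congr rfl fun i _ => ?_
        rw [← Finset.sum_neg_distrib]
        refine Finset.sum_congr rfl fun j _ => ?_
        rw [hp j i]; ring
      linarith
    have e : ∀ i j, p i j * ξ (.inl i) * (1 + θ * ξ (.inl j)) *
        (∑ x, v x * ((ξ - delta (.inl i) + delta (.inl j) : V ⊕ Side → ℕ) (.inl x) : ℝ) -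
          ∑ x, v x * (ξ (.inl x) : ℝ)) = p i j * ξ (.inl i) * (v j - v i) +
          θ * (p i j * ξ (.inl i) * ξ (.inl j) * (v j - v i)) := by
      intro i j
      have := hsub i (.inl j)
      simp only [Sum.elim_inl] at this
      linear_combination (p i j * (1 + θ * ξ (.inl j))) * this
    simp only [e, Finset.sum_add_distrib, ← Finset.mul_sum, anti, mul_zero, add_zero]
  rw [hbulk]
  have hbd : ∑ s, c s * ξ (.inl (site s)) *
        (∑ x, v x * ((ξ - delta (.inl (site s)) + delta (.inr s) : V ⊕ Side → ℕ) (.inl x) : ℝ) -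
          ∑ x, v x * (ξ (.inl x) : ℝ)) =
      -∑ x, ξ (.inl x) * ((∑ s, if site s = x then c s else 0) * v x) := by
    have e : ∀ x, (ξ (.inl x) : ℝ) * ((∑ s, if site s = x then c s else 0) * v x) =
        ∑ s, if site s = x then c s * ξ (.inl x) * v x else 0 := by
      intro x
      rw [Finset.sum_mul, Finset.mul_sum]
      refine Finset.sum_congr rfl fun s _ => ?_
      split_ifs <;> ring
    simp only [e]
    rw [Finset.sum_comm, ← Finset.sum_neg_distrib]
    refine Finset.sum_congr rfl fun s _ => ?_
    have := hsub (site s) (.inr s)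
    simp only [Sum.elim_inr] at this
    rw [Finset.sum_ite_eq, if_pos (Finset.mem_univ _)]
    linear_combination c s * this
  rw [hbd, ← sub_eq_add_neg]
  simp only [mul_add, Finset.sum_add_distrib, neg_add, Finset.mul_sum]
  rw [sub_eq_add_neg]
  congr 1
  rw [← Finset.sum_neg_distrib]
  refine Finset.sum_congr rfl fun i _ => ?_
  rw [← Finset.sum_neg_distrib]
  exact Finset.sum_congr rfl fun j _ => by ring

/-- The indicator of the configurations that have particles in `V`. -/
noncomputable def unabsorbed (ξ : V ⊕ Side → ℕ) : ℝ :=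
  if ∀ x, ξ (.inl x) = 0 then 0 else 1

/-- For `f ξ = ∑ v x * ξ x` the generator gives minus the number of particles in `V`, which is at
most `-f / b` for a bound `b` of `v`. So the expectation of `f` decays exponentially, while `f` is
at least `min v` as long as some particle is in `V`. -/
theorem tendsto_unabsorbed {θ : ℝ} (hθ : AdmissibleTheta θ) {p : V → V → ℝ}
    (hp0 : ∀ i j, 0 ≤ p i j) (hp : ∀ i j, p i j = p j i) {site : Side → V} {c : Side → ℝ}
    (hc : ∀ s, 0 ≤ c s) {v : V → ℝ} (hv : IsAbsorptionTime p site c v) {n : ℕ}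
    {ξ : V ⊕ Side → ℕ} (hξ : ξ ∈ dualFinset V θ n) :
    Tendsto (fun t => (dualSystem θ p site c).finExpect (dualFinset V θ n) t unabsorbed ξ)
      atTop (𝓝 0) := by
  have hF := dualSystem_invariant hθ hp0 site hc n
  obtain ⟨δ, hδ, hδv⟩ : ∃ δ : ℝ, 0 < δ ∧ ∀ x, δ ≤ v x := by
    rcases isEmpty_or_nonempty V with h | h
    · exact ⟨1, one_pos, fun x => h.elim x⟩
    · obtain ⟨x₀, hx₀⟩ := Finite.exists_min v
      exact ⟨v x₀, hv.pos x₀, hx₀⟩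
  set f : (V ⊕ Side → ℕ) → ℝ := fun ξ => ∑ x, v x * (ξ (.inl x) : ℝ)
  -- The summand `1` keeps `b` positive even if `V` is empty.
  set b : ℝ := 1 + ∑ x, v x
  have hb : 0 < b := by
    have := Finset.sum_nonneg fun x (_ : x ∈ Finset.univ) => (hv.pos x).le
    simp only [b]; linarith
  have hle : ∀ y ∈ dualFinset V θ n, (dualSystem θ p site c).generator f y ≤ -(1 / b) * f y := by
    intro y _
    rw [dual_generator_linear hp site c v y]
    simp only [hv.eq_one, mul_one]
    rw [neg_mul, neg_le_neg_iff, one_div, inv_mul_le_iff₀ hb, Finset.mul_sum]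
    refine Finset.sum_le_sum fun x _ => mul_le_mul_of_nonneg_right ?_ (Nat.cast_nonneg _)
    have := Finset.single_le_sum (fun x _ => (hv.pos x).le) (Finset.mem_univ x)
    simp only [b]; linarith
  have hun : ∀ y ∈ dualFinset V θ n, unabsorbed y ≤ δ⁻¹ * f y := by
    intro y _
    have h0 : ∀ x, 0 ≤ v x * (y (.inl x) : ℝ) :=
      fun x => mul_nonneg (hv.pos x).le (Nat.cast_nonneg _)
    rw [unabsorbed]
    split_ifs with h
    · exact mul_nonneg (inv_nonneg.2 hδ.le) (Finset.sum_nonneg fun x _ => h0 x)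
    · push Not at h
      obtain ⟨x, hx⟩ := h
      rw [inv_mul_eq_div, le_div_iff₀ hδ, one_mul]
      refine le_trans ?_ (Finset.single_le_sum (fun x _ => h0 x) (Finset.mem_univ x))
      have : (1 : ℝ) ≤ y (.inl x) := by exact_mod_cast Nat.one_le_iff_ne_zero.2 hx
      nlinarith [hδv x]
  have hlim : Tendsto (fun t => δ⁻¹ * (Real.exp (-(1 / b) * t) * f ξ)) atTop (𝓝 0) := by
    have h1 : Tendsto (fun t : ℝ => Real.exp (-(1 / b) * t)) atTop (𝓝 0) :=
      Real.tendsto_exp_atBot.comp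
        (tendsto_id.const_mul_atTop_of_neg (neg_neg_of_pos (by positivity)))
    simpa using (h1.mul_const (f ξ)).const_mul δ⁻¹
  refine tendsto_of_tendsto_of_tendsto_of_le_of_le' tendsto_const_nhds hlim
    (Eventually.of_forall fun t => JumpSystem.finExpect_nonneg (fun y _ => ?_) t ξ) ?_
  · rw [unabsorbed]; split_ifs <;> norm_num
  · filter_upwards [eventually_ge_atTop 0] with t ht
    refine (JumpSystem.finExpect_mono hun t ξ).trans ?_
    rw [JumpSystem.finExpect_const_mul]
    exact mul_le_mul_of_nonneg_left (JumpSystem.finExpect_le_exp_mul hF hle hξ ht)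
      (inv_nonneg.2 hδ.le)

/-- The indicator of the configurations without a particle at the absorbing site `s`. -/
noncomputable def noneAt (s : Side) (ξ : V ⊕ Side → ℕ) : ℝ := if ξ (.inr s) = 0 then 1 else 0

theorem noneAt_antitone {V : Type*} {s : Side} {ξ ξ' : V ⊕ Side → ℕ}
    (h : ξ (.inr s) ≤ ξ' (.inr s)) : noneAt s ξ' ≤ noneAt s ξ := by
  simp only [noneAt]
  split_ifs with h1 h2 <;> first | omega | norm_num

theorem generator_noneAt_nonpos {θ : ℝ} (hθ : AdmissibleTheta θ) {p : V → V → ℝ}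
    (hp0 : ∀ i j, 0 ≤ p i j) (site : Side → V) {c : Side → ℝ} (hc : ∀ s, 0 ≤ c s) {n : ℕ}
    (s : Side) {ξ : V ⊕ Side → ℕ} (hξ : ξ ∈ dualFinset V θ n) :
    (dualSystem θ p site c).generator (noneAt s) ξ ≤ 0 := by
  have hF := dualSystem_invariant hθ hp0 site hc n
  refine Finset.sum_nonpos fun m _ =>
    mul_nonpos_of_nonneg_of_nonpos (hF ξ hξ m).1 (sub_nonpos.2 (noneAt_antitone ?_))
  rcases m with ⟨i, j⟩ | s' <;> simp [dualSystem, delta_apply]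

/-- Particles never leave an absorbing site, so this probability is nonincreasing in time. Its limit
exists whether or not the particles are eventually absorbed. -/
theorem exists_tendsto_noneAt {θ : ℝ} (hθ : AdmissibleTheta θ) {p : V → V → ℝ}
    (hp0 : ∀ i j, 0 ≤ p i j) (site : Side → V) {c : Side → ℝ} (hc : ∀ s, 0 ≤ c s) {n : ℕ}
    (s : Side) {ξ : V ⊕ Side → ℕ} (hξ : ξ ∈ dualFinset V θ n) :
    ∃ g, Tendsto (fun t => (dualSystem θ p site c).finExpect (dualFinset V θ n) t (noneAt s) ξ)
      atTop (𝓝 g) := by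
  have hF := dualSystem_invariant hθ hp0 site hc n
  have hanti := JumpSystem.finExpect_antitoneOn hF
    (fun y hy => generator_noneAt_nonpos hθ hp0 site hc s hy) hξ
  set φ := fun t => (dualSystem θ p site c).finExpect (dualFinset V θ n) t (noneAt s) ξ
  -- Monotonicity is only known for nonnegative times; the function is frozen before `0`.
  have h1 : Antitone fun t => φ (max t 0) := fun a b hab =>
    hanti (Set.mem_Ici.2 (le_max_right _ _)) (Set.mem_Ici.2 (le_max_right _ _))
      (max_le_max_right 0 hab)
  have h2 := tendsto_atTop_ciInf h1 ⟨0, by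
    rintro _ ⟨t, rfl⟩
    refine JumpSystem.finExpect_nonneg (fun y _ => ?_) _ ξ
    rw [noneAt]; split_ifs <;> norm_num⟩
  refine ⟨_, h2.congr' ?_⟩
  filter_upwards [eventually_ge_atTop 0] with t ht
  rw [max_eq_left ht]

theorem noLeftProb_eq {θ : ℝ} (hθ : AdmissibleTheta θ) {p : V → V → ℝ}
    (hp0 : ∀ i j, 0 ≤ p i j) (site : Side → V) {c : Side → ℝ} (hc : ∀ s, 0 ≤ c s) {n : ℕ}
    {ξ : V ⊕ Side → ℕ} (hξ : ξ ∈ dualFinset V θ n) {t : ℝ} (ht : 0 ≤ t) :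
    noLeftProb θ p site c t ξ =
      (dualSystem θ p site c).finExpect (dualFinset V θ n) t (noneAt .left) ξ := by
  rw [noLeftProb, JumpSystem.prob_toReal_eq_finExpect
    (dualSystem_invariant hθ hp0 site hc n) _ hξ ht]
  exact JumpSystem.finExpect_congr (fun y _ => by simp [noneAt]) t ξ

theorem tendsto_noLeftProb {θ : ℝ} (hθ : AdmissibleTheta θ) {p : V → V → ℝ}
    (hp0 : ∀ i j, 0 ≤ p i j) (site : Side → V) {c : Side → ℝ} (hc : ∀ s, 0 ≤ c s)
    {ξ : V ⊕ Side → ℕ} (hξ : ξ ∈ dualSpace V θ) :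
    Tendsto (fun t => noLeftProb θ p site c t ξ) atTop (𝓝 (noLeftLimit θ p site c ξ)) := by
  refine tendsto_nhds_limUnder ?_
  have hξ' : ξ ∈ dualFinset V θ (∑ w, ξ w) := mem_dualFinset.2 ⟨hξ, rfl⟩
  obtain ⟨g, hg⟩ := exists_tendsto_noneAt hθ hp0 site hc .left hξ'
  refine ⟨g, hg.congr' ?_⟩
  filter_upwards [eventually_ge_atTop 0] with t ht
  exact (noLeftProb_eq hθ hp0 site hc hξ' ht).symm

theorem tendsto_finExpect_noneAt {θ : ℝ} (hθ : AdmissibleTheta θ) {p : V → V → ℝ}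
    (hp0 : ∀ i j, 0 ≤ p i j) (site : Side → V) {c : Side → ℝ} (hc : ∀ s, 0 ≤ c s) {n : ℕ}
    {ξ : V ⊕ Side → ℕ} (hξ : ξ ∈ dualFinset V θ n) :
    Tendsto (fun t => (dualSystem θ p site c).finExpect (dualFinset V θ n) t (noneAt .left) ξ)
      atTop (𝓝 (noLeftLimit θ p site c ξ)) := by
  refine (tendsto_noLeftProb hθ hp0 site hc (mem_dualFinset.1 hξ).1).congr' ?_
  filter_upwards [eventually_ge_atTop 0] with t ht
  exact noLeftProb_eq hθ hp0 site hc hξ ht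

/-- The long-time limit of an expectation of the dual process only depends on the values of the
function at absorbed configurations. -/
theorem tendsto_finExpect_of_absorbed {θ : ℝ} (hθ : AdmissibleTheta θ) {p : V → V → ℝ}
    (hp0 : ∀ i j, 0 ≤ p i j) (hp : ∀ i j, p i j = p j i) {site : Side → V} {c : Side → ℝ}
    (hc : ∀ s, 0 ≤ c s) {v : V → ℝ} (hv : IsAbsorptionTime p site c v) {n : ℕ}
    {ξ : V ⊕ Side → ℕ} (hξ : ξ ∈ dualFinset V θ n) {f g : (V ⊕ Side → ℕ) → ℝ}
    (hfg : ∀ y ∈ dualFinset V θ n, (∀ x, y (.inl x) = 0) → f y = g y) {a : ℝ}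
    (hf : Tendsto (fun t => (dualSystem θ p site c).finExpect (dualFinset V θ n) t f ξ)
      atTop (𝓝 a)) :
    Tendsto (fun t => (dualSystem θ p site c).finExpect (dualFinset V θ n) t g ξ)
      atTop (𝓝 a) := by
  set F := dualFinset V θ n
  set Q := dualSystem θ p site c
  -- On the finite set `F` the difference `g - f` is bounded, and it is supported on configurations
  -- with a particle in `V`, whose probability tends to `0`.
  set b := ∑ y ∈ F, |g y - f y|
  have h0 := (tendsto_unabsorbed hθ hp0 hp hc hv hξ).const_mul b
  rw [mul_zero] at h0
  have hpt : ∀ y ∈ F, |g y - f y| ≤ b * unabsorbed y := by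
    intro y hy
    rw [unabsorbed]
    split_ifs with h
    · simp [hfg y hy h]
    · rw [mul_one]
      exact Finset.single_le_sum (f := fun y => |g y - f y|) (fun _ _ => abs_nonneg _) hy
  have hdiff : Tendsto (fun t => Q.finExpect F t g ξ - Q.finExpect F t f ξ) atTop (𝓝 0) := by
    refine squeeze_zero_norm (fun t => ?_) h0
    rw [Real.norm_eq_abs, ← JumpSystem.finExpect_const_mul, abs_le]
    have h1 := JumpSystem.finExpect_mono (Q := Q) (F := F) (f := g)
      (g := fun y => f y + b * unabsorbed y) (fun y hy => by
        linarith [(abs_le.1 (hpt y hy)).2]) t ξ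
    have h2 := JumpSystem.finExpect_mono (Q := Q) (F := F) (f := f)
      (g := fun y => g y + b * unabsorbed y) (fun y hy => by
        linarith [(abs_le.1 (hpt y hy)).1]) t ξ
    rw [JumpSystem.finExpect_add Q F f] at h1
    rw [JumpSystem.finExpect_add Q F g] at h2
    constructor <;> linarith
  simpa using hdiff.add hf

/-! ### A single dual particle -/

theorem exists_eq_delta {W : Type*} [Fintype W] [DecidableEq W] {ζ : W → ℕ}
    (h : ∑ w, ζ w = 1) : ∃ w, ζ = delta w := by
  obtain ⟨w, hw⟩ : ∃ w, ζ w ≠ 0 := by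
    by_contra! h0
    simp [h0] at h
  refine ⟨w, funext fun u => ?_⟩
  rw [← Finset.add_sum_erase _ _ (Finset.mem_univ w)] at h
  have h2 : ∑ x ∈ Finset.univ.erase w, ζ x = 0 := by omega
  rw [delta_apply]
  split_ifs with hu
  · subst hu; omega
  · exact (Finset.sum_eq_zero_iff.1 h2) u (by simp [hu])

theorem delta_injective {W : Type*} [DecidableEq W] : Function.Injective (delta : W → W → ℕ) := by
  intro a b h
  have := congrFun h a
  simp only [delta_apply, if_true] at this
  by_contra hab
  simp [hab] at this

theorem one_mem_occupation {θ : ℝ} (hθ : AdmissibleTheta θ) : 1 ∈ occupation θ := by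
  have h0 : 0 ∈ occupation θ := by
    by_cases h : 0 ≤ θ
    · exact Or.inl h
    · exact Or.inr (by simp)
  simpa using (occupation_factor hθ h0).2.1 (by simp)

theorem delta_mem_dualFinset {θ : ℝ} (hθ : AdmissibleTheta θ) (w : V ⊕ Side) :
    delta w ∈ dualFinset V θ 1 := by
  refine mem_dualFinset.2 ⟨fun i => occupation_of_le (one_mem_occupation hθ) ?_, ?_⟩
  · rw [delta_apply]; split_ifs <;> simp
  · simp [delta_apply]

theorem walkProb_eq {θ : ℝ} (hθ : AdmissibleTheta θ) {p : V → V → ℝ}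
    (hp0 : ∀ i j, 0 ≤ p i j) (site : Side → V) {c : Side → ℝ} (hc : ∀ s, 0 ≤ c s)
    {t : ℝ} (ht : 0 ≤ t) (u w : V ⊕ Side) :
    walkProb θ p site c t u w = (dualSystem θ p site c).finExpect (dualFinset V θ 1) t
      (fun ξ => if ξ = delta w then 1 else 0) (delta u) := by
  rw [walkProb, JumpSystem.prob_toReal_eq_finExpect
    (dualSystem_invariant hθ hp0 site hc 1) _ (delta_mem_dualFinset hθ u) ht]
  exact JumpSystem.finExpect_congr (fun y _ => by simp) t _

theorem walkProb_side_eq {θ : ℝ} (hθ : AdmissibleTheta θ) {p : V → V → ℝ}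
    (hp0 : ∀ i j, 0 ≤ p i j) (site : Side → V) {c : Side → ℝ} (hc : ∀ s, 0 ≤ c s)
    {t : ℝ} (ht : 0 ≤ t) (u : V ⊕ Side) (s : Side) :
    walkProb θ p site c t u (.inr s) = 1 - (dualSystem θ p site c).finExpect (dualFinset V θ 1) t
      (noneAt s) (delta u) := by
  have h1 := JumpSystem.finExpect_one (dualSystem_invariant hθ hp0 site hc 1)
    (delta_mem_dualFinset hθ u) ht
  rw [walkProb_eq hθ hp0 site hc ht, eq_sub_iff_add_eq, ← JumpSystem.finExpect_add]
  refine Eq.trans ?_ h1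
  refine JumpSystem.finExpect_congr (fun y hy => ?_) t _
  obtain ⟨w, rfl⟩ := exists_eq_delta (mem_dualFinset.1 hy).2
  simp only [noneAt, delta_injective.eq_iff, delta_apply]
  by_cases h : w = .inr s
  · simp [h]
  · simp [h, Ne.symm h]

theorem sum_walkProb_eq {θ : ℝ} (hθ : AdmissibleTheta θ) {p : V → V → ℝ}
    (hp0 : ∀ i j, 0 ≤ p i j) (site : Side → V) {c : Side → ℝ} (hc : ∀ s, 0 ≤ c s)
    {t : ℝ} (ht : 0 ≤ t) (u : V ⊕ Side) :
    ∑ w ∈ Finset.univ.erase (.inr .left : V ⊕ Side), walkProb θ p site c t u w =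
      (dualSystem θ p site c).finExpect (dualFinset V θ 1) t (noneAt .left) (delta u) := by
  simp only [walkProb_eq hθ hp0 site hc ht, JumpSystem.finExpect]
  rw [Finset.sum_comm]
  refine Finset.sum_congr rfl fun y hy => ?_
  rw [← Finset.sum_mul]
  congr 1
  obtain ⟨w, rfl⟩ := exists_eq_delta (mem_dualFinset.1 hy).2
  simp only [noneAt, delta_injective.eq_iff, delta_apply, Finset.sum_ite_eq, Finset.mem_erase,
    Finset.mem_univ, and_true]
  by_cases h : w = .inr .left
  · simp [h]
  · simp [h, Ne.symm h]

theorem config_eq_zero_iff {ι W : Type*} [Fintype ι] [DecidableEq W] (z : ι → W) (w : W) :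
    config z w = 0 ↔ ∀ i, z i ≠ w := by
  simp only [config, Finset.sum_apply, Finset.sum_eq_zero_iff, Finset.mem_univ, true_imp_iff,
    delta_apply]
  refine forall_congr' fun i => ?_
  by_cases h : w = z i
  · simp [h]
  · simp [h, Ne.symm h]

/-- Avoiding the left absorbing site is a condition on each walker separately, so the sum over joint
positions factorises. -/
theorem irwNoLeftProb_eq {θ : ℝ} (hθ : AdmissibleTheta θ) {p : V → V → ℝ}
    (hp0 : ∀ i j, 0 ≤ p i j) (site : Side → V) {c : Side → ℝ} (hc : ∀ s, 0 ≤ c s)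
    {ι : Type*} [Fintype ι] [DecidableEq ι] {t : ℝ} (ht : 0 ≤ t) (y : ι → V ⊕ Side) :
    irwNoLeftProb θ p site c t y = ∏ i, noLeftProb θ p site c t (delta (y i)) := by
  have h : ∀ i, noLeftProb θ p site c t (delta (y i)) =
      ∑ w ∈ Finset.univ.erase (.inr .left : V ⊕ Side), walkProb θ p site c t (y i) w := fun i => by
    rw [sum_walkProb_eq hθ hp0 site hc ht,
      noLeftProb_eq hθ hp0 site hc (delta_mem_dualFinset hθ _) ht]
  simp only [h]
  rw [Finset.prod_univ_sum, irwNoLeftProb, ← Finset.sum_filter]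
  refine Finset.sum_congr ?_ fun _ _ => rfl
  ext z
  simp [config_eq_zero_iff]

theorem tendsto_irwNoLeftProb {θ : ℝ} (hθ : AdmissibleTheta θ) {p : V → V → ℝ}
    (hp0 : ∀ i j, 0 ≤ p i j) (site : Side → V) {c : Side → ℝ} (hc : ∀ s, 0 ≤ c s)
    {ι : Type*} [Fintype ι] [DecidableEq ι] (y : ι → V ⊕ Side) :
    Tendsto (fun t => irwNoLeftProb θ p site c t y) atTop
      (𝓝 (∏ i, noLeftLimit θ p site c (delta (y i)))) := by
  have h := tendsto_finsetProd (s := Finset.univ) fun i _ =>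
    tendsto_noLeftProb hθ hp0 site hc
      (mem_dualFinset.1 (delta_mem_dualFinset hθ (y i))).1
  refine h.congr' ?_
  filter_upwards [eventually_ge_atTop 0] with t ht
  exact (irwNoLeftProb_eq hθ hp0 site hc ht y).symm

theorem irwNoLeftLimit_eq {θ : ℝ} (hθ : AdmissibleTheta θ) {p : V → V → ℝ}
    (hp0 : ∀ i j, 0 ≤ p i j) (site : Side → V) {c : Side → ℝ} (hc : ∀ s, 0 ≤ c s)
    {ι : Type*} [Fintype ι] [DecidableEq ι] (y : ι → V ⊕ Side) :
    irwNoLeftLimit θ p site c y = ∏ i, noLeftLimit θ p site c (delta (y i)) :=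
  (tendsto_irwNoLeftProb hθ hp0 site hc y).limUnder_eq

theorem exists_tendsto_walkProb {θ : ℝ} (hθ : AdmissibleTheta θ) {p : V → V → ℝ}
    (hp0 : ∀ i j, 0 ≤ p i j) (site : Side → V) {c : Side → ℝ} (hc : ∀ s, 0 ≤ c s)
    (u : V ⊕ Side) (s : Side) :
    ∃ g, Tendsto (fun t => walkProb θ p site c t u (.inr s)) atTop (𝓝 g) := by
  obtain ⟨g, hg⟩ := exists_tendsto_noneAt hθ hp0 site hc s (delta_mem_dualFinset hθ u)
  refine ⟨1 - g, (tendsto_const_nhds.sub hg).congr' ?_⟩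
  filter_upwards [eventually_ge_atTop 0] with t ht
  exact (walkProb_side_eq hθ hp0 site hc ht u s).symm

theorem tendsto_walkProb {θ : ℝ} (hθ : AdmissibleTheta θ) {p : V → V → ℝ}
    (hp0 : ∀ i j, 0 ≤ p i j) (site : Side → V) {c : Side → ℝ} (hc : ∀ s, 0 ≤ c s)
    (u : V ⊕ Side) (s : Side) :
    Tendsto (fun t => walkProb θ p site c t u (.inr s)) atTop
      (𝓝 (walkLimit θ p site c u (.inr s))) :=
  tendsto_nhds_limUnder (exists_tendsto_walkProb hθ hp0 site hc u s)

theorem walkLimit_left {θ : ℝ} (hθ : AdmissibleTheta θ) {p : V → V → ℝ}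
    (hp0 : ∀ i j, 0 ≤ p i j) (site : Side → V) {c : Side → ℝ} (hc : ∀ s, 0 ≤ c s)
    (u : V ⊕ Side) :
    walkLimit θ p site c u (.inr .left) = 1 - noLeftLimit θ p site c (delta u) := by
  refine tendsto_nhds_unique (tendsto_walkProb hθ hp0 site hc u .left) ?_
  refine (tendsto_const_nhds.sub
    (tendsto_finExpect_noneAt hθ hp0 site hc (delta_mem_dualFinset hθ u))).congr' ?_
  filter_upwards [eventually_ge_atTop 0] with t ht
  exact (walkProb_side_eq hθ hp0 site hc ht u .left).symm

/-- This is where absorption matters for the walk: not being at the left site means being at the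
right one only once the walk has left `V`. -/
theorem walkLimit_right {θ : ℝ} (hθ : AdmissibleTheta θ) {p : V → V → ℝ}
    (hp0 : ∀ i j, 0 ≤ p i j) (hp : ∀ i j, p i j = p j i) {site : Side → V} {c : Side → ℝ}
    (hc : ∀ s, 0 ≤ c s) {v : V → ℝ} (hv : IsAbsorptionTime p site c v) (u : V ⊕ Side) :
    walkLimit θ p site c u (.inr .right) = noLeftLimit θ p site c (delta u) := by
  have hu := delta_mem_dualFinset hθ u
  have h1 := tendsto_finExpect_of_absorbed hθ hp0 hp hc hv hu
    (g := fun y => if y = delta (.inr .right) then 1 else 0) (fun y hy h0 => ?_)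
    (tendsto_finExpect_noneAt hθ hp0 site hc hu)
  · refine tendsto_nhds_unique (tendsto_walkProb hθ hp0 site hc u .right) (h1.congr' ?_)
    filter_upwards [eventually_ge_atTop 0] with t ht
    exact (walkProb_eq hθ hp0 site hc ht u _).symm
  · obtain ⟨w, rfl⟩ := exists_eq_delta (mem_dualFinset.1 hy).2
    rcases w with x | s | s
    · simpa [delta_apply] using h0 x
    · simp [noneAt, delta_injective.eq_iff, delta_apply]
    · simp [noneAt, delta_apply]

end Absorption

section Stationary

variable {V : Type*} [Fintype V] [DecidableEq V]

/-! ### Stationary measures -/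

/-- As the configuration space is countable, invariance of the masses of points extends to all
nonnegative functions. -/
theorem IsStationary.lintegral_expect
    {θ : ℝ} {p : V → V → ℝ} {site : Side → V} {c ρ : Side → ℝ} {μ : Measure (V → ℕ)}
    (hμ : IsStationary θ p site c ρ μ)
    {t : ℝ} (ht : 0 ≤ t) (f : (V → ℕ) → ℝ≥0∞) :
    ∫⁻ η, (reservoirSystem θ p site c ρ).expect t f η ∂μ = ∫⁻ η, f η ∂μ := by
  simp only [JumpSystem.expect_eq_tsum]
  rw [lintegral_tsum fun y => (Measurable.of_discrete).aemeasurable, lintegral_countable']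
  refine tsum_congr fun y => ?_
  rw [lintegral_const_mul _ Measurable.of_discrete, hμ.2.2 t ht]

theorem IsStationary.ae_mem {θ : ℝ} {p : V → V → ℝ} {site : Side → V} {c ρ : Side → ℝ}
    {μ : Measure (V → ℕ)} (hμ : IsStationary θ p site c ρ μ) : ∀ᵐ η ∂μ, η ∈ stateSpace V θ :=
  hμ.2.1

/-! ### Isolated sets of sites -/

/-- The configuration that agrees with `ζ` on `C` and with `η` elsewhere. -/
def replaceOn (C : Finset V) (ζ η : V → ℕ) : V → ℕ := fun i => if i ∈ C then ζ i else η i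

/-- By `hζ`, the uniform weight on the family `ζ` is invariant for the dynamics inside the isolated
set `C`. Jumps inside `C` therefore cancel on the left, and on the right they are overwritten by the
replacement. Jumps across the boundary of `C` have rate zero, and all moves outside `C` commute with
the replacement. -/
theorem sum_generator_replaceOn {θ : ℝ} {p : V → V → ℝ} (hp : ∀ i j, p i j = p j i)
    {site : Side → V} {c : Side → ℝ} (ρ : Side → ℝ) {C : Finset V}
    (hC : ∀ i ∈ C, ∀ j ∉ C, p i j = 0) (hCs : ∀ s, site s ∈ C → c s = 0)
    {ι : Type*} [Fintype ι] (ζ : ι → V → ℕ)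
    (hζ : ∀ g : (V → ℕ) → ℝ, ∑ a, ∑ i ∈ C, ∑ j ∈ C, p i j * ζ a i * (1 + θ * ζ a j) *
      (g (ζ a - delta i + delta j) - g (ζ a)) = 0) (f : (V → ℕ) → ℝ) (η : V → ℕ) :
    ∑ a, (reservoirSystem θ p site c ρ).generator f (replaceOn C (ζ a) η) =
      (reservoirSystem θ p site c ρ).generator (fun η => ∑ a, f (replaceOn C (ζ a) η)) η := by
  simp only [reservoirSystem_generator, Finset.sum_add_distrib]
  congr 1
  · set T : ι → V → V → ℝ := fun a i j =>
      p i j * (replaceOn C (ζ a) η i) * (1 + θ * replaceOn C (ζ a) η j) *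
        (f (replaceOn C (ζ a) η - delta i + delta j) - f (replaceOn C (ζ a) η))
    have hT : ∑ a, ∑ i ∈ C, ∑ j ∈ C, T a i j = 0 := by
      refine Eq.trans ?_ (hζ fun ζ' => f (replaceOn C ζ' η))
      refine Finset.sum_congr rfl fun a _ => Finset.sum_congr rfl fun i hi =>
        Finset.sum_congr rfl fun j hj => ?_
      have e : replaceOn C (ζ a) η - delta i + delta j =
          replaceOn C (ζ a - delta i + delta j) η := by
        funext k
        by_cases hk : k ∈ C
        · simp [replaceOn, hk]
        · have h1 : k ≠ i := fun h => hk (h ▸ hi)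
          have h2 : k ≠ j := fun h => hk (h ▸ hj)
          simp [replaceOn, hk, delta_apply, h1, h2]
      simp only [T, e]
      simp [replaceOn, hi, hj]
    have hU : ∀ i j, p i j * η i * (1 + θ * η j) *
        (∑ a, f (replaceOn C (ζ a) (η - delta i + delta j)) - ∑ a, f (replaceOn C (ζ a) η)) =
        ∑ a, T a i j - if i ∈ C then (if j ∈ C then ∑ a, T a i j else 0) else 0 := by
      intro i j
      by_cases hi : i ∈ C <;> by_cases hj : j ∈ C
      · have e : ∀ a, replaceOn C (ζ a) (η - delta i + delta j) = replaceOn C (ζ a) η := by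
          intro a
          funext k
          by_cases hk : k ∈ C
          · simp [replaceOn, hk]
          · have h1 : k ≠ i := fun h => hk (h ▸ hi)
            have h2 : k ≠ j := fun h => hk (h ▸ hj)
            simp [replaceOn, hk, delta_apply, h1, h2]
        simp [e, hi, hj]
      · simp [T, hi, hj, hC i hi j hj]
      · simp [T, hi, hp i j, hC j hj i hi]
      · have e : ∀ a, replaceOn C (ζ a) (η - delta i + delta j) =
            replaceOn C (ζ a) η - delta i + delta j := by
          intro a
          funext k
          by_cases hk : k ∈ C
          · have h1 : k ≠ i := fun h => hi (h ▸ hk)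
            have h2 : k ≠ j := fun h => hj (h ▸ hk)
            simp [replaceOn, hk, delta_apply, h1, h2]
          · simp [replaceOn, hk]
        simp only [T, e, hi, if_false, sub_zero, ← Finset.sum_sub_distrib, Finset.mul_sum]
        simp [replaceOn, hi, hj]
    simp only [hU, Finset.sum_sub_distrib]
    have e1 : ∑ i, ∑ j, (if i ∈ C then (if j ∈ C then ∑ a, T a i j else 0) else 0) =
        ∑ a, ∑ i ∈ C, ∑ j ∈ C, T a i j := by
      have : ∀ i j, (if i ∈ C then (if j ∈ C then ∑ a, T a i j else 0) else 0) =
          ∑ a, if i ∈ C then (if j ∈ C then T a i j else 0) else 0 := by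
        intro i j
        split_ifs <;> simp
      simp only [this]
      rw [Finset.sum_congr rfl fun i _ => Finset.sum_comm, Finset.sum_comm]
      refine Finset.sum_congr rfl fun a _ => ?_
      rw [← Finset.sum_filter_add_sum_filter_not Finset.univ (· ∈ C)]
      simp only [Finset.filter_mem_eq_inter, Finset.univ_inter]
      have z : ∑ i ∈ Finset.univ.filter (¬ · ∈ C), ∑ j,
          (if i ∈ C then (if j ∈ C then T a i j else 0) else 0) = 0 := by
        refine Finset.sum_eq_zero fun i hi => ?_
        simp [(Finset.mem_filter.1 hi).2]
      rw [z, add_zero]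
      refine Finset.sum_congr rfl fun i hi => ?_
      simp [hi]
    rw [e1, hT, sub_zero, Finset.sum_comm]
    exact Finset.sum_congr rfl fun i _ => Finset.sum_comm
  · rw [Finset.sum_comm]
    refine Finset.sum_congr rfl fun s _ => ?_
    by_cases hs : site s ∈ C
    · simp [hCs s hs]
    · have e1 : ∀ a, replaceOn C (ζ a) (η + delta (site s)) =
          replaceOn C (ζ a) η + delta (site s) := by
        intro a
        funext k
        by_cases hk : k ∈ C
        · have h1 : k ≠ site s := fun h => hs (h ▸ hk)
          simp [replaceOn, hk, delta_apply, h1]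
        · simp [replaceOn, hk]
      have e2 : ∀ a, replaceOn C (ζ a) (η - delta (site s)) =
          replaceOn C (ζ a) η - delta (site s) := by
        intro a
        funext k
        by_cases hk : k ∈ C
        · have h1 : k ≠ site s := fun h => hs (h ▸ hk)
          simp [replaceOn, hk, delta_apply, h1]
        · simp [replaceOn, hk]
      simp only [e1, e2, ← Finset.sum_sub_distrib, Finset.mul_sum, ← Finset.sum_add_distrib]
      simp [replaceOn, hs]

theorem replaceOn_mem {V : Type*} [DecidableEq V] {θ : ℝ} (C : Finset V) {ζ η : V → ℕ}
    (hζ : ζ ∈ stateSpace V θ) (hη : η ∈ stateSpace V θ) : replaceOn C ζ η ∈ stateSpace V θ := by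
  intro i
  rw [replaceOn]
  split_ifs
  exacts [hζ i, hη i]

/-- The average over `a` of the laws of `replaceOn C (ζ a) η` for `η` with law `μ`. -/
noncomputable def replaceMeasure {ι : Type*} [Fintype ι] (C : Finset V) (ζ : ι → V → ℕ)
    (μ : Measure (V → ℕ)) : Measure (V → ℕ) :=
  ∑ a, (Fintype.card ι : ℝ≥0∞)⁻¹ • μ.map (replaceOn C (ζ a))

theorem lintegral_replaceMeasure {ι : Type*} [Fintype ι] (C : Finset V) (ζ : ι → V → ℕ)
    (μ : Measure (V → ℕ)) (f : (V → ℕ) → ℝ≥0∞) :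
    ∫⁻ η, f η ∂(replaceMeasure C ζ μ) =
      (Fintype.card ι : ℝ≥0∞)⁻¹ * ∫⁻ η, ∑ a, f (replaceOn C (ζ a) η) ∂μ := by
  rw [replaceMeasure, lintegral_finsetSum_measure, lintegral_finsetSum _
    fun a _ => Measurable.of_discrete, Finset.mul_sum]
  refine Finset.sum_congr rfl fun a _ => ?_
  rw [lintegral_smul_measure, lintegral_map Measurable.of_discrete Measurable.of_discrete,
    smul_eq_mul]

/-- By `sum_generator_replaceOn` the averaged transition probabilities solve the backward equation
in `η`. Minimality gives one inequality only, `ν A ≤ ∫ P_t(A) dν`. Applied to `A` and to its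
complement, with total transition mass at most `1`, it becomes an equality. -/
theorem IsStationary.replaceMeasure {θ : ℝ} (hθ : AdmissibleTheta θ) {p : V → V → ℝ}
    (hp0 : ∀ i j, 0 ≤ p i j) (hp : ∀ i j, p i j = p j i) {site : Side → V} {c ρ : Side → ℝ}
    (hc : ∀ s, 0 ≤ c s) (hρ : ∀ s, 0 ≤ ρ s) (hθρ : ∀ s, 0 ≤ 1 + θ * ρ s) {C : Finset V}
    (hC : ∀ i ∈ C, ∀ j ∉ C, p i j = 0) (hCs : ∀ s, site s ∈ C → c s = 0)
    {ι : Type*} [Fintype ι] [Nonempty ι] {ζ : ι → V → ℕ} (hζS : ∀ a, ζ a ∈ stateSpace V θ)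
    (hζ : ∀ g : (V → ℕ) → ℝ, ∑ a, ∑ i ∈ C, ∑ j ∈ C, p i j * ζ a i * (1 + θ * ζ a j) *
      (g (ζ a - delta i + delta j) - g (ζ a)) = 0) {μ : Measure (V → ℕ)}
    (hμ : IsStationary θ p site c ρ μ) :
    IsStationary θ p site c ρ (replaceMeasure C ζ μ) := by
  set Q := reservoirSystem θ p site c ρ
  set ν := ConsistentIPS.replaceMeasure C ζ μ
  have hQ : Q.Invariant (stateSpace V θ) := reservoirSystem_invariant hθ hp0 site hc hρ hθρ
  have := hμ.1
  have hcard : (Fintype.card ι : ℝ≥0∞)⁻¹ * Fintype.card ι = 1 :=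
    ENNReal.inv_mul_cancel (by simp) (by simp)
  have hν : IsProbabilityMeasure ν := by
    constructor
    rw [← lintegral_one, lintegral_replaceMeasure]
    simp [hcard]
  have hle : ∀ t, 0 ≤ t → ∀ A : Set (V → ℕ), ν A ≤ ∫⁻ η, Q.prob t η A ∂ν := by
    intro t ht A
    have hind : ∀ y, A.indicator (1 : (V → ℕ) → ℝ≥0∞) y ≤ 1 :=
      fun y => Set.indicator_le_self' (fun _ _ => zero_le) y
    have hu : Q.IsSupersolution (stateSpace V θ) fun t η =>
        ∑ a, (Q.prob t (replaceOn C (ζ a) η) A).toReal := by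
      refine ⟨fun _ _ _ _ => Finset.sum_nonneg fun _ _ => ENNReal.toReal_nonneg,
        fun η hη t ht => ⟨_, HasDerivWithinAt.fun_sum fun a _ =>
          Q.hasDerivWithinAt_expect hind (replaceOn C (ζ a) η) ht, ?_⟩⟩
      have e : ∀ a, Q.posPart.generator (fun y => (Q.expect t (A.indicator 1) y).toReal)
          (replaceOn C (ζ a) η) = Q.generator (fun y => (Q.expect t (A.indicator 1) y).toReal)
          (replaceOn C (ζ a) η) :=
        fun a => Q.posPart_generator hQ (replaceOn_mem C (hζS a) hη) _
      simp only [e]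
      rw [sum_generator_replaceOn hp ρ hC hCs ζ hζ]
      rfl
    rw [← lintegral_indicator_one (MeasurableSet.of_discrete), lintegral_replaceMeasure,
      lintegral_replaceMeasure, ← hμ.lintegral_expect ht]
    refine mul_le_mul_right (lintegral_mono_ae ?_) _
    filter_upwards [hμ.ae_mem] with η hη
    refine (JumpSystem.expect_le_of_isSupersolution hQ hu (fun y _ => ?_) hη ht).trans ?_
    · rw [ENNReal.ofReal_sum_of_nonneg fun _ _ => ENNReal.toReal_nonneg]
      refine Finset.sum_le_sum fun a _ => ?_
      have e0 : Q.prob 0 (replaceOn C (ζ a) y) A = A.indicator 1 (replaceOn C (ζ a) y) :=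
        Q.expect_zero _ _
      rw [e0, ENNReal.ofReal_toReal ((hind _).trans_lt ENNReal.one_lt_top).ne]
    · rw [ENNReal.ofReal_sum_of_nonneg fun _ _ => ENNReal.toReal_nonneg]
      exact Finset.sum_le_sum fun a _ => ENNReal.ofReal_toReal_le
  refine ⟨hν, ?_, fun t ht A => ?_⟩
  · rw [← lintegral_indicator_one (MeasurableSet.of_discrete), lintegral_replaceMeasure,
      mul_eq_zero]
    right
    rw [lintegral_eq_zero_iff Measurable.of_discrete]
    filter_upwards [hμ.ae_mem] with η hη
    refine Finset.sum_eq_zero fun a _ => ?_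
    simp [replaceOn_mem C (hζS a) hη]
  · refine le_antisymm ?_ (hle t ht A)
    have h1 := hle t ht Aᶜ
    have h2 : ∫⁻ η, Q.prob t η A ∂ν + ∫⁻ η, Q.prob t η Aᶜ ∂ν ≤ 1 := by
      rw [← lintegral_add_left Measurable.of_discrete]
      refine (lintegral_mono (g := fun _ => 1) fun η => ?_).trans (by simp)
      have e := Q.expect_add (A.indicator 1) (Aᶜ.indicator 1) t η
      refine (e.symm.trans_le (Q.expect_le_one (fun y => ?_) ht η))
      by_cases hy : y ∈ A <;> simp [hy]
    have h3 : ν A + ν Aᶜ = 1 := by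
      rw [measure_add_measure_compl MeasurableSet.of_discrete, measure_univ]
    rw [← h3] at h2
    have h4 : ∫⁻ η, Q.prob t η A ∂ν + ν Aᶜ ≤ ν A + ν Aᶜ := (add_le_add_right h1 _).trans h2
    exact (ENNReal.add_le_add_iff_right (measure_ne_top ν _)).1 h4

/-- If the stationary measure is unique then every site is connected to a reservoir. -/
theorem isolated_eq_empty {θ : ℝ} (hθ : AdmissibleTheta θ) {p : V → V → ℝ}
    (hp0 : ∀ i j, 0 ≤ p i j) (hp : ∀ i j, p i j = p j i) {site : Side → V} {c ρ : Side → ℝ}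
    (hc : ∀ s, 0 ≤ c s) (hρ : ∀ s, 0 ≤ ρ s) (hθρ : ∀ s, 0 ≤ 1 + θ * ρ s)
    {μ : Measure (V → ℕ)} (hμ : IsStationary θ p site c ρ μ)
    (hμ_unique : ∀ ν : Measure (V → ℕ), IsStationary θ p site c ρ ν → ν = μ) {C : Finset V}
    (hC : ∀ i ∈ C, ∀ j ∉ C, p i j = 0) (hCs : ∀ s, site s ∈ C → c s = 0) : C = ∅ := by
  by_contra hne
  obtain ⟨x₀, hx₀⟩ := Finset.nonempty_iff_ne_empty.2 hne
  have : Nonempty C := ⟨⟨x₀, hx₀⟩⟩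
  have h1occ := one_mem_occupation hθ
  -- Two competing stationary measures: `C` empty, or one particle uniformly distributed in `C`,
  -- which is invariant because `p` is symmetric. The event that `C` is empty tells them apart.
  have h0 : IsStationary θ p site c ρ (replaceMeasure C (fun _ : Unit => 0) μ) := by
    refine hμ.replaceMeasure hθ hp0 hp hc hρ hθρ hC hCs
      (fun _ i => occupation_of_le h1occ (by simp)) fun g => ?_
    simp
  have h1 : IsStationary θ p site c ρ (replaceMeasure C (fun x : C => delta x.1) μ) := by
    refine hμ.replaceMeasure hθ hp0 hp hc hρ hθρ hC hCs
      (fun x i => occupation_of_le h1occ ?_) fun g => ?_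
    · rw [delta_apply]; split_ifs <;> simp
    · have e : ∀ x ∈ C, ∑ i ∈ C, ∑ j ∈ C, p i j * (delta x : V → ℕ) i *
          (1 + θ * (delta x : V → ℕ) j) * (g (delta x - delta i + delta j) - g (delta x)) =
          ∑ j ∈ C, p x j * (g (delta j) - g (delta x)) := by
        intro x hx
        rw [Finset.sum_eq_single x]
        · refine Finset.sum_congr rfl fun j _ => ?_
          have : (delta x - delta x + delta j : V → ℕ) = delta j := by simp
          rw [this]
          by_cases hj : j = x
          · subst hj; simp
          · simp [delta_apply, hj]
        · intro i _ hi
          simp [delta_apply, hi]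
        · exact fun h => absurd hx h
      rw [Finset.sum_coe_sort C fun x => ∑ i ∈ C, ∑ j ∈ C, p i j * (delta x : V → ℕ) i *
          (1 + θ * (delta x : V → ℕ) j) * (g (delta x - delta i + delta j) - g (delta x)),
        Finset.sum_congr rfl e]
      have anti : ∑ x ∈ C, ∑ j ∈ C, p x j * (g (delta j) - g (delta x)) =
          -∑ x ∈ C, ∑ j ∈ C, p x j * (g (delta j) - g (delta x)) := by
        conv_lhs => rw [Finset.sum_comm]
        rw [← Finset.sum_neg_distrib]
        refine Finset.sum_congr rfl fun i _ => ?_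
        rw [← Finset.sum_neg_distrib]
        refine Finset.sum_congr rfl fun j _ => ?_
        rw [hp j i]; ring
      linarith
  have heq := (hμ_unique _ h0).trans (hμ_unique _ h1).symm
  have hprob := hμ.1
  have hA := congrArg (fun ν : Measure (V → ℕ) =>
    ∫⁻ η, ({η | ∀ i ∈ C, η i = 0} : Set (V → ℕ)).indicator 1 η ∂ν) heq
  simp only [lintegral_replaceMeasure] at hA
  have e0 : ∀ η : V → ℕ, replaceOn C 0 η ∈ ({η | ∀ i ∈ C, η i = 0} : Set (V → ℕ)) := by
    intro η i hi
    simp [replaceOn, hi]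
  have e1 : ∀ (x : C) (η : V → ℕ),
      replaceOn C (delta x.1) η ∉ ({η | ∀ i ∈ C, η i = 0} : Set (V → ℕ)) := by
    intro x η h
    have := h x.1 x.2
    simp [replaceOn, delta_apply] at this
  simp [Set.indicator_of_mem (e0 _), Set.indicator_of_notMem (e1 _ _)] at hA

/-- If the stationary measure is unique then the dual particles are absorbed in finite mean
time. -/
theorem exists_isAbsorptionTime {θ : ℝ} (hθ : AdmissibleTheta θ) {p : V → V → ℝ}
    (hp0 : ∀ i j, 0 ≤ p i j) (hp : ∀ i j, p i j = p j i) {site : Side → V} {c ρ : Side → ℝ}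
    (hc : ∀ s, 0 ≤ c s) (hρ : ∀ s, 0 ≤ ρ s) (hθρ : ∀ s, 0 ≤ 1 + θ * ρ s)
    {μ : Measure (V → ℕ)} (hμ : IsStationary θ p site c ρ μ)
    (hμ_unique : ∀ ν : Measure (V → ℕ), IsStationary θ p site c ρ ν → ν = μ) :
    ∃ v, IsAbsorptionTime p site c v := by
  set k : V → ℝ := fun x => ∑ s, if site s = x then c s else 0
  have hk0 : ∀ x, 0 ≤ k x := fun x => Finset.sum_nonneg fun s _ => by
    split_ifs
    exacts [hc s, le_rfl]
  let L : (V → ℝ) →ₗ[ℝ] (V → ℝ) :=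
    { toFun := fun v x => ∑ y, p x y * (v x - v y) + k x * v x
      map_add' := fun v w => by
        funext x
        simp only [Pi.add_apply]
        have : ∀ y, p x y * (v x + w x - (v y + w y)) =
          p x y * (v x - v y) + p x y * (w x - w y) := fun y => by ring
        simp only [this, Finset.sum_add_distrib]
        ring
      map_smul' := fun a v => by
        funext x
        simp only [Pi.smul_apply, smul_eq_mul, RingHom.id_apply, mul_add, Finset.mul_sum]
        congr 1
        · exact Finset.sum_congr rfl fun y _ => by ring
        · ring }
  have hinj : Function.Injective L := by
    rw [injective_iff_map_eq_zero]
    intro v hv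
    have hv' : ∀ x, ∑ y, p x y * (v x - v y) + k x * v x = 0 := fun x => congrFun hv x
    -- The Dirichlet form: pair `L v = 0` with `v` and symmetrise.
    have hE : ∑ x, ∑ y, p x y * (v x - v y) ^ 2 + 2 * ∑ x, k x * v x ^ 2 = 0 := by
      have h1 : ∑ x, v x * (∑ y, p x y * (v x - v y) + k x * v x) = 0 :=
        Finset.sum_eq_zero fun x _ => by rw [hv', mul_zero]
      simp only [mul_add, Finset.sum_add_distrib, Finset.mul_sum] at h1
      have h2 : ∑ x, ∑ y, v x * (p x y * (v x - v y)) =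
          ∑ x, ∑ y, -(v y * (p x y * (v x - v y))) := by
        conv_lhs => rw [Finset.sum_comm]
        refine Finset.sum_congr rfl fun x _ => Finset.sum_congr rfl fun y _ => ?_
        rw [hp y x]; ring
      have h3 : ∑ x, ∑ y, p x y * (v x - v y) ^ 2 =
          ∑ x, ∑ y, v x * (p x y * (v x - v y)) + ∑ x, ∑ y, -(v y * (p x y * (v x - v y))) := by
        simp only [← Finset.sum_add_distrib]
        exact Finset.sum_congr rfl fun x _ => Finset.sum_congr rfl fun y _ => by ring
      have h4 : ∑ x, k x * v x ^ 2 = ∑ x, v x * (k x * v x) :=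
        Finset.sum_congr rfl fun x _ => by ring
      rw [h3, h4, ← h2]; linarith
    have hA0 : ∀ x y, 0 ≤ p x y * (v x - v y) ^ 2 := fun x y => mul_nonneg (hp0 x y) (sq_nonneg _)
    have hB0 : ∀ x, 0 ≤ k x * v x ^ 2 := fun x => mul_nonneg (hk0 x) (sq_nonneg _)
    have hAs : 0 ≤ ∑ x, ∑ y, p x y * (v x - v y) ^ 2 :=
      Finset.sum_nonneg fun x _ => Finset.sum_nonneg fun y _ => hA0 x y
    have hBs : 0 ≤ ∑ x, k x * v x ^ 2 := Finset.sum_nonneg fun x _ => hB0 x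
    have hA : ∀ x y, p x y * (v x - v y) ^ 2 = 0 := fun x y =>
      (Finset.sum_eq_zero_iff_of_nonneg fun y _ => hA0 x y).1
        ((Finset.sum_eq_zero_iff_of_nonneg fun x _ => Finset.sum_nonneg fun y _ => hA0 x y).1
          (by linarith) x (Finset.mem_univ x)) y (Finset.mem_univ y)
    have hB : ∀ x, k x * v x ^ 2 = 0 := fun x =>
      (Finset.sum_eq_zero_iff_of_nonneg fun x _ => hB0 x).1 (by linarith) x (Finset.mem_univ x)
    -- The support of a kernel element is isolated: `hA` excludes edges to its complement, and `hB`
    -- excludes active reservoirs acting on it.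
    have hempty := isolated_eq_empty hθ hp0 hp hc hρ hθρ hμ hμ_unique
      (C := Finset.univ.filter fun x => v x ≠ 0) (fun i hi j hj => ?_) (fun s hs => ?_)
    · funext x
      by_contra hx
      have : x ∈ Finset.univ.filter fun x => v x ≠ 0 := by simpa using hx
      rw [hempty] at this
      simp at this
    · simp only [Finset.mem_filter, Finset.mem_univ, true_and, not_not] at hi hj
      have := hA i j
      rw [hj, sub_zero] at this
      simpa [hi] using this
    · simp only [Finset.mem_filter, Finset.mem_univ, true_and] at hs
      have h1 : k (site s) = 0 := by simpa [hs] using hB (site s)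
      have h2 := (Finset.sum_eq_zero_iff_of_nonneg fun s' _ => by
        split_ifs
        exacts [hc s', le_rfl]).1 h1 s (Finset.mem_univ s)
      simpa using h2
  obtain ⟨v, hv⟩ := (LinearMap.injective_iff_surjective.1 hinj) fun _ => 1
  have hv' : ∀ x, ∑ y, p x y * (v x - v y) + k x * v x = 1 := fun x => congrFun hv x
  refine ⟨v, fun x => ?_, hv'⟩
  have : Nonempty V := ⟨x⟩
  obtain ⟨x₀, hx₀⟩ := Finite.exists_min v
  refine lt_of_lt_of_le ?_ (hx₀ x)
  -- Minimum principle: at a nonpositive minimum the left side of the equation would be at most `0`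
  -- instead of `1`.
  by_contra hneg
  have h1 := hv' x₀
  have h2 : ∑ y, p x₀ y * (v x₀ - v y) ≤ 0 := Finset.sum_nonpos fun y _ =>
    mul_nonpos_of_nonneg_of_nonpos (hp0 _ _) (sub_nonpos.2 (hx₀ y))
  have h3 : k x₀ * v x₀ ≤ 0 := mul_nonpos_of_nonneg_of_nonpos (hk0 _) (not_lt.1 hneg)
  linarith

end Stationary

/-! ### Polynomially bounded functions -/

/-- `f` is bounded by a constant times a power of `x`. -/
def PolyBounded {α : Type*} (x f : α → ℝ) : Prop :=
  ∃ (B : ℝ) (m : ℕ), 0 ≤ B ∧ ∀ a, |f a| ≤ B * x a ^ m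

namespace PolyBounded

variable {α : Type*} {x f g : α → ℝ}

theorem const (x : α → ℝ) (b : ℝ) : PolyBounded x fun _ => b :=
  ⟨|b|, 0, abs_nonneg b, fun a => by simp⟩

theorem mul (hx : ∀ a, 1 ≤ x a) (hf : PolyBounded x f) (hg : PolyBounded x g) :
    PolyBounded x fun a => f a * g a := by
  obtain ⟨B, m, hB, h⟩ := hf
  obtain ⟨B', m', hB', h'⟩ := hg
  refine ⟨B * B', m + m', mul_nonneg hB hB', fun a => ?_⟩
  have hx0 : 0 ≤ x a := zero_le_one.trans (hx a)
  calc |f a * g a| = |f a| * |g a| := abs_mul _ _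
    _ ≤ (B * x a ^ m) * (B' * x a ^ m') :=
      mul_le_mul (h a) (h' a) (abs_nonneg _) (by positivity)
    _ = B * B' * x a ^ (m + m') := by ring

theorem sub (hx : ∀ a, 1 ≤ x a) (hf : PolyBounded x f) (hg : PolyBounded x g) :
    PolyBounded x fun a => f a - g a := by
  obtain ⟨B, m, hB, h⟩ := hf
  obtain ⟨B', m', hB', h'⟩ := hg
  refine ⟨B + B', m + m', add_nonneg hB hB', fun a => ?_⟩
  have h1 : x a ^ m ≤ x a ^ (m + m') := pow_le_pow_right₀ (hx a) (Nat.le_add_right _ _)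
  have h2 : x a ^ m' ≤ x a ^ (m + m') := pow_le_pow_right₀ (hx a) (Nat.le_add_left _ _)
  calc |f a - g a| ≤ |f a| + |g a| := abs_sub _ _
    _ ≤ B * x a ^ (m + m') + B' * x a ^ (m + m') :=
      add_le_add ((h a).trans (mul_le_mul_of_nonneg_left h1 hB))
        ((h' a).trans (mul_le_mul_of_nonneg_left h2 hB'))
    _ = (B + B') * x a ^ (m + m') := by ring

theorem abs (hf : PolyBounded x f) : PolyBounded x fun a => |f a| := by
  obtain ⟨B, m, hB, h⟩ := hf
  exact ⟨B, m, hB, fun a => by rw [abs_abs]; exact h a⟩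

theorem add (hx : ∀ a, 1 ≤ x a) (hf : PolyBounded x f) (hg : PolyBounded x g) :
    PolyBounded x fun a => f a + g a := by
  simpa using hf.sub hx ((const x 0).sub hx hg)

theorem prod (hx : ∀ a, 1 ≤ x a) {ι : Type*} (s : Finset ι) {f : ι → α → ℝ}
    (h : ∀ i ∈ s, PolyBounded x (f i)) : PolyBounded x fun a => ∏ i ∈ s, f i a := by
  classical
  induction s using Finset.induction_on with
  | empty => simpa using const x 1
  | insert i s hi ih =>
    simp only [Finset.prod_insert hi]
    exact (h i (Finset.mem_insert_self _ _)).mul hx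
      (ih fun j hj => h j (Finset.mem_insert_of_mem hj))

theorem sum (hx : ∀ a, 1 ≤ x a) {ι : Type*} (s : Finset ι) {f : ι → α → ℝ}
    (h : ∀ i ∈ s, PolyBounded x (f i)) : PolyBounded x fun a => ∑ i ∈ s, f i a := by
  classical
  induction s using Finset.induction_on with
  | empty => simpa using const x 0
  | insert i s hi ih =>
    simp only [Finset.sum_insert hi]
    exact (h i (Finset.mem_insert_self _ _)).add hx
      (ih fun j hj => h j (Finset.mem_insert_of_mem hj))

theorem binomialShift (hx : ∀ a, 1 ≤ x a) (r : ℝ) {f : ℕ → α → ℝ}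
    (h : ∀ m, PolyBounded x (f m)) (k : ℕ) :
    PolyBounded x fun a => binomialShift r (fun m => f m a) k := by
  induction k generalizing f with
  | zero => exact h 0
  | succ k ih => exact (ih fun m => h (m + 1)).sub hx ((const x r).mul hx (ih h))

end PolyBounded

/-! ### Polynomial growth of the duality functions, and Lyapunov functions -/

section Moments

variable {V : Type*} [Fintype V] [DecidableEq V]

/-- One plus the number of particles. -/
def sizeSucc (η : V → ℕ) : ℝ := 1 + ∑ i, (η i : ℝ)

theorem one_le_sizeSucc {V : Type*} [Fintype V] (η : V → ℕ) : 1 ≤ sizeSucc η := by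
  have : 0 ≤ ∑ i, (η i : ℝ) := Finset.sum_nonneg fun i _ => Nat.cast_nonneg _
  rw [sizeSucc]; linarith

theorem polyBounded_apply {V : Type*} [Fintype V] (i : V) :
    PolyBounded sizeSucc fun η : V → ℕ => (η i : ℝ) := by
  refine ⟨1, 1, zero_le_one, fun η => ?_⟩
  rw [abs_of_nonneg (Nat.cast_nonneg _), one_mul, pow_one, sizeSucc]
  have := Finset.single_le_sum (fun i _ => Nat.cast_nonneg (α := ℝ) (η i)) (Finset.mem_univ i)
  linarith

theorem polyBounded_siteDual {V : Type*} [Fintype V] (θ r : ℝ) (k : ℕ) (i : V) :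
    PolyBounded sizeSucc fun η : V → ℕ => siteDual θ r k (η i) := by
  refine PolyBounded.binomialShift one_le_sizeSucc r
    (f := fun m η => factorialDual θ m (η i)) (fun m => ?_) k
  simp only [factorialDual, div_eq_mul_inv]
  refine PolyBounded.mul one_le_sizeSucc ?_ (PolyBounded.const _ _)
  refine ⟨1, m, zero_le_one, fun η => ?_⟩
  rw [abs_of_nonneg (Nat.cast_nonneg _), one_mul]
  have h1 : ((η i).descFactorial m : ℝ) ≤ (η i : ℝ) ^ m := by
    exact_mod_cast Nat.descFactorial_le_pow _ _
  refine h1.trans (pow_le_pow_left₀ (Nat.cast_nonneg _) ?_ m)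
  have := Finset.single_le_sum (fun i _ => Nat.cast_nonneg (α := ℝ) (η i)) (Finset.mem_univ i)
  rw [sizeSucc]; linarith

theorem polyBounded_configDual {V : Type*} [Fintype V] (θ r : ℝ) (ρ : Side → ℝ)
    (ξ : V ⊕ Side → ℕ) : PolyBounded sizeSucc (configDual θ r ρ ξ) :=
  (PolyBounded.prod one_le_sizeSucc _ fun i _ => polyBounded_siteDual θ r _ i).mul
    one_le_sizeSucc (PolyBounded.const _ _)

/-- A Lyapunov function of polynomial growth `m`. -/
noncomputable def lyapunov (m : ℕ) (η : V → ℕ) : ℝ := ((1 + ∑ i, η i).ascFactorial m : ℝ)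

theorem sizeSucc_pow_le_lyapunov {V : Type*} [Fintype V] (m : ℕ) (η : V → ℕ) :
    sizeSucc η ^ m ≤ lyapunov m η := by
  have := Nat.pow_succ_le_ascFactorial (1 + ∑ i, η i) m
  rw [sizeSucc, lyapunov]
  exact_mod_cast this

theorem lyapunov_le {V : Type*} [Fintype V] (m : ℕ) (η : V → ℕ) :
    lyapunov m η ≤ m.factorial * sizeSucc η ^ m := by
  have := Nat.ascFactorial_le_factorial_mul_pow (1 + ∑ i, η i) m
  rw [sizeSucc, lyapunov]
  exact_mod_cast this

/-- Bulk jumps conserve the number of particles and removals decrease it, so only injections matter.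
With `s = 1 + |η|`, the rising factorial `W(s) = s (s + 1) ⋯ (s + m - 1)` satisfies `s * (W(s + 1) -
W(s)) = m * W(s)` exactly, and the injection rates grow at most linearly in `s`. -/
theorem exists_generator_lyapunov_le (θ : ℝ) (p : V → V → ℝ) (site : Side → V) {c ρ : Side → ℝ}
    (hc : ∀ s, 0 ≤ c s) (hρ : ∀ s, 0 ≤ ρ s) (hθρ : ∀ s, 0 ≤ 1 + θ * ρ s) (m : ℕ) :
    ∃ K : ℝ, ∀ η,
      (reservoirSystem θ p site c ρ).generator (lyapunov m) η ≤ K * lyapunov m η := by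
  refine ⟨∑ s, c s * (ρ s * ((1 + |θ|) * m)), fun η => ?_⟩
  rw [reservoirSystem_generator]
  have h1 : ∑ i, ∑ j, p i j * η i * (1 + θ * η j) *
      (lyapunov m (η - delta i + delta j) - lyapunov m η) = 0 := by
    refine Finset.sum_eq_zero fun i _ => Finset.sum_eq_zero fun j _ => ?_
    rcases eq_or_ne (η i) 0 with h | h
    · simp [h]
    · rw [lyapunov, lyapunov, sum_sub_delta_add_delta h, sub_self, mul_zero]
  rw [h1, zero_add, Finset.sum_mul]
  refine Finset.sum_le_sum fun s _ => ?_
  rw [mul_assoc (c s)]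
  refine mul_le_mul_of_nonneg_left ?_ (hc s)
  have h2 : lyapunov m (η - delta (site s)) ≤ lyapunov m η := by
    rw [lyapunov, lyapunov]
    have : ∑ i, (η - delta (site s)) i ≤ ∑ i, η i :=
      Finset.sum_le_sum fun i _ => by simp
    exact_mod_cast Nat.ascFactorial_le m (Nat.add_le_add_left this 1)
  have h3 : (1 + θ * ρ s) * η (site s) *
      (lyapunov m (η - delta (site s)) - lyapunov m η) ≤ 0 :=
    mul_nonpos_of_nonneg_of_nonpos (mul_nonneg (hθρ s) (Nat.cast_nonneg _)) (sub_nonpos.2 h2)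
  have h4 : sizeSucc η * (lyapunov m (η + delta (site s)) - lyapunov m η) = m * lyapunov m η := by
    have hs : ∑ i, (η + delta (site s)) i = ∑ i, η i + 1 := by
      simp [Finset.sum_add_distrib, delta_apply]
    have := Nat.succ_ascFactorial (1 + ∑ i, η i) m
    rw [lyapunov, lyapunov, hs, sizeSucc]
    have h : ((1 : ℝ) + ∑ i, (η i : ℝ)) * ((1 + (∑ i, η i + 1)).ascFactorial m : ℝ) =
        (1 + ∑ i, (η i : ℝ) + m) * ((1 + ∑ i, η i).ascFactorial m : ℝ) := by
      rw [← add_assoc 1]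
      exact_mod_cast this
    rw [mul_sub, h]; ring
  have h5 : 0 ≤ lyapunov m (η + delta (site s)) - lyapunov m η := by
    rw [sub_nonneg, lyapunov, lyapunov]
    have : ∑ i, η i ≤ ∑ i, (η + delta (site s)) i :=
      Finset.sum_le_sum fun i _ => by simp
    exact_mod_cast Nat.ascFactorial_le m (Nat.add_le_add_left this 1)
  have h6 : 1 + θ * η (site s) ≤ (1 + |θ|) * sizeSucc η := by
    have a1 : (η (site s) : ℝ) ≤ sizeSucc η - 1 := by
      have := Finset.single_le_sum (fun i _ => Nat.cast_nonneg (α := ℝ) (η i))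
        (Finset.mem_univ (site s))
      rw [sizeSucc]; linarith
    have a2 : θ * η (site s) ≤ |θ| * η (site s) :=
      mul_le_mul_of_nonneg_right (le_abs_self θ) (Nat.cast_nonneg _)
    have a3 := mul_le_mul_of_nonneg_left a1 (abs_nonneg θ)
    nlinarith [one_le_sizeSucc η, abs_nonneg θ]
  have h7 := mul_le_mul_of_nonneg_right h6 h5
  rw [mul_assoc, h4] at h7
  have h8 := mul_le_mul_of_nonneg_left h7 (hρ s)
  nlinarith

/-! ### The dual semigroup solves the backward equation -/

/-- `∑_{ξ'} P_ξ(ξ(t) = ξ') D(ξ', η)`. -/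
noncomputable def dualFlow (θ : ℝ) (p : V → V → ℝ) (site : Side → V) (c ρ : Side → ℝ) (r : ℝ)
    (n : ℕ) (ξ : V ⊕ Side → ℕ) (t : ℝ) (η : V → ℕ) : ℝ :=
  (dualSystem θ p site c).finExpect (dualFinset V θ n) t (fun ξ' => configDual θ r ρ ξ' η) ξ

/-- The forward equation puts the dual generator on the duality function. Duality turns it into the
generator acting on `η`, which passes through the finite sum over dual configurations. -/
theorem hasDerivWithinAt_dualFlow {θ : ℝ} (hθ : AdmissibleTheta θ) {p : V → V → ℝ}
    (hp0 : ∀ i j, 0 ≤ p i j) (hp : ∀ i j, p i j = p j i) (site : Side → V) {c : Side → ℝ}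
    (hc : ∀ s, 0 ≤ c s) (ρ : Side → ℝ) (r : ℝ) {n : ℕ}
    {ξ : V ⊕ Side → ℕ} (hξ : ξ ∈ dualFinset V θ n) {η : V → ℕ} (hη : η ∈ stateSpace V θ)
    {t : ℝ} (ht : 0 ≤ t) :
    HasDerivWithinAt (fun s => dualFlow θ p site c ρ r n ξ s η)
      ((reservoirSystem θ p site c ρ).generator (dualFlow θ p site c ρ r n ξ t) η)
      (Set.Ici 0) t := by
  have h := JumpSystem.finExpect_forward (dualSystem_invariant hθ hp0 site hc n)
    (fun ξ' => configDual θ r ρ ξ' η) hξ ht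
  convert h using 1
  · rfl
  rw [JumpSystem.finExpect_congr (g := fun ξ' =>
    (reservoirSystem θ p site c ρ).generator (configDual θ r ρ ξ') η) fun y hy =>
    (generator_configDual hθ hp site c ρ r (mem_dualFinset.1 hy).1 hη).symm]
  simp only [JumpSystem.generator, dualFlow, JumpSystem.finExpect, Finset.sum_mul]
  rw [Finset.sum_comm]
  refine Finset.sum_congr rfl fun m _ => ?_
  rw [← Finset.sum_sub_distrib, Finset.mul_sum]
  exact Finset.sum_congr rfl fun y _ => by ring

theorem dualFlow_zero {θ : ℝ} (p : V → V → ℝ) (site : Side → V) (c ρ : Side → ℝ) (r : ℝ) {n : ℕ}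
    {ξ : V ⊕ Side → ℕ} (hξ : ξ ∈ dualFinset V θ n) (η : V → ℕ) :
    dualFlow θ p site c ρ r n ξ 0 η = configDual θ r ρ ξ η :=
  JumpSystem.finExpect_zero _ _ hξ

/-- The bound is uniform in time because the dual process lives on a finite set: the sum of all the
absolute values of the duality functions dominates any average of them. -/
theorem abs_dualFlow_le {θ : ℝ} (hθ : AdmissibleTheta θ) {p : V → V → ℝ}
    (hp0 : ∀ i j, 0 ≤ p i j) (site : Side → V) {c : Side → ℝ}
    (hc : ∀ s, 0 ≤ c s) (ρ : Side → ℝ) (r : ℝ) {n : ℕ}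
    {ξ : V ⊕ Side → ℕ} (hξ : ξ ∈ dualFinset V θ n) :
    ∃ (B : ℝ) (m : ℕ), 0 ≤ B ∧ ∀ t, 0 ≤ t → ∀ η : V → ℕ,
      |dualFlow θ p site c ρ r n ξ t η| ≤ B * sizeSucc η ^ m := by
  obtain ⟨B, m, hB, h⟩ := PolyBounded.sum one_le_sizeSucc (dualFinset V θ n)
    fun y _ => (polyBounded_configDual θ r ρ y).abs
  refine ⟨B, m, hB, fun t ht η => ?_⟩
  refine JumpSystem.abs_finExpect_le (dualSystem_invariant hθ hp0 site hc n) (fun y hy => ?_) hξ ht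
  refine le_trans ?_ ((le_abs_self _).trans (h η))
  exact Finset.single_le_sum (f := fun y => |configDual θ r ρ y η|)
    (fun _ _ => abs_nonneg _) hy

/-! ### Moments of the stationary measure -/

theorem configDual_zero_nonneg {V : Type*} [Fintype V] {θ : ℝ} (hθ : AdmissibleTheta θ)
    {ρ : Side → ℝ} (hρ : ∀ s, 0 ≤ ρ s) {ξ : V ⊕ Side → ℕ} (hξ : ξ ∈ dualSpace V θ) (η : V → ℕ) :
    0 ≤ configDual θ 0 ρ ξ η := by
  refine mul_nonneg (Finset.prod_nonneg fun i _ => ?_) (Finset.prod_nonneg fun s _ => ?_)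
  · rw [siteDual, binomialShift_zero]
    exact factorialDual_nonneg hθ (hξ i) _
  · rw [sub_zero]; exact pow_nonneg (hρ s) _

theorem configDual_of_absorbed {V : Type*} [Fintype V] (θ r : ℝ) (ρ : Side → ℝ)
    {ξ : V ⊕ Side → ℕ} (hξ : ∀ x, ξ (.inl x) = 0) (η : V → ℕ) :
    configDual θ r ρ ξ η = ∏ s, (ρ s - r) ^ ξ (.inr s) := by
  simp [configDual, hξ, siteDual_zero_left]

/-- The uncentred duality function is nonnegative, so its dual flow is a supersolution that
dominates the minimal semigroup. The flow is at most `R + B η * a t`, with `R` bounding the weights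
of absorbed configurations and `a t` the probability that some particle is not yet absorbed.
Stationarity and `t → ∞` bound the integral by `R`. -/
theorem lintegral_configDual_lt_top {θ : ℝ} (hθ : AdmissibleTheta θ) {p : V → V → ℝ}
    (hp0 : ∀ i j, 0 ≤ p i j) (hp : ∀ i j, p i j = p j i) {site : Side → V} {c ρ : Side → ℝ}
    (hc : ∀ s, 0 ≤ c s) (hρ : ∀ s, 0 ≤ ρ s) (hθρ : ∀ s, 0 ≤ 1 + θ * ρ s)
    {μ : Measure (V → ℕ)} (hμ : IsStationary θ p site c ρ μ)
    {v : V → ℝ} (hv : IsAbsorptionTime p site c v) {n : ℕ} {ξ : V ⊕ Side → ℕ}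
    (hξ : ξ ∈ dualFinset V θ n) :
    ∫⁻ η, ENNReal.ofReal (configDual θ 0 ρ ξ η) ∂μ < ∞ := by
  have := hμ.1
  set Q := reservoirSystem θ p site c ρ
  have hQ : Q.Invariant (stateSpace V θ) := reservoirSystem_invariant hθ hp0 site hc hρ hθρ
  set R : ℝ := ∏ s, (1 + ρ s) ^ n
  set F := dualFinset V θ n
  have hR : 0 ≤ R := Finset.prod_nonneg fun s _ => pow_nonneg (by linarith [hρ s]) _
  set B : (V → ℕ) → ℝ := fun η => ∑ y ∈ F, configDual θ 0 ρ y η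
  have hnn : ∀ y ∈ F, ∀ η, 0 ≤ configDual θ 0 ρ y η :=
    fun y hy η => configDual_zero_nonneg hθ hρ (mem_dualFinset.1 hy).1 η
  have hpt : ∀ η, ∀ y ∈ F, configDual θ 0 ρ y η ≤ R * 1 + B η * unabsorbed y := by
    intro η y hy
    rw [unabsorbed]
    split_ifs with h
    · rw [configDual_of_absorbed θ 0 ρ h, mul_zero, add_zero, mul_one]
      refine Finset.prod_le_prod (fun s _ => by rw [sub_zero]; exact pow_nonneg (hρ s) _)
        fun s _ => ?_
      have hle : y (.inr s) ≤ n := by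
        rw [← (mem_dualFinset.1 hy).2]
        exact Finset.single_le_sum (fun _ _ => Nat.zero_le _) (Finset.mem_univ _)
      rw [sub_zero]
      exact (pow_le_pow_left₀ (hρ s) (by linarith) _).trans
        (pow_le_pow_right₀ (by linarith [hρ s]) hle)
    · have : configDual θ 0 ρ y η ≤ B η :=
        Finset.single_le_sum (f := fun y => configDual θ 0 ρ y η) (fun z hz => hnn z hz η) hy
      linarith
  set a : ℝ → ℝ := fun t => (dualSystem θ p site c).finExpect F t unabsorbed ξ
  have ha : Tendsto a atTop (𝓝 0) := tendsto_unabsorbed hθ hp0 hp hc hv hξ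
  have hflow : ∀ t, 0 ≤ t → ∀ η, dualFlow θ p site c ρ 0 n ξ t η ≤ R + B η * a t := by
    intro t ht η
    have h1 := JumpSystem.finExpect_mono (Q := dualSystem θ p site c) (hpt η) t ξ
    rw [JumpSystem.finExpect_add _ _ (fun _ => R * 1), JumpSystem.finExpect_const_mul,
      JumpSystem.finExpect_const_mul,
      JumpSystem.finExpect_one (dualSystem_invariant hθ hp0 site hc n) hξ ht, mul_one] at h1
    exact h1
  have hsuper : Q.IsSupersolution (stateSpace V θ) (dualFlow θ p site c ρ 0 n ξ) :=
    ⟨fun η _ t _ => JumpSystem.finExpect_nonneg (fun y hy => hnn y hy η) t ξ,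
      fun η hη t ht => ⟨_, hasDerivWithinAt_dualFlow hθ hp0 hp site hc ρ 0 hξ hη ht, le_rfl⟩⟩
  set f : (V → ℕ) → ℝ≥0∞ := fun η => ENNReal.ofReal (configDual θ 0 ρ ξ η)
  -- No integrability of `B` is known yet. Truncation at `M` makes dominated convergence available,
  -- and `M → ∞` is taken afterwards by monotone convergence.
  have htrunc : ∀ M : ℕ, ∫⁻ η, min (f η) M ∂μ ≤ ENNReal.ofReal R := by
    intro M
    have h1 : ∀ t, 0 ≤ t → ∫⁻ η, min (f η) M ∂μ ≤
        ∫⁻ η, min (ENNReal.ofReal (R + B η * a t)) M ∂μ := by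
      intro t ht
      rw [← hμ.lintegral_expect ht]
      refine lintegral_mono_ae ?_
      filter_upwards [hμ.ae_mem] with η hη
      refine le_min ?_ ?_
      · refine (Q.expect_mono (fun y => min_le_left _ _) t η).trans ?_
        refine (JumpSystem.expect_le_of_isSupersolution hQ hsuper (fun y _ => ?_) hη ht).trans
          (ENNReal.ofReal_le_ofReal (hflow t ht η))
        rw [dualFlow_zero p site c ρ 0 hξ]
      · refine (Q.expect_mono (g := fun _ => (M : ℝ≥0∞) * 1)
          (fun y => (min_le_right _ _).trans_eq (mul_one _).symm) t η).trans ?_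
        rw [JumpSystem.expect_const_mul]
        exact mul_le_of_le_one_right zero_le (Q.expect_le_one (fun _ => le_rfl) ht η)
    have h2 : Tendsto (fun t => ∫⁻ η, min (ENNReal.ofReal (R + B η * a t)) M ∂μ) atTop
        (𝓝 (∫⁻ _, min (ENNReal.ofReal R) M ∂μ)) := by
      refine tendsto_lintegral_filter_of_dominated_convergence (fun _ => (M : ℝ≥0∞))
        (Eventually.of_forall fun t => Measurable.of_discrete)
        (Eventually.of_forall fun t => Eventually.of_forall fun η => min_le_right _ _)
        (by simp) (Eventually.of_forall fun η => ?_)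
      refine Tendsto.min ?_ tendsto_const_nhds
      refine ENNReal.tendsto_ofReal ?_
      simpa using (ha.const_mul (B η)).const_add R
    have h3 := ge_of_tendsto h2 ((eventually_ge_atTop 0).mono h1)
    refine h3.trans ?_
    rw [lintegral_const, measure_univ, mul_one]
    exact min_le_left _ _
  have hsup : ∫⁻ η, f η ∂μ = ⨆ M : ℕ, ∫⁻ η, min (f η) M ∂μ := by
    rw [← lintegral_iSup (fun _ => Measurable.of_discrete)]
    · refine lintegral_congr fun η => ?_
      change f η = ⨆ M : ℕ, f η ⊓ (M : ℝ≥0∞)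
      rw [← inf_iSup_eq, ENNReal.iSup_natCast, inf_top_eq]
    · intro M M' h η
      exact min_le_min_left _ (by exact_mod_cast h)
  rw [hsup]
  exact (iSup_le htrunc).trans_lt ENNReal.ofReal_lt_top

/-- If `n ≥ 2 * k`, every factor of the falling factorial is at least `n + 1 - k`, hence at least `n
/ 2`. -/
theorem pow_le_descFactorial (n k : ℕ) :
    n ^ k ≤ (2 * k) ^ k + 2 ^ k * n.descFactorial k := by
  rcases le_total n (2 * k) with h | h
  · exact (Nat.pow_le_pow_left h k).trans (Nat.le_add_right _ _)
  · calc n ^ k ≤ (2 * (n + 1 - k)) ^ k := Nat.pow_le_pow_left (by omega) k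
      _ = 2 ^ k * (n + 1 - k) ^ k := mul_pow _ _ _
      _ ≤ 2 ^ k * n.descFactorial k := Nat.mul_le_mul_left _ (Nat.pow_sub_le_descFactorial n k)
      _ ≤ _ := Nat.le_add_left _ _

theorem integrable_pow_apply {θ : ℝ} (hθ : AdmissibleTheta θ) {p : V → V → ℝ}
    (hp0 : ∀ i j, 0 ≤ p i j) (hp : ∀ i j, p i j = p j i) {site : Side → V} {c ρ : Side → ℝ}
    (hc : ∀ s, 0 ≤ c s) (hρ : ∀ s, 0 ≤ ρ s) (hθρ : ∀ s, 0 ≤ 1 + θ * ρ s)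
    {μ : Measure (V → ℕ)} (hμ : IsStationary θ p site c ρ μ)
    {v : V → ℝ} (hv : IsAbsorptionTime p site c v) (m : ℕ) (x : V) :
    Integrable (fun η : V → ℕ => (η x : ℝ) ^ m) μ := by
  have := hμ.1
  -- For `θ ≥ 0` any number `m` of dual particles may sit at `x`, and the duality function is then
  -- the falling factorial of order `m` up to a constant. For `θ < 0` occupation numbers are
  -- bounded.
  by_cases h0 : 0 ≤ θ
  · have hocc : ∀ k, k ∈ occupation θ := fun k => Or.inl h0
    set ξ : V ⊕ Side → ℕ := fun w => m * delta (.inl x) w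
    have hξ : ξ ∈ dualFinset V θ m :=
      mem_dualFinset.2 ⟨fun i => hocc _, by simp [ξ, delta_apply]⟩
    have hD : ∀ η, configDual θ 0 ρ ξ η = factorialDual θ m (η x) := by
      intro η
      rw [configDual, Finset.prod_eq_single x]
      · simp [ξ, delta_apply, siteDual, binomialShift_zero]
      · intro y _ hy
        simp [ξ, delta_apply, hy, siteDual_zero_left]
      · simp
    have hint : Integrable (fun η => factorialDual θ m (η x)) μ := by
      refine ⟨Measurable.of_discrete.aestronglyMeasurable, ?_⟩
      rw [hasFiniteIntegral_iff_ofReal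
        (Eventually.of_forall fun η : V → ℕ => factorialDual_nonneg hθ (hocc m) (η x))]
      simp only [← hD]
      exact lintegral_configDual_lt_top hθ hp0 hp hc hρ hθρ hμ hv hξ
    set w := ∏ j ∈ Finset.range m, (1 + θ * (j : ℝ))
    have hw : w ≠ 0 := (weight_pos hθ (hocc m)).ne'
    refine ((integrable_const (((2 * m : ℕ) : ℝ) ^ m)).add (hint.const_mul (2 ^ m * w))).mono'
      Measurable.of_discrete.aestronglyMeasurable (Eventually.of_forall fun η => ?_)
    rw [Real.norm_of_nonneg (by positivity)]
    have h1 : ((η x : ℝ)) ^ m ≤ ((2 * m : ℕ) : ℝ) ^ m + 2 ^ m * (η x).descFactorial m := by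
      exact_mod_cast pow_le_descFactorial (η x) m
    refine h1.trans_eq ?_
    simp only [Pi.add_apply, factorialDual]
    rw [mul_assoc (2 ^ m : ℝ), mul_div_cancel₀ _ hw]
  · refine (integrable_const ((1 / |θ|) ^ m)).mono'
      Measurable.of_discrete.aestronglyMeasurable ?_
    filter_upwards [hμ.ae_mem] with η hη
    rw [Real.norm_of_nonneg (by positivity)]
    exact pow_le_pow_left₀ (Nat.cast_nonneg _) ((hη x).resolve_left h0) m

theorem integrable_sizeSucc_pow {θ : ℝ} (hθ : AdmissibleTheta θ) {p : V → V → ℝ}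
    (hp0 : ∀ i j, 0 ≤ p i j) (hp : ∀ i j, p i j = p j i) {site : Side → V} {c ρ : Side → ℝ}
    (hc : ∀ s, 0 ≤ c s) (hρ : ∀ s, 0 ≤ ρ s) (hθρ : ∀ s, 0 ≤ 1 + θ * ρ s)
    {μ : Measure (V → ℕ)} (hμ : IsStationary θ p site c ρ μ)
    {v : V → ℝ} (hv : IsAbsorptionTime p site c v) (m : ℕ) :
    Integrable (fun η : V → ℕ => sizeSucc η ^ m) μ := by
  have := hμ.1
  have hint := integrable_pow_apply hθ hp0 hp hc hρ hθρ hμ hv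
  rcases m with _ | m
  · simp
  · refine ((integrable_const (1 : ℝ)).add ((integrable_finsetSum Finset.univ fun x _ =>
      hint (m + 1) x).const_mul ((Fintype.card V : ℝ) ^ m))).const_mul (2 ^ m) |>.mono'
      Measurable.of_discrete.aestronglyMeasurable (Eventually.of_forall fun η => ?_)
    have h0 : 0 ≤ ∑ i, (η i : ℝ) := Finset.sum_nonneg fun i _ => Nat.cast_nonneg _
    rw [Real.norm_of_nonneg (pow_nonneg (zero_le_one.trans (one_le_sizeSucc η)) _), sizeSucc]
    refine (add_pow_le zero_le_one h0 (m + 1)).trans ?_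
    simp only [one_pow, Nat.add_sub_cancel, Pi.add_apply]
    gcongr
    exact pow_sum_le_card_mul_sum_pow (fun i _ => Nat.cast_nonneg (η i)) m

end Moments

section SteadyState

variable {V : Type*} [Fintype V] [DecidableEq V]

/-! ### Stationarity tested on solutions of polynomial growth -/

/-- The comparison principle needs nonnegative functions, so `u` is replaced by `C + ε * exp (K s) *
W + u`, with `W` a Lyapunov function of growth one degree higher. In the integrated inequality `C`
cancels, and the remaining error is proportional to `ε`. -/
theorem integral_le_of_solution {θ : ℝ} (hθ : AdmissibleTheta θ) {p : V → V → ℝ}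
    (hp0 : ∀ i j, 0 ≤ p i j) {site : Side → V} {c ρ : Side → ℝ}
    (hc : ∀ s, 0 ≤ c s) (hρ : ∀ s, 0 ≤ ρ s) (hθρ : ∀ s, 0 ≤ 1 + θ * ρ s)
    {μ : Measure (V → ℕ)} (hμ : IsStationary θ p site c ρ μ)
    (hmom : ∀ m : ℕ, Integrable (fun η : V → ℕ => sizeSucc η ^ m) μ)
    {u : ℝ → (V → ℕ) → ℝ} (hu : ∀ η ∈ stateSpace V θ, ∀ t, 0 ≤ t →
      HasDerivWithinAt (fun s => u s η) ((reservoirSystem θ p site c ρ).generator (u t) η)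
        (Set.Ici 0) t)
    {B : ℝ} {m : ℕ} (hB : 0 ≤ B) (hbound : ∀ t, 0 ≤ t → ∀ η, |u t η| ≤ B * sizeSucc η ^ m)
    {t : ℝ} (ht : 0 ≤ t) : ∫ η, u 0 η ∂μ ≤ ∫ η, u t η ∂μ := by
  have := hμ.1
  set Q := reservoirSystem θ p site c ρ
  have hQ : Q.Invariant (stateSpace V θ) := reservoirSystem_invariant hθ hp0 site hc hρ hθρ
  obtain ⟨K₀, hK₀⟩ := exists_generator_lyapunov_le θ p site hc hρ hθρ (m + 1)
  -- With `K ≥ 0` the factor `exp (K s)` is at least `1`, so the lower bound at time `0` persists.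
  set K := |K₀|
  set W : (V → ℕ) → ℝ := lyapunov (m + 1)
  have hW0 : ∀ η, 0 ≤ W η := fun η => Nat.cast_nonneg _
  have hWi : Integrable W μ := ((hmom (m + 1)).const_mul ((m + 1).factorial : ℝ)).mono'
    Measurable.of_discrete.aestronglyMeasurable (Eventually.of_forall fun η => by
      rw [Real.norm_of_nonneg (hW0 η)]; exact lyapunov_le (m + 1) η)
  have hui : ∀ s, 0 ≤ s → Integrable (u s) μ := fun s hs => ((hmom m).const_mul B).mono'
    Measurable.of_discrete.aestronglyMeasurable (Eventually.of_forall (hbound s hs))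
  have key : ∀ ε : ℝ, 0 < ε → ∫ η, u 0 η ∂μ ≤
      ∫ η, u t η ∂μ + ε * ((Real.exp (K * t) - 1) * ∫ η, W η ∂μ) := by
    intro ε hε
    -- Below the threshold `B / ε` the constant `C` dominates `B * x ^ m`. Above it `B ≤ ε * x`, so
    -- `ε * x ^ (m + 1)` dominates.
    set C : ℝ := B * (B / ε) ^ m
    have hC : ∀ η, B * sizeSucc η ^ m ≤ C + ε * W η := by
      intro η
      have hx : 0 ≤ sizeSucc η := zero_le_one.trans (one_le_sizeSucc η)
      have hCn : 0 ≤ C := by positivity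
      rcases le_total (sizeSucc η) (B / ε) with h | h
      · have := mul_le_mul_of_nonneg_left (pow_le_pow_left₀ hx h m) hB
        have := mul_nonneg hε.le (hW0 η)
        linarith
      · have h1 : B ≤ ε * sizeSucc η := by rwa [div_le_iff₀' hε] at h
        have h2 := mul_le_mul_of_nonneg_right h1 (pow_nonneg hx m)
        have h3 := mul_le_mul_of_nonneg_left (sizeSucc_pow_le_lyapunov (m + 1) η) hε.le
        rw [pow_succ] at h3
        linarith
    set w : ℝ → (V → ℕ) → ℝ := fun s η => C + ε * (Real.exp (K * s) * W η) + u s η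
    have hw0 : ∀ s, 0 ≤ s → ∀ η, 0 ≤ w s η := by
      intro s hs η
      have h1 : W η ≤ Real.exp (K * s) * W η :=
        le_mul_of_one_le_left (hW0 η) (Real.one_le_exp (mul_nonneg (abs_nonneg _) hs))
      have h2 := mul_le_mul_of_nonneg_left h1 hε.le
      have h3 := (abs_le.1 (hbound s hs η)).1
      have h4 := hC η
      simp only [w]; linarith
    have hsuper : Q.IsSupersolution (stateSpace V θ) w := by
      refine ⟨fun η _ s hs => hw0 s hs η, fun η hη s hs =>
        ⟨_, ((((((hasDerivAt_id s).const_mul K).exp.mul_const (W η)).const_mul ε).const_add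
          C).hasDerivWithinAt).add (hu η hη s hs), ?_⟩⟩
      have h1 : Q.generator (w s) η =
          ε * (Real.exp (K * s) * Q.generator W η) + Q.generator (u s) η := by
        simp only [JumpSystem.generator, w, Finset.mul_sum, ← Finset.sum_add_distrib]
        exact Finset.sum_congr rfl fun _ _ => by ring
      have h2 : Q.generator W η ≤ K * W η :=
        (hK₀ η).trans (mul_le_mul_of_nonneg_right (le_abs_self K₀) (hW0 η))
      have h3 := mul_le_mul_of_nonneg_left
        (mul_le_mul_of_nonneg_left h2 (Real.exp_nonneg (K * s))) hε.le
      rw [h1]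
      simp only [id, mul_one]
      linarith
    have hwi : ∀ s, 0 ≤ s → Integrable (w s) μ := fun s hs =>
      ((integrable_const C).add ((hWi.const_mul _).const_mul ε)).add (hui s hs)
    have hle : ENNReal.ofReal (∫ η, w 0 η ∂μ) ≤ ENNReal.ofReal (∫ η, w t η ∂μ) := by
      rw [ofReal_integral_eq_lintegral_ofReal (hwi 0 le_rfl)
          (Eventually.of_forall (hw0 0 le_rfl)),
        ofReal_integral_eq_lintegral_ofReal (hwi t ht) (Eventually.of_forall (hw0 t ht)),
        ← hμ.lintegral_expect ht]
      refine lintegral_mono_ae ?_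
      filter_upwards [hμ.ae_mem] with η hη
      exact JumpSystem.expect_le_of_isSupersolution hQ hsuper (fun _ _ => le_rfl) hη ht
    have hle' := (ENNReal.ofReal_le_ofReal_iff (integral_nonneg (hw0 t ht))).1 hle
    have hint : ∀ s, 0 ≤ s → ∫ η, w s η ∂μ =
        C + ε * (Real.exp (K * s) * ∫ η, W η ∂μ) + ∫ η, u s η ∂μ := by
      intro s hs
      have hCW : Integrable (fun η => C + ε * (Real.exp (K * s) * W η)) μ :=
        (integrable_const C).add ((hWi.const_mul _).const_mul ε)
      simp only [w]
      rw [integral_add hCW (hui s hs), integral_add (integrable_const C)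
        ((hWi.const_mul _).const_mul ε), integral_const, integral_const_mul, integral_const_mul]
      simp
    rw [hint 0 le_rfl, hint t ht, mul_zero, Real.exp_zero, one_mul] at hle'
    linarith
  have hlim : Tendsto (fun ε : ℝ => ∫ η, u t η ∂μ + ε * ((Real.exp (K * t) - 1) * ∫ η, W η ∂μ))
      (𝓝[>] 0) (𝓝 (∫ η, u t η ∂μ + 0 * ((Real.exp (K * t) - 1) * ∫ η, W η ∂μ))) :=
    ((continuous_const.add (continuous_id.mul continuous_const)).tendsto 0).mono_left
      nhdsWithin_le_nhds
  rw [zero_mul, add_zero] at hlim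
  exact ge_of_tendsto hlim (eventually_nhdsWithin_of_forall key)

theorem integral_eq_of_solution {θ : ℝ} (hθ : AdmissibleTheta θ) {p : V → V → ℝ}
    (hp0 : ∀ i j, 0 ≤ p i j) {site : Side → V} {c ρ : Side → ℝ}
    (hc : ∀ s, 0 ≤ c s) (hρ : ∀ s, 0 ≤ ρ s) (hθρ : ∀ s, 0 ≤ 1 + θ * ρ s)
    {μ : Measure (V → ℕ)} (hμ : IsStationary θ p site c ρ μ)
    (hmom : ∀ m : ℕ, Integrable (fun η : V → ℕ => sizeSucc η ^ m) μ)
    {u : ℝ → (V → ℕ) → ℝ} (hu : ∀ η ∈ stateSpace V θ, ∀ t, 0 ≤ t →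
      HasDerivWithinAt (fun s => u s η) ((reservoirSystem θ p site c ρ).generator (u t) η)
        (Set.Ici 0) t)
    {B : ℝ} {m : ℕ} (hB : 0 ≤ B) (hbound : ∀ t, 0 ≤ t → ∀ η, |u t η| ≤ B * sizeSucc η ^ m)
    {t : ℝ} (ht : 0 ≤ t) : ∫ η, u t η ∂μ = ∫ η, u 0 η ∂μ := by
  refine le_antisymm ?_
    (integral_le_of_solution hθ hp0 hc hρ hθρ hμ hmom hu hB hbound ht)
  have h := integral_le_of_solution hθ hp0 hc hρ hθρ hμ hmom (u := fun s η => -u s η)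
    (fun η hη s hs => by
      have e : (reservoirSystem θ p site c ρ).generator (fun η => -u s η) η =
          -(reservoirSystem θ p site c ρ).generator (u s) η := by
        simp only [JumpSystem.generator, ← Finset.sum_neg_distrib]
        exact Finset.sum_congr rfl fun _ _ => by ring
      rw [e]
      exact (hu η hη s hs).neg) hB (fun s hs η => by rw [abs_neg]; exact hbound s hs η) ht
  rw [integral_neg, integral_neg] at h
  linarith

/-- The stationary expectation of the duality function centred at the left density. -/
theorem integral_configDual {θ : ℝ} (hθ : AdmissibleTheta θ) {p : V → V → ℝ}
    (hp0 : ∀ i j, 0 ≤ p i j) (hp : ∀ i j, p i j = p j i) {site : Side → V} {c ρ : Side → ℝ}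
    (hc : ∀ s, 0 ≤ c s) (hρ : ∀ s, 0 ≤ ρ s) (hθρ : ∀ s, 0 ≤ 1 + θ * ρ s)
    {μ : Measure (V → ℕ)} (hμ : IsStationary θ p site c ρ μ)
    {v : V → ℝ} (hv : IsAbsorptionTime p site c v) {n : ℕ} {ξ : V ⊕ Side → ℕ}
    (hξ : ξ ∈ dualFinset V θ n) :
    ∫ η, configDual θ (ρ .left) ρ ξ η ∂μ =
      (ρ .right - ρ .left) ^ n * noLeftLimit θ p site c ξ := by
  have := hμ.1
  have hmom := integrable_sizeSucc_pow hθ hp0 hp hc hρ hθρ hμ hv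
  set r := ρ .left
  obtain ⟨B, m, hB, hbound⟩ := abs_dualFlow_le hθ hp0 site hc ρ r hξ
  have hconst : ∀ t, 0 ≤ t → ∫ η, dualFlow θ p site c ρ r n ξ t η ∂μ =
      ∫ η, configDual θ r ρ ξ η ∂μ := by
    intro t ht
    rw [integral_eq_of_solution hθ hp0 hc hρ hθρ hμ hmom (fun η hη s hs =>
      hasDerivWithinAt_dualFlow hθ hp0 hp site hc ρ r hξ hη hs) hB hbound ht]
    simp only [dualFlow_zero p site c ρ r hξ]
  have hpt : ∀ η : V → ℕ, Tendsto (fun t => dualFlow θ p site c ρ r n ξ t η) atTop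
      (𝓝 ((ρ .right - r) ^ n * noLeftLimit θ p site c ξ)) := by
    intro η
    have h0 := (tendsto_finExpect_noneAt hθ hp0 site hc hξ).const_mul ((ρ .right - r) ^ n)
    simp only [← JumpSystem.finExpect_const_mul] at h0
    refine tendsto_finExpect_of_absorbed hθ hp0 hp hc hv hξ (fun y hy hy0 => ?_) h0
    have hside : ∀ f : Side → ℝ, ∏ s, f s = f .left * f .right := fun f => by
      have : (Finset.univ : Finset Side) = {.left, .right} := rfl
      rw [this, Finset.prod_pair (by decide)]
    have hsum : y (.inr .left) + y (.inr .right) = n := by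
      rw [← (mem_dualFinset.1 hy).2, Fintype.sum_sum_type]
      have : (Finset.univ : Finset Side) = {.left, .right} := rfl
      rw [this, Finset.sum_pair (by decide)]
      simp [hy0]
    -- Centring at the left density gives left-absorbed particles the weight `0`; by `0 ^ 0 = 1` a
    -- weight survives exactly when there are none, and then all `n` particles are on the right.
    rw [configDual_of_absorbed θ r ρ hy0, hside, noneAt]
    split_ifs with h
    · rw [h, zero_add] at hsum
      rw [h, hsum]; ring
    · simp [r, h]
  -- The polynomial bound on the flow is uniform in time and integrable, so the limit may be taken
  -- under the integral.
  have hlim := tendsto_integral_filter_of_dominated_convergence (μ := μ)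
    (F := fun t η => dualFlow θ p site c ρ r n ξ t η) (l := atTop)
    (fun η => B * sizeSucc η ^ m)
    (Eventually.of_forall fun t => Measurable.of_discrete.aestronglyMeasurable)
    ((eventually_ge_atTop 0).mono fun t ht => Eventually.of_forall (hbound t ht))
    ((hmom m).const_mul B) (Eventually.of_forall hpt)
  have hlim' : Tendsto (fun t => ∫ η, dualFlow θ p site c ρ r n ξ t η ∂μ) atTop
      (𝓝 (∫ η, configDual θ r ρ ξ η ∂μ)) := by
    refine tendsto_const_nhds.congr' ?_
    filter_upwards [eventually_ge_atTop 0] with t ht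
    exact (hconst t ht).symm
  have := tendsto_nhds_unique hlim' hlim
  simpa using this

/-! ### Correlations at distinct sites -/

theorem config_inl_apply {V : Type*} [DecidableEq V] {ι : Type*} [Fintype ι] {x : ι → V} (hx : Function.Injective x) (i : V) :
    config (fun a => (Sum.inl (x a) : V ⊕ Side)) (.inl i) =
      if i ∈ Finset.univ.image x then 1 else 0 := by
  classical
  simp only [config, Finset.sum_apply, delta_apply, Sum.inl.injEq]
  split_ifs with h
  · obtain ⟨a, -, rfl⟩ := Finset.mem_image.1 h
    simp [hx.eq_iff]
  · refine Finset.sum_eq_zero fun a _ => if_neg fun h' => h ?_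
    exact Finset.mem_image.2 ⟨a, Finset.mem_univ a, h'.symm⟩

theorem config_inl_mem_dualFinset {ι : Type*} [Fintype ι] {θ : ℝ} (hθ : AdmissibleTheta θ)
    {x : ι → V} (hx : Function.Injective x) :
    config (fun a => (Sum.inl (x a) : V ⊕ Side)) ∈ dualFinset V θ (Fintype.card ι) := by
  refine mem_dualFinset.2 ⟨fun i => occupation_of_le (one_mem_occupation hθ) ?_, ?_⟩
  · rw [config_inl_apply hx]; split_ifs <;> simp
  · simp only [config, Finset.sum_apply]
    rw [Finset.sum_comm]
    simp [delta_apply]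

/-- At distinct sites the dual occupation numbers are `0` or `1`, where `siteDual` is `1` or `n -
r`, and no particle has been absorbed. -/
theorem configDual_config {ι : Type*} [Fintype ι] (θ r : ℝ) (ρ : Side → ℝ) {x : ι → V}
    (hx : Function.Injective x) (η : V → ℕ) :
    configDual θ r ρ (config fun a => (Sum.inl (x a) : V ⊕ Side)) η = ∏ a, ((η (x a) : ℝ) - r) := by
  have hs : ∀ s, config (fun a => (Sum.inl (x a) : V ⊕ Side)) (.inr s) = 0 := fun s =>
    (config_eq_zero_iff _ _).2 fun a => by simp
  have h : ∀ i, siteDual θ r (config (fun a => (Sum.inl (x a) : V ⊕ Side)) (.inl i)) (η i) =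
      if i ∈ Finset.univ.image x then (η i : ℝ) - r else 1 := by
    intro i
    rw [config_inl_apply hx]
    split_ifs
    exacts [siteDual_one_left θ r _, siteDual_zero_left θ r _]
  simp only [configDual, hs, h, pow_zero, Finset.prod_const_one, mul_one]
  rw [Finset.prod_ite_mem, Finset.univ_inter, Finset.prod_image hx.injOn]

theorem integral_prod_sub {θ : ℝ} (hθ : AdmissibleTheta θ) {p : V → V → ℝ}
    (hp0 : ∀ i j, 0 ≤ p i j) (hp : ∀ i j, p i j = p j i) {site : Side → V} {c ρ : Side → ℝ}
    (hc : ∀ s, 0 ≤ c s) (hρ : ∀ s, 0 ≤ ρ s) (hθρ : ∀ s, 0 ≤ 1 + θ * ρ s)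
    {μ : Measure (V → ℕ)} (hμ : IsStationary θ p site c ρ μ)
    {v : V → ℝ} (hv : IsAbsorptionTime p site c v) {ι : Type*} [Fintype ι] {x : ι → V}
    (hx : Function.Injective x) :
    ∫ η, ∏ a, ((η (x a) : ℝ) - ρ .left) ∂μ = (ρ .right - ρ .left) ^ Fintype.card ι *
      noLeftLimit θ p site c (config fun a => Sum.inl (x a)) := by
  rw [← integral_configDual hθ hp0 hp hc hρ hθρ hμ hv (config_inl_mem_dualFinset hθ hx)]
  simp only [configDual_config θ _ ρ hx]

theorem PolyBounded.integrable {V : Type*} [Fintype V] {μ : Measure (V → ℕ)}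
    (hmom : ∀ m : ℕ, Integrable (fun η : V → ℕ => sizeSucc η ^ m) μ) {f : (V → ℕ) → ℝ}
    (hf : PolyBounded sizeSucc f) : Integrable f μ := by
  obtain ⟨B, m, -, h⟩ := hf
  exact ((hmom m).const_mul B).mono' Measurable.of_discrete.aestronglyMeasurable
    (Eventually.of_forall h)

theorem integral_apply {θ : ℝ} (hθ : AdmissibleTheta θ) {p : V → V → ℝ}
    (hp0 : ∀ i j, 0 ≤ p i j) (hp : ∀ i j, p i j = p j i) {site : Side → V} {c ρ : Side → ℝ}
    (hc : ∀ s, 0 ≤ c s) (hρ : ∀ s, 0 ≤ ρ s) (hθρ : ∀ s, 0 ≤ 1 + θ * ρ s)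
    {μ : Measure (V → ℕ)} (hμ : IsStationary θ p site c ρ μ)
    {v : V → ℝ} (hv : IsAbsorptionTime p site c v) (x : V) :
    ∫ η, (η x : ℝ) ∂μ =
      ρ .left + (ρ .right - ρ .left) * noLeftLimit θ p site c (delta (.inl x)) := by
  have := hμ.1
  have hmom := integrable_sizeSucc_pow hθ hp0 hp hc hρ hθρ hμ hv
  have h := integral_prod_sub hθ hp0 hp hc hρ hθρ hμ hv (x := fun _ : Unit => x)
    fun _ _ _ => rfl
  simp only [config, Finset.univ_unique, Finset.sum_singleton, Finset.prod_singleton, Fintype.card_unit, pow_one] at h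
  rw [integral_sub ((polyBounded_apply x).integrable hmom) (integrable_const _)] at h
  simp only [integral_const, probReal_univ, one_smul] at h
  linarith

/-- The product of the occupation numbers, expanded around the left density. -/
theorem integral_prod_apply {θ : ℝ} (hθ : AdmissibleTheta θ) {p : V → V → ℝ}
    (hp0 : ∀ i j, 0 ≤ p i j) (hp : ∀ i j, p i j = p j i) {site : Side → V} {c ρ : Side → ℝ}
    (hc : ∀ s, 0 ≤ c s) (hρ : ∀ s, 0 ≤ ρ s) (hθρ : ∀ s, 0 ≤ 1 + θ * ρ s)
    {μ : Measure (V → ℕ)} (hμ : IsStationary θ p site c ρ μ)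
    {v : V → ℝ} (hv : IsAbsorptionTime p site c v) {n : ℕ} {x : Fin n → V}
    (hx : Function.Injective x) :
    ∫ η, ∏ i, (η (x i) : ℝ) ∂μ - ∏ i, ∫ η, (η (x i) : ℝ) ∂μ =
      ∑ κ ∈ Finset.Icc 2 n, gammaCoeff θ p site c x κ *
        (ρ .right - ρ .left) ^ κ * ρ .left ^ (n - κ) := by
  have hmom := integrable_sizeSucc_pow hθ hp0 hp hc hρ hθρ hμ hv
  set r := ρ .left
  set d := ρ .right - r
  set g : Finset (Fin n) → ℝ := fun I =>
    noLeftLimit θ p site c (config fun i : I => Sum.inl (x i))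
  set h : Finset (Fin n) → ℝ := fun I =>
    irwNoLeftLimit θ p site c fun i : I => (Sum.inl (x i) : V ⊕ Side)
  have hh : ∀ I, h I = ∏ i ∈ I, noLeftLimit θ p site c (delta (.inl (x i))) := fun I => by
    simp only [h, irwNoLeftLimit_eq hθ hp0 site hc]
    exact Finset.prod_coe_sort I fun i => noLeftLimit θ p site c (delta (.inl (x i)))
  have h1 : ∫ η, ∏ i, (η (x i) : ℝ) ∂μ =
      ∑ I : Finset (Fin n), g I * d ^ I.card * r ^ (n - I.card) := by
    have e : ∀ η : V → ℕ, ∏ i, (η (x i) : ℝ) =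
        ∑ I : Finset (Fin n), (∏ i : I, ((η (x i) : ℝ) - r)) * r ^ (n - I.card) := by
      intro η
      have h2 : ∏ i, (η (x i) : ℝ) = ∏ i, (((η (x i) : ℝ) - r) + r) :=
        Finset.prod_congr rfl fun i _ => by ring
      rw [h2, Finset.prod_add, Finset.powerset_univ]
      refine Finset.sum_congr rfl fun I _ => ?_
      rw [Finset.prod_const, ← Finset.compl_eq_univ_sdiff, Finset.card_compl, Fintype.card_fin,
        Finset.prod_coe_sort I fun i => ((η (x i) : ℝ) - r)]
    simp only [e]
    rw [integral_finsetSum]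
    · refine Finset.sum_congr rfl fun I _ => ?_
      rw [integral_mul_const, integral_prod_sub hθ hp0 hp hc hρ hθρ hμ hv
        (x := fun i : I => x i) (hx.comp Subtype.val_injective), Fintype.card_coe]
      ring
    · intro I _
      refine Integrable.mul_const (PolyBounded.integrable hmom ?_) _
      exact PolyBounded.prod one_le_sizeSucc _ fun i _ =>
        (polyBounded_apply _).sub one_le_sizeSucc (PolyBounded.const _ _)
  have h2 : ∏ i, ∫ η, (η (x i) : ℝ) ∂μ =
      ∑ I : Finset (Fin n), h I * d ^ I.card * r ^ (n - I.card) := by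
    -- Each mean is `r + d * P(no left absorption)`. The product expands over the same subsets as
    -- the moment, and independence makes the coefficients equal to `h I`.
    simp only [integral_apply hθ hp0 hp hc hρ hθρ hμ hv]
    rw [Finset.prod_congr rfl fun i _ => add_comm _ _, Finset.prod_add, Finset.powerset_univ]
    refine Finset.sum_congr rfl fun I _ => ?_
    rw [Finset.prod_const, ← Finset.compl_eq_univ_sdiff, Finset.card_compl, Fintype.card_fin, hh,
      Finset.prod_mul_distrib, Finset.prod_const]
    ring
  -- With no particle both probabilities are `1`, and a single particle has nothing to interact
  -- with.
  have hsmall : ∀ I : Finset (Fin n), I.card < 2 → g I = h I := by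
    intro I hI
    rw [hh]
    rcases Nat.lt_succ_iff_lt_or_eq.1 hI with h0 | h1
    · have hI0 : I = ∅ := Finset.card_eq_zero.1 (by omega)
      subst hI0
      have hc0 : (config fun i : (∅ : Finset (Fin n)) => (Sum.inl (x i) : V ⊕ Side)) = 0 := by
        simp [config]
      have hmem : (0 : V ⊕ Side → ℕ) ∈ dualFinset V θ 0 :=
        mem_dualFinset.2 ⟨fun i => occupation_of_le (one_mem_occupation hθ) (by simp), by simp⟩
      simp only [g, hc0, Finset.prod_empty]
      refine tendsto_nhds_unique (tendsto_finExpect_noneAt hθ hp0 site hc hmem)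
        (tendsto_const_nhds.congr' ?_)
      filter_upwards [eventually_ge_atTop 0] with t ht
      rw [← JumpSystem.finExpect_one (dualSystem_invariant hθ hp0 site hc 0) hmem ht]
      refine JumpSystem.finExpect_congr (fun y hy => ?_) t _
      have := Finset.sum_eq_zero_iff.1 (mem_dualFinset.1 hy).2 (.inr .left) (Finset.mem_univ _)
      simp [noneAt, this]
    · obtain ⟨i, rfl⟩ := Finset.card_eq_one.1 h1
      simp only [g, Finset.prod_singleton]
      rw [config, Finset.sum_coe_sort {i} fun j => delta (Sum.inl (x j) : V ⊕ Side),
        Finset.sum_singleton]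
  have hgamma : ∀ κ, gammaCoeff θ p site c x κ * d ^ κ * r ^ (n - κ) =
      ∑ I ∈ (Finset.univ : Finset (Fin n)).powersetCard κ,
        (g I - h I) * d ^ I.card * r ^ (n - I.card) := by
    intro κ
    rw [gammaCoeff, Finset.sum_mul, Finset.sum_mul]
    refine Finset.sum_congr rfl fun I hI => ?_
    rw [(Finset.mem_powersetCard.1 hI).2]
  simp only [hgamma]
  rw [h1, h2, ← Finset.sum_sub_distrib, ← Finset.powerset_univ,
    Finset.sum_powerset Finset.univ fun I => g I * d ^ I.card * r ^ (n - I.card) -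
      h I * d ^ I.card * r ^ (n - I.card), Finset.card_univ, Fintype.card_fin]
  symm
  refine (Finset.sum_subset (fun κ hκ => ?_) fun κ hκ hκ' => ?_).trans
    (Finset.sum_congr rfl fun κ _ => Finset.sum_congr rfl fun I _ => by ring)
  · simp only [Finset.mem_Icc, Finset.mem_range] at hκ ⊢; omega
  · refine Finset.sum_eq_zero fun I hI => ?_
    have hcard := (Finset.mem_powersetCard.1 hI).2
    simp only [Finset.mem_Icc, Finset.mem_range] at hκ hκ'
    rw [hsmall I (by omega), sub_self, zero_mul, zero_mul]

end SteadyState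

end ConsistentIPS

/-! ### Assembly of the three statements -/

open ConsistentIPS in
theorem corollary7p2 (N : ℕ) (hN : 0 < N) (θ : ℝ) (hθ : AdmissibleTheta θ)
    (p : Fin N → Fin N → ℝ) (hp_nonneg : ∀ i j, 0 ≤ p i j) (hp_symm : ∀ i j, p i j = p j i)
    (c ρ : Side → ℝ) (hc : ∀ s, 0 ≤ c s) (hρ : ∀ s, 0 ≤ ρ s) (hθρ : ∀ s, 0 ≤ 1 + θ * ρ s)
    (μ : Measure (Fin N → ℕ)) (hμ : IsStationary θ p (endSite hN) c ρ μ)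
    (hμ_unique : ∀ ν : Measure (Fin N → ℕ), IsStationary θ p (endSite hN) c ρ ν → ν = μ) :
    -- the one-point function
    (∀ x : Fin N,
      (∀ s, Tendsto (fun t => walkProb θ p (endSite hN) c t (.inl x) (.inr s)) atTop
        (𝓝 (walkLimit θ p (endSite hN) c (.inl x) (.inr s)))) ∧
      Integrable (fun η : Fin N → ℕ => (η x : ℝ)) μ ∧
      ∫ η, (η x : ℝ) ∂μ = ∑ s, ρ s * walkLimit θ p (endSite hN) c (.inl x) (.inr s)) ∧
    -- the correlation functions at distinct sites
    (∀ (n : ℕ) (x : Fin n → Fin N), Function.Injective x →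
      (∀ I : Finset (Fin n),
        Tendsto (fun t => noLeftProb θ p (endSite hN) c t (config fun i : I => Sum.inl (x i)))
          atTop (𝓝 (noLeftLimit θ p (endSite hN) c (config fun i : I => Sum.inl (x i)))) ∧
        Tendsto (fun t => irwNoLeftProb θ p (endSite hN) c t fun i : I => Sum.inl (x i))
          atTop (𝓝 (irwNoLeftLimit θ p (endSite hN) c fun i : I => Sum.inl (x i)))) ∧
      Integrable (fun η : Fin N → ℕ => ∏ i, (η (x i) : ℝ)) μ ∧
      ∫ η, ∏ i, (η (x i) : ℝ) ∂μ - ∏ i, ∫ η, (η (x i) : ℝ) ∂μ =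
        ∑ κ ∈ Finset.Icc 2 n, gammaCoeff θ p (endSite hN) c x κ *
          (ρ .right - ρ .left) ^ κ * ρ .left ^ (n - κ)) ∧
    -- the covariance
    (∀ x y : Fin N, x ≠ y →
      Integrable (fun η : Fin N → ℕ => (η x : ℝ) * (η y : ℝ)) μ ∧
      ∫ η, (η x : ℝ) * (η y : ℝ) ∂μ - (∫ η, (η x : ℝ) ∂μ) * ∫ η, (η y : ℝ) ∂μ =
        (ρ .right - ρ .left) ^ 2 *
          (noLeftLimit θ p (endSite hN) c (delta (.inl x) + delta (.inl y)) -
            irwNoLeftLimit θ p (endSite hN) c ![.inl x, .inl y])) := by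
  have := hμ.1
  obtain ⟨v, hv⟩ := exists_isAbsorptionTime hθ hp_nonneg hp_symm hc hρ hθρ hμ hμ_unique
  have hmom := integrable_sizeSucc_pow hθ hp_nonneg hp_symm hc hρ hθρ hμ hv
  have hside : (Finset.univ : Finset Side) = {.left, .right} := rfl
  refine ⟨fun x => ⟨fun s => tendsto_walkProb hθ hp_nonneg _ hc _ s,
    (polyBounded_apply x).integrable hmom, ?_⟩, fun n x hx => ⟨fun I => ⟨?_, ?_⟩, ?_, ?_⟩,
    fun x y hxy => ⟨?_, ?_⟩⟩
  · rw [integral_apply hθ hp_nonneg hp_symm hc hρ hθρ hμ hv, hside,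
      Finset.sum_pair (by decide), walkLimit_left hθ hp_nonneg _ hc,
      walkLimit_right hθ hp_nonneg hp_symm hc hv]
    ring
  · exact tendsto_noLeftProb hθ hp_nonneg _ hc (mem_dualFinset.1 (config_inl_mem_dualFinset hθ
      (x := fun i : I => x i) (hx.comp Subtype.val_injective))).1
  · rw [irwNoLeftLimit_eq hθ hp_nonneg _ hc]
    exact tendsto_irwNoLeftProb hθ hp_nonneg _ hc _
  · exact PolyBounded.integrable hmom
      (PolyBounded.prod one_le_sizeSucc _ fun i _ => polyBounded_apply _)
  · exact integral_prod_apply hθ hp_nonneg hp_symm hc hρ hθρ hμ hv hx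
  · exact PolyBounded.integrable hmom
      ((polyBounded_apply x).mul one_le_sizeSucc (polyBounded_apply y))
  · have hx : Function.Injective ![x, y] := by
      intro i j hij
      fin_cases i <;> fin_cases j <;> simp_all [hxy.symm]
    have h := integral_prod_sub hθ hp_nonneg hp_symm hc hρ hθρ hμ hv hx
    have hcfg : (config fun a => (Sum.inl (![x, y] a) : Fin N ⊕ Side)) =
        delta (.inl x) + delta (.inl y) := by
      simp [config, Fin.sum_univ_two]
    rw [hcfg, Fintype.card_fin] at h
    simp only [Fin.prod_univ_two, Matrix.cons_val_zero, Matrix.cons_val_one] at h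
    have hxi := (polyBounded_apply x).integrable hmom
    have hyi := (polyBounded_apply y).integrable hmom
    have hxyi : Integrable (fun η : Fin N → ℕ => (η x : ℝ) * (η y : ℝ)) μ :=
      PolyBounded.integrable hmom
        ((polyBounded_apply x).mul one_le_sizeSucc (polyBounded_apply y))
    -- The centred second moment is `(ρ_right - ρ_left) ^ 2` times the two-particle probability.
    -- Expanding it and inserting the one-point functions leaves the covariance.
    have e : ∫ η : Fin N → ℕ, ((η x : ℝ) - ρ .left) * ((η y : ℝ) - ρ .left) ∂μ =
        ∫ η : Fin N → ℕ, (η x : ℝ) * (η y : ℝ) ∂μ - ρ .left * ∫ η : Fin N → ℕ, (η x : ℝ) ∂μ -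
          ρ .left * ∫ η : Fin N → ℕ, (η y : ℝ) ∂μ + ρ .left ^ 2 := by
      have e1 : ∀ η : Fin N → ℕ, ((η x : ℝ) - ρ .left) * ((η y : ℝ) - ρ .left) =
          (η x : ℝ) * (η y : ℝ) - ρ .left * (η x : ℝ) - ρ .left * (η y : ℝ) + ρ .left ^ 2 :=
        fun η => by ring
      have i1 : Integrable (fun η : Fin N → ℕ =>
          (η x : ℝ) * (η y : ℝ) - ρ .left * (η x : ℝ)) μ := hxyi.sub (hxi.const_mul _)
      have i2 : Integrable (fun η : Fin N → ℕ =>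
          (η x : ℝ) * (η y : ℝ) - ρ .left * (η x : ℝ) - ρ .left * (η y : ℝ)) μ :=
        i1.sub (hyi.const_mul _)
      simp only [e1]
      rw [integral_add i2 (integrable_const _), integral_sub i1 (hyi.const_mul _), integral_sub hxyi (hxi.const_mul _), integral_const_mul, integral_const_mul]
      simp
    rw [e] at h
    rw [irwNoLeftLimit_eq hθ hp_nonneg _ hc]
    simp only [Fin.prod_univ_two, Matrix.cons_val_zero, Matrix.cons_val_one]
    have hx1 := integral_apply hθ hp_nonneg hp_symm hc hρ hθρ hμ hv x
    have hy1 := integral_apply hθ hp_nonneg hp_symm hc hρ hθρ hμ hv y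
    rw [hx1, hy1] at h ⊢
    linear_combination h
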